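/- Let $q\in\mathbb{C}^\times$ and let $A=\widetilde{\mathcal O}_q(\mathrm{GL}(2))$ be the Takhtajan–Sudbery Hopf algebra: generators $a,b,c,d,D^{-1}$ with $ab=q^{-1}ba$, $ac=q\,ca$, $cd=q^{-1}dc$, $bd=q\,db$, $bc=q^2cb$, $ad=da$, where $D^{-1}$ is the inverse of $D=ad-q^{-1}bc$, commutes with $a,d$, and satisfies $bD^{-1}=q^{-2}D^{-1}b$, $cD^{-1}=q^{2}D^{-1}c$; the coproduct and counit are the matrix ones, with $D^{-1}$ group-like. Let $H=A/(c)$, and let $t,n,s,\tilde D^{-1}$ be the classes of $a,b,d,D^{-1}$, so that $t^{-1}=s\tilde D^{-1}$; let $H_0=H/(n)$. These are quotients by Hopf ideals. Let $\mathbf P^1=\mathbf P^1(\mathbb C)$ carry the topology generated by the charts $U_1=\{x_0\ne0\}$, $U_2=\{x_1\neq 0\}$, and the structure sheaf $\mathcal O(U_1)=\mathbb C[z]$, $\mathcal O(U_2)=\mathbb C[z^{-1}]$, $\mathcal O(U_1\cap U_2)=\mathbb C[z^{\pm1}]$, $\mathcal O(\mathbf P^1)=\mathbb C$, $z=x_1/x_0$.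 Let $\mathcal F$ be the following presheaf of right $H$-comodule algebras on $\mathbf P^1$. For $U\ne\emptyset$, $\mathcal F(U)$ is generated by $a,c,x,D^{\pm1}$, together with $a^{-1}$ if $U\subseteq U_1$ and $c^{-1}$ if $U\subseteq U_2$, subject to $$ac=q\,ca,\quad ax=q^{-1}xa,\quad cx=q^{-1}xc,\quad aD=Da,\quad cD=q^{-2}Dc,\quad xD=q^2Dx$$ and the relations saying that $D^{\pm1}$, $a^{\pm1}$, $c^{\pm1}$ are mutually inverse; $\mathcal F(\emptyset)=0$. The restriction maps send each generator to the generator of the same name. The coaction is the algebra map with $a\mapsto a\otimes t$, $c\mapsto c\otimes t$, $D^{\pm1}\mapsto D^{\pm1}\otimes (ts)^{\pm1}$, $x\mapsto 1\otimes t^{-1}n+x\otimes t^{-1}s$. In $\mathcal F(U_2)$ the generator $x$ is also denoted $y$. Let $\mathcal F_0(U)=\mathcal F(U)/(x)$ with the induced restriction maps and the induced $H_0$-coaction; thus $\mathcal F_0(U_1)=\mathcal F(U_1)/(x)$ and $\mathcal F_0(U_2)=\mathcal F(U_2)/(y)$. A right comodule algebra $E$ over a Hopf algebra $K$ (with bijective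 antipode), with coinvariants $B=E^{\mathrm{co}K}$, is *principal* if $E\otimes_BE\to E\otimes K$, $e'\otimes e\mapsto e'e_{(0)}\otimes e_{(1)}$, is bijective and $E$ is faithfully flat over $B$ on both sides; it is *cleft* if there is a convolution-invertible $K$-comodule map $K\to E$. Left comodule algebras are treated symmetrically. A sheaf $\mathcal E$ of $K$-comodule algebras is a *quantum principal $K$-bundle* over $(\mathbf P^1,\mathcal O)$ for the cover $\{U_1,U_2\}$ if each $\mathcal E(U_i)$ is principal and there is a sheaf morphism $\mathcal O\to\mathcal E$ that maps each $\mathcal O(U_i)$ isomorphically onto $\mathcal E(U_i)^{\mathrm{co}K}$; it is *locally cleft* if moreover each $\mathcal E(U_i)$ is cleft. The bundle $\mathcal F_0$ is an *algebraic reduction* of $\mathcal F$ by means of a morphism of sheaves of algebras $\varphi:\mathcal F\to\mathcal F_0$ if $\mathcal F$ and $\mathcal F_0$ are quantum principal bundles for the cover $\{U_1,U_2\}$, for $H$ and $H_0$ respectively, $H$ is a principal left $H_0$-comodule algebra, each $\varphi_U$ is a map of $H_0$-comodules, and for $i=1,2$ the map $\varphi_{U_i}$ is surjective with $\varphi_{U_i}(\mathcal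 F(U_i)^{\mathrm{co}H})=\mathcal F_0(U_i)^{\mathrm{co}H_0}$, and these two algebras of coinvariants are isomorphic. **Proposition.** 1. $\mathcal F_0$ is a (sheaf and a) locally cleft quantum principal $H_0$-bundle over $(\mathbf P^1,\mathcal O)$ for the cover $\{U_1,U_2\}$. 2. The quotient maps $\mathcal F(U)\to\mathcal F_0(U)$ commute with the restriction maps, and by means of them $\mathcal F_0$ is an algebraic reduction of $\mathcal F$; in particular $\mathcal F$ is a (sheaf and a) quantum principal $H$-bundle. 3. $\mathcal F(U_1)$ is the localization $A[a^{-1}]$ with $x=a^{-1}b$, and $\mathcal F(U_2)$ is the localization $A[c^{-1}]$ with $y=c^{-1}d$, where $a,c,D$ in $A$ correspond to the generators $a,c,D$, compatibly with the coactions extending $(\mathrm{id}\otimes\mathrm{pr})\Delta:A\to A\otimes H$. Moreover $\mathcal F(U_1\cap U_2)$ is the localization $\mathcal F(U_1)[c^{-1}]$ and $\mathcal F(U_2)[a^{-1}]$. -/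

import Mathlib

open scoped TensorProduct
open CategoryTheory TopologicalSpace Opposite

noncomputable section

namespace QuantumBundle

/-! ## Modules over noncommutative rings: tensor product and faithful flatness

Right `B`-modules are modules over `Bᵐᵒᵖ`. -/

section Balanced

variable (B : Type) [Ring B]

/-- The subgroup of `N ⊗[ℤ] M` generated by all `n • b ⊗ m - n ⊗ b • m`. -/
def balancedRelations (N M : Type) [AddCommGroup N] [Module Bᵐᵒᵖ N] [AddCommGroup M]
    [Module B M] : AddSubgroup (N ⊗[ℤ] M) :=
  AddSubgroup.closure
    {w | ∃ (n : N) (b : B) (m : M), w = (MulOpposite.op b • n) ⊗ₜ[ℤ] m - n ⊗ₜ[ℤ] (b • m)}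

/-- The tensor product `N ⊗_B M` of a right `B`-module `N` and a left `B`-module `M`. -/
abbrev BalancedTensor (N M : Type) [AddCommGroup N] [Module Bᵐᵒᵖ N] [AddCommGroup M]
    [Module B M] : Type :=
  (N ⊗[ℤ] M) ⧸ balancedRelations B N M

variable {B}

/-- The map `f ⊗_B g`. -/
def BalancedTensor.map {N N' M M' : Type} [AddCommGroup N] [Module Bᵐᵒᵖ N] [AddCommGroup N']
    [Module Bᵐᵒᵖ N'] [AddCommGroup M] [Module B M] [AddCommGroup M'] [Module B M']
    (f : N →ₗ[Bᵐᵒᵖ] N') (g : M →ₗ[B] M') : BalancedTensor B N M →+ BalancedTensor B N' M' :=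
  QuotientAddGroup.map _ _
    (TensorProduct.map f.toAddMonoidHom.toIntLinearMap
      g.toAddMonoidHom.toIntLinearMap).toAddMonoidHom <| by
    rw [balancedRelations, AddSubgroup.closure_le]
    rintro _ ⟨n, b, m, rfl⟩
    refine AddSubgroup.subset_closure ⟨f n, b, g m, ?_⟩
    rw [map_sub]
    change f (MulOpposite.op b • n) ⊗ₜ[ℤ] g m - f n ⊗ₜ[ℤ] g (b • m) = _
    rw [map_smul, map_smul]

variable (B)

/-- The left `B`-module `M` is faithfully flat: a sequence of right `B`-modules is exact if and
only if it is exact after applying `- ⊗_B M`. -/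
def IsFaithfullyFlatLeft (M : Type) [AddCommGroup M] [Module B M] : Prop :=
  ∀ (N₁ N₂ N₃ : Type) [AddCommGroup N₁] [AddCommGroup N₂] [AddCommGroup N₃]
    [Module Bᵐᵒᵖ N₁] [Module Bᵐᵒᵖ N₂] [Module Bᵐᵒᵖ N₃]
    (f : N₁ →ₗ[Bᵐᵒᵖ] N₂) (g : N₂ →ₗ[Bᵐᵒᵖ] N₃),
    Function.Exact f g ↔
      Function.Exact (BalancedTensor.map f (LinearMap.id : M →ₗ[B] M))
        (BalancedTensor.map g (LinearMap.id : M →ₗ[B] M))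

/-- The right `B`-module `N` is faithfully flat: a sequence of left `B`-modules is exact if and
only if it is exact after applying `N ⊗_B -`. -/
def IsFaithfullyFlatRight (N : Type) [AddCommGroup N] [Module Bᵐᵒᵖ N] : Prop :=
  ∀ (M₁ M₂ M₃ : Type) [AddCommGroup M₁] [AddCommGroup M₂] [AddCommGroup M₃]
    [Module B M₁] [Module B M₂] [Module B M₃]
    (f : M₁ →ₗ[B] M₂) (g : M₂ →ₗ[B] M₃),
    Function.Exact f g ↔
      Function.Exact (BalancedTensor.map (LinearMap.id : N →ₗ[Bᵐᵒᵖ] N) f)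
        (BalancedTensor.map (LinearMap.id : N →ₗ[Bᵐᵒᵖ] N) g)

end Balanced

/-- An algebra is a right module over each of its subalgebras, by right multiplication. -/
instance subalgebraRightModule {k A : Type} [Field k] [Ring A] [Algebra k A]
    (B : Subalgebra k A) : Module (↥B)ᵐᵒᵖ A :=
  Module.compHom A (RingHom.op (B.val : ↥B →+* A))

theorem subalgebra_op_smul {k A : Type} [Field k] [Ring A] [Algebra k A]
    (B : Subalgebra k A) (b : B) (a : A) : MulOpposite.op b • a = a * (b : A) := rfl

/-! ## Comodule algebras, Hopf-Galois and cleft extensions -/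

/-- The structure of a right `H`-comodule algebra on the algebra `A`. -/
structure RightCoaction (k H A : Type) [Field k] [Ring H] [Bialgebra k H] [Ring A]
    [Algebra k A] where
  /-- the coaction `A → A ⊗ H` -/
  toAlgHom : A →ₐ[k] A ⊗[k] H
  coassoc : (Algebra.TensorProduct.assoc k k k A H H).toAlgHom.comp
      ((Algebra.TensorProduct.map toAlgHom (AlgHom.id k H)).comp toAlgHom) =
    (Algebra.TensorProduct.map (AlgHom.id k A) (Bialgebra.comulAlgHom k H)).comp toAlgHom
  counit : (Algebra.TensorProduct.rid k k A).toAlgHom.comp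
      ((Algebra.TensorProduct.map (AlgHom.id k A) (Bialgebra.counitAlgHom k H)).comp toAlgHom) =
    AlgHom.id k A

/-- The structure of a left `H`-comodule algebra on the algebra `A`. -/
structure LeftCoaction (k H A : Type) [Field k] [Ring H] [Bialgebra k H] [Ring A]
    [Algebra k A] where
  /-- the coaction `A → H ⊗ A` -/
  toAlgHom : A →ₐ[k] H ⊗[k] A
  coassoc : (Algebra.TensorProduct.assoc k k k H H A).toAlgHom.comp
      ((Algebra.TensorProduct.map (Bialgebra.comulAlgHom k H) (AlgHom.id k A)).comp toAlgHom) =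
    (Algebra.TensorProduct.map (AlgHom.id k H) toAlgHom).comp toAlgHom
  counit : (Algebra.TensorProduct.lid k A).toAlgHom.comp
      ((Algebra.TensorProduct.map (Bialgebra.counitAlgHom k H) (AlgHom.id k A)).comp toAlgHom) =
    AlgHom.id k A

namespace RightCoaction

variable {k H A : Type} [Field k] [Ring H] [Bialgebra k H] [Ring A] [Algebra k A]
  (δ : RightCoaction k H A)

/-- The subalgebra `{b | δ b = b ⊗ 1}` of coinvariants. -/
def coinvariants : Subalgebra k A :=
  AlgHom.equalizer δ.toAlgHom (Algebra.TensorProduct.includeLeft : A →ₐ[k] A ⊗[k] H)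

theorem mem_coinvariants (b : A) : b ∈ δ.coinvariants ↔ δ.toAlgHom b = b ⊗ₜ[k] 1 := Iff.rfl

/-- The canonical map `a' ⊗_B a ↦ a' a₍₀₎ ⊗ a₍₁₎`, where `B` is the algebra of coinvariants. -/
def canonicalMap : BalancedTensor δ.coinvariants A A →+ A ⊗[k] H :=
  QuotientAddGroup.lift _
    (TensorProduct.liftAddHom ((AddMonoidHom.mul (R := A ⊗[k] H))
      |>.compl₂ (δ.toAlgHom : A →+ A ⊗[k] H)
      |>.comp ((Algebra.TensorProduct.includeLeft : A →ₐ[k] A ⊗[k] H) : A →+ A ⊗[k] H))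
      fun r m n => by rw [map_zsmul, map_zsmul]; rfl) <| by
    rw [balancedRelations, AddSubgroup.closure_le]
    rintro _ ⟨n, b, m, rfl⟩
    have hb : δ.toAlgHom (b : A) = (b : A) ⊗ₜ[k] 1 := b.2
    have h : (n * (b : A)) ⊗ₜ[k] (1 : H) = n ⊗ₜ[k] 1 * (b : A) ⊗ₜ[k] 1 := by simp
    rw [SetLike.mem_coe, AddMonoidHom.mem_ker, map_sub]
    change (n * (b : A)) ⊗ₜ[k] (1 : H) * δ.toAlgHom m -
      n ⊗ₜ[k] (1 : H) * δ.toAlgHom ((b : A) * m) = 0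
    rw [map_mul, hb, h, mul_assoc, sub_self]

theorem canonicalMap_mk (a' a : A) :
    δ.canonicalMap (QuotientAddGroup.mk (a' ⊗ₜ[ℤ] a)) = a' ⊗ₜ[k] 1 * δ.toAlgHom a := rfl

/-- The extension `B ⊆ A` is Hopf-Galois. -/
def IsGalois : Prop := Function.Bijective δ.canonicalMap

/-- A principal comodule algebra: a Hopf-Galois extension `B ⊆ A` with `A` faithfully flat over
`B` (on both sides). -/
structure IsPrincipal : Prop where
  galois : δ.IsGalois
  flat_left : IsFaithfullyFlatLeft δ.coinvariants A
  flat_right : IsFaithfullyFlatRight δ.coinvariants A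

/-- A cleft extension: there is a right comodule map `γ : H → A` that is invertible for the
convolution product. -/
def IsCleft : Prop :=
  ∃ γ : H →ₗ[k] A,
    δ.toAlgHom.toLinearMap ∘ₗ γ = γ.rTensor H ∘ₗ Coalgebra.comul ∧ IsUnit (WithConv.toConv γ)

end RightCoaction

namespace LeftCoaction

variable {k H A : Type} [Field k] [Ring H] [Bialgebra k H] [Ring A] [Algebra k A]
  (δ : LeftCoaction k H A)

/-- The subalgebra `{b | δ b = 1 ⊗ b}` of coinvariants. -/
def coinvariants : Subalgebra k A :=
  AlgHom.equalizer δ.toAlgHom (Algebra.TensorProduct.includeRight : A →ₐ[k] H ⊗[k] A)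

/-- The canonical map `a ⊗_B a' ↦ a₍₋₁₎ ⊗ a₍₀₎ a'`, where `B` is the algebra of coinvariants. -/
def canonicalMap : BalancedTensor δ.coinvariants A A →+ H ⊗[k] A :=
  QuotientAddGroup.lift _
    (TensorProduct.liftAddHom ((AddMonoidHom.mul (R := H ⊗[k] A))
      |>.compl₂ ((Algebra.TensorProduct.includeRight : A →ₐ[k] H ⊗[k] A) : A →+ H ⊗[k] A)
      |>.comp (δ.toAlgHom : A →+ H ⊗[k] A))
      fun r m n => by rw [map_zsmul, map_zsmul]; rfl) <| by
    rw [balancedRelations, AddSubgroup.closure_le]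
    rintro _ ⟨n, b, m, rfl⟩
    have hb : δ.toAlgHom (b : A) = 1 ⊗ₜ[k] (b : A) := b.2
    have h : (1 : H) ⊗ₜ[k] ((b : A) * m) = 1 ⊗ₜ[k] (b : A) * 1 ⊗ₜ[k] m := by simp
    rw [SetLike.mem_coe, AddMonoidHom.mem_ker, map_sub]
    change δ.toAlgHom (n * (b : A)) * (1 : H) ⊗ₜ[k] m -
      δ.toAlgHom n * (1 : H) ⊗ₜ[k] ((b : A) * m) = 0
    rw [map_mul, hb, h, mul_assoc, sub_self]

theorem canonicalMap_mk (a a' : A) :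
    δ.canonicalMap (QuotientAddGroup.mk (a ⊗ₜ[ℤ] a')) = δ.toAlgHom a * 1 ⊗ₜ[k] a' := rfl

/-- The left-handed version of `RightCoaction.IsPrincipal`. -/
structure IsPrincipal : Prop where
  galois : Function.Bijective δ.canonicalMap
  flat_left : IsFaithfullyFlatLeft δ.coinvariants A
  flat_right : IsFaithfullyFlatRight δ.coinvariants A

end LeftCoaction

/-! ## Reductions of principal comodule algebras -/

section Reduction

variable {k H : Type} [Field k] [Ring H] [HopfAlgebra k H] (J : Ideal H) [J.IsTwoSided]
  [J.IsHopfIdeal k]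

variable (k) in
/-- The projection of the coproduct makes `H` a left `H ⧸ J`-comodule algebra. -/
def quotientLeftCoaction : LeftCoaction k (H ⧸ J) H where
  toAlgHom := (Algebra.TensorProduct.map (Ideal.Quotient.mkₐ k J) (AlgHom.id k H)).comp
    (Bialgebra.comulAlgHom k H)
  coassoc := by
    apply AlgHom.toLinearMap_injective
    ext x
    have h := congr(Algebra.TensorProduct.map (Ideal.Quotient.mkₐ k J)
      (Algebra.TensorProduct.map (Ideal.Quotient.mkₐ k J) (AlgHom.id k H))
      $(Coalgebra.coassoc_apply (R := k) x))
    have key₁ : ∀ y : H ⊗[k] H, Algebra.TensorProduct.assoc k k k (H ⧸ J) (H ⧸ J) H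
        (Algebra.TensorProduct.map (Bialgebra.comulAlgHom k (H ⧸ J)) (AlgHom.id k H)
          (Algebra.TensorProduct.map (Ideal.Quotient.mkₐ k J) (AlgHom.id k H) y)) =
        Algebra.TensorProduct.map (Ideal.Quotient.mkₐ k J)
          (Algebra.TensorProduct.map (Ideal.Quotient.mkₐ k J) (AlgHom.id k H))
          (TensorProduct.assoc k H H H (Coalgebra.comul.rTensor H y)) := by
      intro y
      induction y with
      | zero => simp
      | add y z hy hz => simp only [map_add, hy, hz]
      | tmul u v =>
        simp only [Algebra.TensorProduct.map_tmul, Ideal.Quotient.mkₐ_eq_mk,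
          Bialgebra.comulAlgHom_apply, Bialgebra.Quotient.comul_mk, LinearMap.rTensor_tmul]
        generalize (Coalgebra.comul u : H ⊗[k] H) = w
        induction w with
        | zero => simp
        | add y z hy hz => simp only [map_add, TensorProduct.add_tmul, hy, hz]
        | tmul a b => simp
    have key₂ : ∀ y : H ⊗[k] H, Algebra.TensorProduct.map (AlgHom.id k (H ⧸ J))
          ((Algebra.TensorProduct.map (Ideal.Quotient.mkₐ k J) (AlgHom.id k H)).comp
            (Bialgebra.comulAlgHom k H))
          (Algebra.TensorProduct.map (Ideal.Quotient.mkₐ k J) (AlgHom.id k H) y) =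
        Algebra.TensorProduct.map (Ideal.Quotient.mkₐ k J)
          (Algebra.TensorProduct.map (Ideal.Quotient.mkₐ k J) (AlgHom.id k H))
          (Coalgebra.comul.lTensor H y) := by
      intro y
      induction y with
      | zero => simp
      | add y z hy hz => simp only [map_add, hy, hz]
      | tmul u v => simp
    exact (key₁ _).trans (h.trans (key₂ _).symm)
  counit := by
    ext x
    have key : ∀ y : H ⊗[k] H, Algebra.TensorProduct.lid k H
        (Algebra.TensorProduct.map (Bialgebra.counitAlgHom k (H ⧸ J)) (AlgHom.id k H)
          (Algebra.TensorProduct.map (Ideal.Quotient.mkₐ k J) (AlgHom.id k H) y)) =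
        TensorProduct.lid k H (Coalgebra.counit.rTensor H y) := by
      intro y
      induction y with
      | zero => simp
      | add y z hy hz => simp only [map_add, hy, hz]
      | tmul u v => simp
    refine (key _).trans ?_
    simp

variable {A A₀ : Type} [Ring A] [Algebra k A] [Ring A₀] [Algebra k A₀]

/-- The `H ⧸ J`-coaction induced by an `H`-coaction. -/
def RightCoaction.induced (δ : RightCoaction k H A) : A →ₐ[k] A ⊗[k] (H ⧸ J) :=
  (Algebra.TensorProduct.map (AlgHom.id k A) (Ideal.Quotient.mkₐ k J)).comp δ.toAlgHom

/-- The algebra map `φ` is a morphism of `H ⧸ J`-comodules, for the induced coaction on `A`. -/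
def IsColinear (δ : RightCoaction k H A) (δ₀ : RightCoaction k (H ⧸ J) A₀) (φ : A →ₐ[k] A₀) :
    Prop :=
  (Algebra.TensorProduct.map φ (AlgHom.id k (H ⧸ J))).comp (δ.induced J) = δ₀.toAlgHom.comp φ

/-- `A₀` is an algebraic reduction of the principal `H`-comodule algebra `A` to the quotient
Hopf algebra `H ⧸ J`, by means of the algebra map `φ : A → A₀`. -/
structure IsAffineAlgebraicReduction (δ : RightCoaction k H A)
    (δ₀ : RightCoaction k (H ⧸ J) A₀) (φ : A →ₐ[k] A₀) : Prop where
  principal : δ.IsPrincipal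
  principal_quotient : (quotientLeftCoaction k J).IsPrincipal
  principal_reduced : δ₀.IsPrincipal
  base_iso : Nonempty (δ.coinvariants ≃ₐ[k] δ₀.coinvariants)
  colinear : IsColinear J δ δ₀ φ
  surjective : Function.Surjective φ
  map_coinvariants : δ.coinvariants.map φ = δ₀.coinvariants

end Reduction

/-! ## Quantum principal bundles -/

/-- A presheaf of right `H`-comodule algebras on the space `X`. -/
structure ComoduleAlgebraPresheaf (k H : Type) [Field k] [Ring H] [Bialgebra k H]
    (X : TopCat.{0}) where
  /-- the underlying presheaf of algebras -/
  presheaf : TopCat.Presheaf (AlgCat.{0} k) X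
  /-- the coactions on the algebras of sections -/
  coaction : ∀ U : Opens X, RightCoaction k H (presheaf.obj (op U))
  /-- the restriction maps are maps of comodules -/
  map_coaction : ∀ {U V : Opens X} (i : V ⟶ U),
    (coaction V).toAlgHom.comp (presheaf.map i.op).hom =
      (Algebra.TensorProduct.map (presheaf.map i.op).hom (AlgHom.id k H)).comp
        (coaction U).toAlgHom

section Bundles

variable {k : Type} [Field k] {X : TopCat.{0}} {ι : Type}

/-- `F` is a quantum principal bundle over the quantum ringed space `(X, O)`, with respect to the
open cover `U`, for the Hopf algebra `H`: a sheaf of `H`-comodule algebras whose sections on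
each `U i` form a principal comodule algebra with algebra of coinvariants `O (U i)`. -/
structure IsQuantumPrincipalBundle {H : Type} [Ring H] [HopfAlgebra k H]
    (O : TopCat.Presheaf (AlgCat.{0} k) X) (F : ComoduleAlgebraPresheaf k H X)
    (U : ι → Opens X) : Prop where
  antipode_bijective : Function.Bijective (HopfAlgebra.antipode k (A := H))
  base_isSheaf : O.IsSheaf
  isSheaf : F.presheaf.IsSheaf
  cover : ⨆ i, U i = ⊤
  coinvariants_eq : ∃ j : O ⟶ F.presheaf, ∀ i,
    Function.Injective (j.app (op (U i))).hom ∧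
      (j.app (op (U i))).hom.range = (F.coaction (U i)).coinvariants
  principal : ∀ i, (F.coaction (U i)).IsPrincipal

/-- A locally cleft quantum principal bundle. -/
structure IsLocallyCleftQuantumPrincipalBundle {H : Type} [Ring H] [HopfAlgebra k H]
    (O : TopCat.Presheaf (AlgCat.{0} k) X) (F : ComoduleAlgebraPresheaf k H X)
    (U : ι → Opens X) : Prop extends IsQuantumPrincipalBundle O F U where
  cleft : ∀ i, (F.coaction (U i)).IsCleft

/-- The quantum principal `H ⧸ J`-bundle `F₀` is an algebraic reduction of the quantum principal
`H`-bundle `F` over `(X, O)`, by means of the morphism `φ`, with respect to the open cover `U`. -/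
structure IsAlgebraicReduction {H : Type} [Ring H] [HopfAlgebra k H] (J : Ideal H)
    [J.IsTwoSided] [J.IsHopfIdeal k] (O : TopCat.Presheaf (AlgCat.{0} k) X)
    (F : ComoduleAlgebraPresheaf k H X) (F₀ : ComoduleAlgebraPresheaf k (H ⧸ J) X)
    (φ : F.presheaf ⟶ F₀.presheaf) (U : ι → Opens X) : Prop where
  bundle : IsQuantumPrincipalBundle O F U
  bundle_reduced : IsQuantumPrincipalBundle O F₀ U
  colinear : ∀ V, IsColinear J (F.coaction V) (F₀.coaction V) (φ.app (op V)).hom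
  map_coinvariants : ∀ i,
    (F.coaction (U i)).coinvariants.map (φ.app (op (U i))).hom = (F₀.coaction (U i)).coinvariants
  affine : ∀ i, IsAffineAlgebraicReduction J (F.coaction (U i)) (F₀.coaction (U i))
    (φ.app (op (U i))).hom

end Bundles

/-! ## Two-sided ideals generated by one element -/

section PrincipalIdeal

variable {R : Type} [Ring R]

/-- The two-sided ideal generated by `g`. -/
def idealOf (g : R) : Ideal R := (TwoSidedIdeal.span {g}).asIdeal

instance (g : R) : (idealOf g).IsTwoSided :=
  inferInstanceAs (TwoSidedIdeal.span {g}).asIdeal.IsTwoSided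

theorem mem_idealOf_self (g : R) : g ∈ idealOf g :=
  TwoSidedIdeal.mem_asIdeal.2 (TwoSidedIdeal.subset_span rfl)

theorem eq_zero_of_mem_idealOf {S : Type} [Ring S] (f : R →+* S) {g : R} (hg : f g = 0) {x : R}
    (hx : x ∈ idealOf g) : f x = 0 := by
  have : TwoSidedIdeal.span {g} ≤ TwoSidedIdeal.ker f := by
    rw [TwoSidedIdeal.span_le]
    rintro _ rfl
    exact (TwoSidedIdeal.mem_ker f).2 hg
  exact (TwoSidedIdeal.mem_ker f).1 (this (TwoSidedIdeal.mem_asIdeal.1 hx))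

/-- A two-sided ideal generated by one element `g` is a Hopf ideal as soon as the conditions
hold for `g`. -/
theorem isHopfIdeal_idealOf {k H : Type} [Field k] [Ring H] [HopfAlgebra k H] {g : H}
    (hε : Coalgebra.counit (R := k) g = 0)
    (hΔ : Algebra.TensorProduct.map (Ideal.Quotient.mkₐ k (idealOf g))
      (Ideal.Quotient.mkₐ k (idealOf g)) (Coalgebra.comul g) = 0)
    (hS : HopfAlgebra.antipode k g ∈ idealOf g) : (idealOf g).IsHopfIdeal k where
  counit_eq_zero _ hx := eq_zero_of_mem_idealOf (Bialgebra.counitAlgHom k H).toRingHom hε hx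
  map_mkQ_comul_eq_zero _ hx := eq_zero_of_mem_idealOf
    ((Algebra.TensorProduct.map (Ideal.Quotient.mkₐ k (idealOf g))
      (Ideal.Quotient.mkₐ k (idealOf g))).comp (Bialgebra.comulAlgHom k H)).toRingHom hΔ hx
  antipode_mem x hx := by
    have hx' := TwoSidedIdeal.mem_asIdeal.1 hx
    induction hx' using TwoSidedIdeal.span_induction with
    | mem x h => rw [Set.mem_singleton_iff.1 h]; exact hS
    | zero => simp
    | add x y h₁ h₂ h₃ h₄ =>
      rw [map_add]
      exact add_mem (h₃ (TwoSidedIdeal.mem_asIdeal.2 h₁)) (h₄ (TwoSidedIdeal.mem_asIdeal.2 h₂))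
    | neg x h₁ h₂ => rw [map_neg]; exact neg_mem (h₂ (TwoSidedIdeal.mem_asIdeal.2 h₁))
    | left_absorb a x h₁ h₂ =>
      rw [HopfAlgebra.antipode_mul_antidistrib]
      exact Ideal.mul_mem_right _ _ (h₂ (TwoSidedIdeal.mem_asIdeal.2 h₁))
    | right_absorb b x h₁ h₂ =>
      rw [HopfAlgebra.antipode_mul_antidistrib]
      exact Ideal.mul_mem_left _ _ (h₂ (TwoSidedIdeal.mem_asIdeal.2 h₁))

end PrincipalIdeal

section QuotientCoaction

variable {k H A A' : Type} [Field k] [Ring H] [HopfAlgebra k H] [Ring A] [Algebra k A]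
  [Ring A'] [Algebra k A']

/-- A coaction on `A` induces a coaction of `H ⧸ J` on the quotient of `A` by the ideal generated
by an element whose coaction vanishes in the quotient. -/
def RightCoaction.quotient (δ : RightCoaction k H A) (J : Ideal H) [J.IsTwoSided]
    [J.IsHopfIdeal k] (g : A)
    (hg : Algebra.TensorProduct.map (Ideal.Quotient.mkₐ k (idealOf g)) (Ideal.Quotient.mkₐ k J)
      (δ.toAlgHom g) = 0) : RightCoaction k (H ⧸ J) (A ⧸ idealOf g) where
  toAlgHom := Ideal.Quotient.liftₐ (idealOf g)
    ((Algebra.TensorProduct.map (Ideal.Quotient.mkₐ k (idealOf g))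
      (Ideal.Quotient.mkₐ k J)).comp δ.toAlgHom)
    fun _ h => eq_zero_of_mem_idealOf ((Algebra.TensorProduct.map
      (Ideal.Quotient.mkₐ k (idealOf g)) (Ideal.Quotient.mkₐ k J)).comp δ.toAlgHom).toRingHom hg h
  coassoc := by
    set p := Ideal.Quotient.mkₐ k (idealOf g)
    set π := Ideal.Quotient.mkₐ k J
    set δ₀ : A ⧸ idealOf g →ₐ[k] (A ⧸ idealOf g) ⊗[k] (H ⧸ J) :=
      Ideal.Quotient.liftₐ (idealOf g) ((Algebra.TensorProduct.map p π).comp δ.toAlgHom) _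
    have key₁ : ∀ z : A ⊗[k] H,
        Algebra.TensorProduct.assoc k k k (A ⧸ idealOf g) (H ⧸ J) (H ⧸ J)
          (Algebra.TensorProduct.map δ₀ (AlgHom.id k (H ⧸ J))
            (Algebra.TensorProduct.map p π z)) =
        Algebra.TensorProduct.map p (Algebra.TensorProduct.map π π)
          (Algebra.TensorProduct.assoc k k k A H H
            (Algebra.TensorProduct.map δ.toAlgHom (AlgHom.id k H) z)) := by
      intro z
      induction z with
      | zero => simp only [map_zero]
      | add y z hy hz => simp only [map_add, hy, hz]
      | tmul u v =>
        have hu : δ₀ (p u) = Algebra.TensorProduct.map p π (δ.toAlgHom u) := rfl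
        simp only [Algebra.TensorProduct.map_tmul, hu]
        generalize δ.toAlgHom u = w
        induction w with
        | zero => simp only [map_zero, TensorProduct.zero_tmul]
        | add y z hy hz => simp only [map_add, TensorProduct.add_tmul, hy, hz]
        | tmul a b => rfl
    have key₂ : ∀ z : A ⊗[k] H,
        Algebra.TensorProduct.map (AlgHom.id k (A ⧸ idealOf g))
          (Bialgebra.comulAlgHom k (H ⧸ J)) (Algebra.TensorProduct.map p π z) =
        Algebra.TensorProduct.map p (Algebra.TensorProduct.map π π)
          (Algebra.TensorProduct.map (AlgHom.id k A) (Bialgebra.comulAlgHom k H) z) := by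
      intro z
      induction z with
      | zero => simp only [map_zero]
      | add y z hy hz => simp only [map_add, hy, hz]
      | tmul u v => rfl
    apply Ideal.Quotient.algHom_ext k
    ext y
    exact (key₁ _).trans
      ((congrArg _ (DFunLike.congr_fun δ.coassoc y)).trans (key₂ _).symm)
  counit := by
    set p := Ideal.Quotient.mkₐ k (idealOf g)
    set π := Ideal.Quotient.mkₐ k J
    have key : ∀ z : A ⊗[k] H,
        Algebra.TensorProduct.rid k k (A ⧸ idealOf g)
          (Algebra.TensorProduct.map (AlgHom.id k (A ⧸ idealOf g))
            (Bialgebra.counitAlgHom k (H ⧸ J)) (Algebra.TensorProduct.map p π z)) =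
        p (Algebra.TensorProduct.rid k k A
          (Algebra.TensorProduct.map (AlgHom.id k A) (Bialgebra.counitAlgHom k H) z)) := by
      intro z
      induction z with
      | zero => simp only [map_zero]
      | add y z hy hz => simp only [map_add, hy, hz]
      | tmul u v => rfl
    apply Ideal.Quotient.algHom_ext k
    ext y
    exact (key _).trans (congrArg _ (DFunLike.congr_fun δ.counit y))

theorem RightCoaction.quotient_mk (δ : RightCoaction k H A) (J : Ideal H) [J.IsTwoSided]
    [J.IsHopfIdeal k] (g : A)
    (hg : Algebra.TensorProduct.map (Ideal.Quotient.mkₐ k (idealOf g)) (Ideal.Quotient.mkₐ k J)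
      (δ.toAlgHom g) = 0) (y : A) :
    (δ.quotient J g hg).toAlgHom (Ideal.Quotient.mkₐ k (idealOf g) y) =
      Algebra.TensorProduct.map (Ideal.Quotient.mkₐ k (idealOf g)) (Ideal.Quotient.mkₐ k J)
        (δ.toAlgHom y) := rfl

theorem RightCoaction.quotient_natural (δ : RightCoaction k H A) (δ' : RightCoaction k H A')
    (J : Ideal H) [J.IsTwoSided] [J.IsHopfIdeal k] (g : A) (g' : A')
    (hg : Algebra.TensorProduct.map (Ideal.Quotient.mkₐ k (idealOf g)) (Ideal.Quotient.mkₐ k J)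
      (δ.toAlgHom g) = 0)
    (hg' : Algebra.TensorProduct.map (Ideal.Quotient.mkₐ k (idealOf g'))
      (Ideal.Quotient.mkₐ k J) (δ'.toAlgHom g') = 0)
    (f : A →ₐ[k] A') (f₀ : A ⧸ idealOf g →ₐ[k] A' ⧸ idealOf g')
    (hf₀ : f₀.comp (Ideal.Quotient.mkₐ k (idealOf g)) =
      (Ideal.Quotient.mkₐ k (idealOf g')).comp f)
    (hf : δ'.toAlgHom.comp f =
      (Algebra.TensorProduct.map f (AlgHom.id k H)).comp δ.toAlgHom) :
    (δ'.quotient J g' hg').toAlgHom.comp f₀ =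
      (Algebra.TensorProduct.map f₀ (AlgHom.id k (H ⧸ J))).comp
        (δ.quotient J g hg).toAlgHom := by
  have key : ∀ z : A ⊗[k] H,
      Algebra.TensorProduct.map (Ideal.Quotient.mkₐ k (idealOf g')) (Ideal.Quotient.mkₐ k J)
        (Algebra.TensorProduct.map f (AlgHom.id k H) z) =
      Algebra.TensorProduct.map f₀ (AlgHom.id k (H ⧸ J))
        (Algebra.TensorProduct.map (Ideal.Quotient.mkₐ k (idealOf g))
          (Ideal.Quotient.mkₐ k J) z) := by
    intro z
    induction z with
    | zero => simp only [map_zero]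
    | add y z hy hz => simp only [map_add, hy, hz]
    | tmul u v =>
      simp only [Algebra.TensorProduct.map_tmul]
      rw [← AlgHom.comp_apply f₀, hf₀]
      rfl
  apply Ideal.Quotient.algHom_ext k
  ext y
  change (δ'.quotient J g' hg').toAlgHom (f₀ (Ideal.Quotient.mkₐ k (idealOf g) y)) = _
  rw [← AlgHom.comp_apply f₀, hf₀]
  change Algebra.TensorProduct.map _ _ (δ'.toAlgHom (f y)) = _
  rw [← AlgHom.comp_apply δ'.toAlgHom, hf]
  exact key _

end QuotientCoaction

/-! ## The Takhtajan-Sudbery quantum group `GL(2)` -/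

set_option linter.unusedSimpArgs false
set_option linter.unnecessarySeqFocus false
set_option linter.constructorNameAsVariable false

/-- The generators of the Takhtajan-Sudbery algebra. -/
inductive GLGen : Type
  | a | b | c | d | Dinv

section Relations

open GLGen FreeAlgebra

/-- The relations of the Takhtajan-Sudbery algebra for `n = 2`; here `a d - q⁻¹ b c` is the
quantum determinant and `Dinv` is its inverse. -/
inductive GLRel (q : ℂˣ) : FreeAlgebra ℂ GLGen → FreeAlgebra ℂ GLGen → Prop
  | ab : GLRel q (ι ℂ a * ι ℂ b) ((q : ℂ)⁻¹ • (ι ℂ b * ι ℂ a))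
  | ac : GLRel q (ι ℂ a * ι ℂ c) ((q : ℂ) • (ι ℂ c * ι ℂ a))
  | cd : GLRel q (ι ℂ c * ι ℂ d) ((q : ℂ)⁻¹ • (ι ℂ d * ι ℂ c))
  | bd : GLRel q (ι ℂ b * ι ℂ d) ((q : ℂ) • (ι ℂ d * ι ℂ b))
  | bc : GLRel q (ι ℂ b * ι ℂ c) ((q : ℂ) ^ 2 • (ι ℂ c * ι ℂ b))
  | ad : GLRel q (ι ℂ a * ι ℂ d) (ι ℂ d * ι ℂ a)
  | aD : GLRel q (ι ℂ a * ι ℂ Dinv) (ι ℂ Dinv * ι ℂ a)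
  | bD : GLRel q (ι ℂ b * ι ℂ Dinv) ((q : ℂ)⁻¹ ^ 2 • (ι ℂ Dinv * ι ℂ b))
  | cD : GLRel q (ι ℂ c * ι ℂ Dinv) ((q : ℂ) ^ 2 • (ι ℂ Dinv * ι ℂ c))
  | dD : GLRel q (ι ℂ d * ι ℂ Dinv) (ι ℂ Dinv * ι ℂ d)
  | D_mul_Dinv : GLRel q
      ((ι ℂ a * ι ℂ d - (q : ℂ)⁻¹ • (ι ℂ b * ι ℂ c)) * ι ℂ Dinv) 1
  | Dinv_mul_D : GLRel q
      (ι ℂ Dinv * (ι ℂ a * ι ℂ d - (q : ℂ)⁻¹ • (ι ℂ b * ι ℂ c))) 1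

end Relations

/-- The Takhtajan-Sudbery algebra, the coordinate algebra of the quantum group `GL(2)`. -/
def GL2 (q : ℂˣ) : Type := RingQuot (GLRel q)

instance (q : ℂˣ) : Ring (GL2 q) := inferInstanceAs (Ring (RingQuot (GLRel q)))

instance (q : ℂˣ) : Algebra ℂ (GL2 q) := inferInstanceAs (Algebra ℂ (RingQuot (GLRel q)))

namespace GL2

open GLGen Coalgebra

/-- The generators. -/
def gen (q : ℂˣ) (g : GLGen) : GL2 q := RingQuot.mkAlgHom ℂ (GLRel q) (FreeAlgebra.ι ℂ g)

variable {q : ℂˣ} {B : Type} [Ring B] [Algebra ℂ B]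

/-- The algebra map determined by its values on the generators. -/
def lift (f : GLGen → B)
    (h : ∀ x y, GLRel q x y → FreeAlgebra.lift ℂ f x = FreeAlgebra.lift ℂ f y) : GL2 q →ₐ[ℂ] B :=
  RingQuot.liftAlgHom ℂ (s := GLRel q) ⟨FreeAlgebra.lift ℂ f, h⟩

@[simp]
theorem lift_gen (f : GLGen → B)
    (h : ∀ x y, GLRel q x y → FreeAlgebra.lift ℂ f x = FreeAlgebra.lift ℂ f y) (g : GLGen) :
    lift f h (gen q g) = f g := by
  simp only [lift, gen]
  exact (RingQuot.liftAlgHom_mkAlgHom_apply ℂ (FreeAlgebra.lift ℂ f) h _).trans (by simp)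

theorem hom_ext {f g : GL2 q →ₐ[ℂ] B} (h : ∀ x, f (gen q x) = g (gen q x)) : f = g := by
  apply RingQuot.ringQuot_ext' (S := ℂ) (s := GLRel q)
  apply FreeAlgebra.hom_ext
  funext x
  exact h x

theorem rel {x y : FreeAlgebra ℂ GLGen} (h : GLRel q x y) :
    (RingQuot.mkAlgHom ℂ (GLRel q) x : GL2 q) = RingQuot.mkAlgHom ℂ (GLRel q) y :=
  RingQuot.mkAlgHom_rel ℂ h

theorem induction {p : GL2 q → Prop} (hC : ∀ r : ℂ, p (algebraMap ℂ (GL2 q) r))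
    (hg : ∀ g, p (gen q g)) (hm : ∀ x y, p x → p y → p (x * y))
    (ha : ∀ x y, p x → p y → p (x + y)) (x : GL2 q) : p x := by
  obtain ⟨x, rfl⟩ := RingQuot.mkAlgHom_surjective ℂ (GLRel q) x
  induction x using FreeAlgebra.induction with
  | grade0 r => rw [AlgHom.commutes]; exact hC r
  | grade1 g => exact hg g
  | mul x y hx hy => rw [map_mul]; exact hm _ _ hx hy
  | add x y hx hy => rw [map_add]; exact ha _ _ hx hy

/-- The quantum determinant. -/
def det (q : ℂˣ) : GL2 q := gen q a * gen q d - (q : ℂ)⁻¹ • (gen q b * gen q c)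

/-! Commutation relations, moving the generators into the order `a, b, c, d, Dinv`. -/

theorem ba : gen q b * gen q a = (q : ℂ) • (gen q a * gen q b) := by
  have h := rel (GLRel.ab (q := q))
  simp only [map_mul, map_smul] at h
  change gen q a * gen q b = (q : ℂ)⁻¹ • (gen q b * gen q a) at h
  rw [h, smul_smul, mul_inv_cancel₀ q.ne_zero, one_smul]

theorem ca : gen q c * gen q a = (q : ℂ)⁻¹ • (gen q a * gen q c) := by
  have h := rel (GLRel.ac (q := q))
  simp only [map_mul, map_smul] at h
  change gen q a * gen q c = (q : ℂ) • (gen q c * gen q a) at h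
  rw [h, smul_smul, inv_mul_cancel₀ q.ne_zero, one_smul]

theorem da : gen q d * gen q a = gen q a * gen q d := by
  have h := rel (GLRel.ad (q := q))
  simp only [map_mul] at h
  exact h.symm

theorem cb : gen q c * gen q b = (q : ℂ)⁻¹ ^ 2 • (gen q b * gen q c) := by
  have h := rel (GLRel.bc (q := q))
  simp only [map_mul, map_smul] at h
  change gen q b * gen q c = (q : ℂ) ^ 2 • (gen q c * gen q b) at h
  rw [h, smul_smul, ← mul_pow, inv_mul_cancel₀ q.ne_zero, one_pow, one_smul]

theorem db : gen q d * gen q b = (q : ℂ)⁻¹ • (gen q b * gen q d) := by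
  have h := rel (GLRel.bd (q := q))
  simp only [map_mul, map_smul] at h
  change gen q b * gen q d = (q : ℂ) • (gen q d * gen q b) at h
  rw [h, smul_smul, inv_mul_cancel₀ q.ne_zero, one_smul]

theorem dc : gen q d * gen q c = (q : ℂ) • (gen q c * gen q d) := by
  have h := rel (GLRel.cd (q := q))
  simp only [map_mul, map_smul] at h
  change gen q c * gen q d = (q : ℂ)⁻¹ • (gen q d * gen q c) at h
  rw [h, smul_smul, mul_inv_cancel₀ q.ne_zero, one_smul]

theorem Da : gen q Dinv * gen q a = gen q a * gen q Dinv := by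
  have h := rel (GLRel.aD (q := q))
  simp only [map_mul] at h
  exact h.symm

theorem Db : gen q Dinv * gen q b = (q : ℂ) ^ 2 • (gen q b * gen q Dinv) := by
  have h := rel (GLRel.bD (q := q))
  simp only [map_mul, map_smul] at h
  change gen q b * gen q Dinv = (q : ℂ)⁻¹ ^ 2 • (gen q Dinv * gen q b) at h
  rw [h, smul_smul, ← mul_pow, mul_inv_cancel₀ q.ne_zero, one_pow, one_smul]

theorem Dc : gen q Dinv * gen q c = (q : ℂ)⁻¹ ^ 2 • (gen q c * gen q Dinv) := by
  have h := rel (GLRel.cD (q := q))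
  simp only [map_mul, map_smul] at h
  change gen q c * gen q Dinv = (q : ℂ) ^ 2 • (gen q Dinv * gen q c) at h
  rw [h, smul_smul, ← mul_pow, inv_mul_cancel₀ q.ne_zero, one_pow, one_smul]

theorem Dd : gen q Dinv * gen q d = gen q d * gen q Dinv := by
  have h := rel (GLRel.dD (q := q))
  simp only [map_mul] at h
  exact h.symm

theorem det_mul_Dinv : det q * gen q Dinv = 1 := by
  have h := rel (GLRel.D_mul_Dinv (q := q))
  simp only [map_mul, map_sub, map_smul, map_one] at h
  exact h

theorem Dinv_mul_det : gen q Dinv * det q = 1 := by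
  have h := rel (GLRel.Dinv_mul_D (q := q))
  simp only [map_mul, map_sub, map_smul, map_one] at h
  exact h

theorem ad_Dinv : gen q a * (gen q d * gen q Dinv) =
    1 + (q : ℂ)⁻¹ • (gen q b * (gen q c * gen q Dinv)) := by
  have h := det_mul_Dinv (q := q)
  rw [det, sub_mul, smul_mul_assoc, mul_assoc, mul_assoc, sub_eq_iff_eq_add] at h
  exact h

theorem mul_left_rel {x y z w : GL2 q} {r : ℂ} (h : x * y = r • (z * w)) (v : GL2 q) :
    x * (y * v) = r • (z * (w * v)) := by
  rw [← mul_assoc, h, smul_mul_assoc, mul_assoc]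

theorem mul_left_rel' {x y z w : GL2 q} (h : x * y = z * w) (v : GL2 q) :
    x * (y * v) = z * (w * v) := by
  rw [← mul_assoc, h, mul_assoc]

open scoped TensorProduct

/-- The comultiplication on the generators. -/
def comulGen (q : ℂˣ) : GLGen → GL2 q ⊗[ℂ] GL2 q
  | a => gen q a ⊗ₜ gen q a + gen q b ⊗ₜ gen q c
  | b => gen q a ⊗ₜ gen q b + gen q b ⊗ₜ gen q d
  | c => gen q c ⊗ₜ gen q a + gen q d ⊗ₜ gen q c
  | d => gen q c ⊗ₜ gen q b + gen q d ⊗ₜ gen q d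
  | Dinv => gen q Dinv ⊗ₜ gen q Dinv

theorem comulGen_det : comulGen q a * comulGen q d - (q : ℂ)⁻¹ • (comulGen q b * comulGen q c) =
    det q ⊗ₜ det q := by
  have hq := q.ne_zero
  simp only [comulGen, det, mul_add, add_mul, Algebra.TensorProduct.tmul_mul_tmul, ba, ca, da, cb,
    db, dc, TensorProduct.tmul_sub, TensorProduct.sub_tmul, TensorProduct.tmul_smul,
    ← TensorProduct.smul_tmul', smul_smul, smul_add, smul_sub]
  match_scalars <;> field_simp <;> try ring

/-- The comultiplication `Δ a_{ij} = ∑ a_{ik} ⊗ a_{kj}`, `Δ D⁻¹ = D⁻¹ ⊗ D⁻¹`. -/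
def comulHom (q : ℂˣ) : GL2 q →ₐ[ℂ] GL2 q ⊗[ℂ] GL2 q :=
  lift (comulGen q) <| by
    have hq := q.ne_zero
    intro x y h
    cases h with
    | D_mul_Dinv =>
      simp only [map_mul, map_sub, map_smul, map_one, FreeAlgebra.lift_ι_apply]
      rw [comulGen_det, comulGen, Algebra.TensorProduct.tmul_mul_tmul, det_mul_Dinv]
      rfl
    | Dinv_mul_D =>
      simp only [map_mul, map_sub, map_smul, map_one, FreeAlgebra.lift_ι_apply]
      rw [comulGen_det, comulGen, Algebra.TensorProduct.tmul_mul_tmul, Dinv_mul_det]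
      rfl
    | _ =>
      simp only [map_mul, map_smul, FreeAlgebra.lift_ι_apply, comulGen, mul_add, add_mul,
        Algebra.TensorProduct.tmul_mul_tmul, ba, ca, da, cb, db, dc, Da, Db, Dc, Dd,
        TensorProduct.tmul_smul, ← TensorProduct.smul_tmul', smul_smul, smul_add]
      match_scalars <;> field_simp

/-- The counit on the generators. -/
def counitGen : GLGen → ℂ
  | a => 1
  | b => 0
  | c => 0
  | d => 1
  | Dinv => 1

/-- The counit `ε a_{ij} = δ_{ij}`, `ε D⁻¹ = 1`. -/
def counitHom (q : ℂˣ) : GL2 q →ₐ[ℂ] ℂ :=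
  lift counitGen <| by
    intro x y h
    cases h <;> simp [counitGen]

instance instBialgebra (q : ℂˣ) : Bialgebra ℂ (GL2 q) :=
  Bialgebra.ofAlgHom (comulHom q) (counitHom q)
    (by
      apply hom_ext
      intro x
      cases x <;> simp [comulHom, comulGen, TensorProduct.tmul_add, TensorProduct.add_tmul] <;>
        abel)
    (by
      apply hom_ext
      intro x
      cases x <;> simp [comulHom, counitHom, comulGen, counitGen])
    (by
      apply hom_ext
      intro x
      cases x <;> simp [comulHom, counitHom, comulGen, counitGen])

theorem comul_gen (g : GLGen) : comul (R := ℂ) (gen q g) = comulGen q g := lift_gen _ _ g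

theorem counit_gen (g : GLGen) : counit (R := ℂ) (gen q g) = counitGen g := lift_gen _ _ g

/-- The antipode on the generators. -/
def antipodeGen (q : ℂˣ) : GLGen → GL2 q
  | a => gen q d * gen q Dinv
  | b => -((q : ℂ) • (gen q b * gen q Dinv))
  | c => -((q : ℂ)⁻¹ • (gen q c * gen q Dinv))
  | d => gen q a * gen q Dinv
  | Dinv => det q

theorem antipodeGen_det : antipodeGen q d * antipodeGen q a -
    (q : ℂ)⁻¹ • (antipodeGen q c * antipodeGen q b) = gen q Dinv := by
  have hq := q.ne_zero
  have h : gen q Dinv = det q * gen q Dinv * gen q Dinv := by rw [det_mul_Dinv, one_mul]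
  conv_rhs => rw [h]
  simp only [antipodeGen, sub_mul, det, mul_assoc, cb, mul_left_rel cb, mul_left_rel Db,
    mul_left_rel' Dd, neg_mul, mul_neg, smul_neg, neg_neg, mul_smul_comm, smul_mul_assoc,
    smul_smul]
  match_scalars <;> field_simp

/-- The antipode, as an algebra map to the opposite algebra. -/
def antipodeHom (q : ℂˣ) : GL2 q →ₐ[ℂ] (GL2 q)ᵐᵒᵖ :=
  lift (fun g => MulOpposite.op (antipodeGen q g)) <| by
    have hq := q.ne_zero
    intro x y h
    apply MulOpposite.unop_injective
    cases h with
    | D_mul_Dinv =>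
      simp only [map_mul, map_sub, map_smul, map_one, FreeAlgebra.lift_ι_apply,
        MulOpposite.unop_op, MulOpposite.unop_mul, MulOpposite.unop_smul, MulOpposite.unop_one,
        MulOpposite.unop_sub]
      rw [antipodeGen_det, antipodeGen, det_mul_Dinv]
    | Dinv_mul_D =>
      simp only [map_mul, map_sub, map_smul, map_one, FreeAlgebra.lift_ι_apply,
        MulOpposite.unop_op, MulOpposite.unop_mul, MulOpposite.unop_smul, MulOpposite.unop_one,
        MulOpposite.unop_sub]
      rw [antipodeGen_det, antipodeGen, Dinv_mul_det]
    | _ =>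
      simp only [map_mul, map_smul, FreeAlgebra.lift_ι_apply, antipodeGen, mul_sub, sub_mul,
        MulOpposite.unop_op, MulOpposite.unop_mul, MulOpposite.unop_smul, det, mul_assoc,
        ba, ca, da, cb, db, dc, Da, Db, Dc, Dd,
        mul_left_rel ba, mul_left_rel ca, mul_left_rel' da, mul_left_rel cb, mul_left_rel db,
        mul_left_rel dc, mul_left_rel' Da, mul_left_rel Db, mul_left_rel Dc, mul_left_rel' Dd,
        neg_mul, mul_neg, smul_neg, neg_neg,
        mul_smul_comm, smul_mul_assoc, smul_smul, smul_sub]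
      try (match_scalars <;> field_simp)

theorem antipodeHom_gen (g : GLGen) :
    antipodeHom q (gen q g) = MulOpposite.op (antipodeGen q g) := lift_gen _ _ g

/-- The antipode. -/
def antipodeMap (q : ℂˣ) : GL2 q →ₗ[ℂ] GL2 q :=
  (MulOpposite.opLinearEquiv ℂ).symm.toLinearMap ∘ₗ (antipodeHom q).toLinearMap

theorem antipodeMap_gen (g : GLGen) : antipodeMap q (gen q g) = antipodeGen q g := by
  simp [antipodeMap, antipodeHom_gen]

theorem antipodeMap_mul (x y : GL2 q) :
    antipodeMap q (x * y) = antipodeMap q y * antipodeMap q x := by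
  simp [antipodeMap]

theorem antipodeMap_one : antipodeMap q 1 = 1 := by
  simp [antipodeMap]

theorem antipode_left (x : GL2 q) : LinearMap.mul' ℂ (GL2 q)
    ((antipodeMap q).rTensor (GL2 q) (comul x)) = algebraMap ℂ (GL2 q) (counit x) := by
  have hq := q.ne_zero
  induction x using induction with
  | hC r =>
    simp [Algebra.algebraMap_eq_smul_one, antipodeMap_one, Algebra.TensorProduct.one_def]
  | hg g =>
    rw [comul_gen, counit_gen]
    cases g with
    | Dinv => simp [comulGen, counitGen, antipodeMap_gen, antipodeGen, det_mul_Dinv]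
    | _ =>
      simp only [comulGen, counitGen, map_add, LinearMap.rTensor_tmul, LinearMap.mul'_apply,
        antipodeMap_gen, antipodeGen, mul_assoc, ba, ca, da, cb, db, dc, Da, Db, Dc, Dd,
        mul_left_rel ba, mul_left_rel ca, mul_left_rel' da, mul_left_rel cb, mul_left_rel db,
        mul_left_rel dc, neg_mul, mul_smul_comm, smul_mul_assoc, smul_smul, ad_Dinv, map_one,
        map_zero]
      match_scalars <;> field_simp <;> try ring
  | hm x y hx hy =>
    have key : ∀ (s t : GL2 q ⊗[ℂ] GL2 q), LinearMap.mul' ℂ (GL2 q)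
        ((antipodeMap q).rTensor (GL2 q) (s * t)) =
        LinearMap.mul' ℂ (GL2 q) (TensorProduct.map (antipodeMap q)
          (LinearMap.mulLeft ℂ (LinearMap.mul' ℂ (GL2 q)
            ((antipodeMap q).rTensor (GL2 q) s))) t) := by
      intro s t
      induction t with
      | zero => simp
      | add t u ht hu => simp only [mul_add, map_add, ht, hu]
      | tmul u v =>
        induction s with
        | zero => simp
        | add t u ht hu =>
          simp only [add_mul, map_add, ht, hu, TensorProduct.map_tmul, LinearMap.mulLeft_apply,
            LinearMap.mul'_apply, mul_add]
        | tmul s t => simp [antipodeMap_mul, mul_assoc]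
    rw [Bialgebra.comul_mul, key, hx]
    have h2 : ∀ t : GL2 q ⊗[ℂ] GL2 q, LinearMap.mul' ℂ (GL2 q) (TensorProduct.map (antipodeMap q)
          (LinearMap.mulLeft ℂ (algebraMap ℂ (GL2 q) (counit x))) t) =
        algebraMap ℂ (GL2 q) (counit x) *
          LinearMap.mul' ℂ (GL2 q) ((antipodeMap q).rTensor (GL2 q) t) := by
      intro t
      induction t with
      | zero => simp
      | add t u ht hu => simp only [map_add, ht, hu, mul_add]
      | tmul u v =>
        simp only [TensorProduct.map_tmul, LinearMap.mulLeft_apply, LinearMap.mul'_apply,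
          LinearMap.rTensor_tmul]
        rw [← mul_assoc, ← Algebra.commutes, mul_assoc]
    rw [h2, hy, Bialgebra.counit_mul, map_mul]
  | ha x y hx hy => simp only [map_add, hx, hy]

theorem antipode_right (x : GL2 q) : LinearMap.mul' ℂ (GL2 q)
    ((antipodeMap q).lTensor (GL2 q) (comul x)) = algebraMap ℂ (GL2 q) (counit x) := by
  have hq := q.ne_zero
  induction x using induction with
  | hC r =>
    simp [Algebra.algebraMap_eq_smul_one, antipodeMap_one, Algebra.TensorProduct.one_def]
  | hg g =>
    rw [comul_gen, counit_gen]
    cases g with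
    | Dinv => simp [comulGen, counitGen, antipodeMap_gen, antipodeGen, Dinv_mul_det]
    | _ =>
      simp only [comulGen, counitGen, map_add, LinearMap.lTensor_tmul, LinearMap.mul'_apply,
        antipodeMap_gen, antipodeGen, ba, ca, da, cb, db, dc, Da, Db, Dc, Dd,
        mul_left_rel ba, mul_left_rel ca, mul_left_rel' da, mul_left_rel cb, mul_left_rel db,
        mul_left_rel dc, mul_neg, mul_smul_comm, smul_mul_assoc, smul_smul, ad_Dinv, map_one,
        map_zero]
      match_scalars <;> field_simp <;> try ring
  | hm x y hx hy =>
    have key : ∀ (s t : GL2 q ⊗[ℂ] GL2 q), LinearMap.mul' ℂ (GL2 q)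
        ((antipodeMap q).lTensor (GL2 q) (s * t)) =
        LinearMap.mul' ℂ (GL2 q) (TensorProduct.map
          (LinearMap.mulRight ℂ (LinearMap.mul' ℂ (GL2 q)
            ((antipodeMap q).lTensor (GL2 q) t))) (antipodeMap q) s) := by
      intro s t
      induction s with
      | zero => simp
      | add t u ht hu => simp only [add_mul, map_add, ht, hu]
      | tmul u v =>
        induction t with
        | zero => simp
        | add t u ht hu =>
          simp only [mul_add, map_add, ht, hu, TensorProduct.map_tmul, LinearMap.mulRight_apply,
            LinearMap.mul'_apply, add_mul]
        | tmul s t => simp [antipodeMap_mul, mul_assoc]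
    rw [Bialgebra.comul_mul, key, hy]
    have h2 : ∀ t : GL2 q ⊗[ℂ] GL2 q, LinearMap.mul' ℂ (GL2 q) (TensorProduct.map
          (LinearMap.mulRight ℂ (algebraMap ℂ (GL2 q) (counit y))) (antipodeMap q) t) =
        LinearMap.mul' ℂ (GL2 q) ((antipodeMap q).lTensor (GL2 q) t) *
          algebraMap ℂ (GL2 q) (counit y) := by
      intro t
      induction t with
      | zero => simp
      | add t u ht hu => simp only [map_add, ht, hu, add_mul]
      | tmul u v =>
        simp only [TensorProduct.map_tmul, LinearMap.mulRight_apply, LinearMap.mul'_apply,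
          LinearMap.lTensor_tmul]
        rw [mul_assoc, Algebra.commutes, ← mul_assoc]
    rw [h2, hx, Bialgebra.counit_mul, map_mul]
  | ha x y hx hy => simp only [map_add, hx, hy]

instance instHopfAlgebra (q : ℂˣ) : HopfAlgebra ℂ (GL2 q) where
  antipode := antipodeMap q
  mul_antipode_rTensor_comul := LinearMap.ext antipode_left
  mul_antipode_lTensor_comul := LinearMap.ext antipode_right

theorem antipode_gen (g : GLGen) : HopfAlgebra.antipode ℂ (gen q g) = antipodeGen q g :=
  antipodeMap_gen g

end GL2

/-! ## The quantum parabolic subgroup and its Levi quotient -/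

section Parabolic

open GLGen Coalgebra

theorem mk_self_eq_zero {R : Type} [Ring R] (g : R) : Ideal.Quotient.mk (idealOf g) g = 0 :=
  Ideal.Quotient.eq_zero_iff_mem.2 (mem_idealOf_self g)

/-- The ideal of the parabolic subgroup is generated by `c`. -/
abbrev parabolicIdeal (q : ℂˣ) : Ideal (GL2 q) := idealOf (GL2.gen q c)

instance (q : ℂˣ) : (parabolicIdeal q).IsHopfIdeal ℂ :=
  isHopfIdeal_idealOf (by rw [GL2.counit_gen]; rfl)
    (by
      rw [GL2.comul_gen]
      simp [GL2.comulGen, mk_self_eq_zero])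
    (by
      rw [GL2.antipode_gen]
      simp only [GL2.antipodeGen]
      rw [← smul_mul_assoc, Algebra.smul_def, mul_assoc]
      exact neg_mem (Ideal.mul_mem_left _ _ (Ideal.mul_mem_right _ _ (mem_idealOf_self _))))

/-- The Hopf algebra `H` of the quantum parabolic subgroup of `GL(2)`: the quotient of the
Takhtajan-Sudbery algebra by the ideal generated by `c`. -/
abbrev Parabolic (q : ℂˣ) : Type := GL2 q ⧸ parabolicIdeal q

/-- The projection onto the quantum parabolic subgroup. -/
abbrev parabolicMk (q : ℂˣ) : GL2 q →ₐ[ℂ] Parabolic q := Ideal.Quotient.mkₐ ℂ (parabolicIdeal q)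

namespace Parabolic

/-- The class of `a`. -/
def t (q : ℂˣ) : Parabolic q := parabolicMk q (GL2.gen q a)

/-- The class of `b`. -/
def n (q : ℂˣ) : Parabolic q := parabolicMk q (GL2.gen q b)

/-- The class of `d`. -/
def s (q : ℂˣ) : Parabolic q := parabolicMk q (GL2.gen q d)

/-- The class of the inverse `Dinv` of the quantum determinant. -/
def e (q : ℂˣ) : Parabolic q := parabolicMk q (GL2.gen q Dinv)

/-- The inverse of `t`. -/
def tinv (q : ℂˣ) : Parabolic q := s q * e q

variable {q : ℂˣ}

theorem nt : n q * t q = (q : ℂ) • (t q * n q) := by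
  simp only [n, t, ← map_mul, GL2.ba, map_smul]

theorem st : s q * t q = t q * s q := by
  simp only [s, t, ← map_mul, GL2.da]

theorem sn : s q * n q = (q : ℂ)⁻¹ • (n q * s q) := by
  simp only [n, s, ← map_mul, GL2.db, map_smul]

theorem et : e q * t q = t q * e q := by
  simp only [e, t, ← map_mul, GL2.Da]

theorem en : e q * n q = (q : ℂ) ^ 2 • (n q * e q) := by
  simp only [e, n, ← map_mul, GL2.Db, map_smul]

theorem es : e q * s q = s q * e q := by
  simp only [e, s, ← map_mul, GL2.Dd]

theorem mk_c : parabolicMk q (GL2.gen q c) = 0 := mk_self_eq_zero _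

theorem t_tinv : t q * tinv q = 1 := by
  have h := congrArg (parabolicMk q) (GL2.ad_Dinv (q := q))
  simp only [map_mul, map_add, map_smul, mk_c, zero_mul, mul_zero, smul_zero, add_zero,
    map_one] at h
  exact h

theorem tinv_t : tinv q * t q = 1 := by
  rw [← t_tinv, tinv, mul_assoc, et, ← mul_assoc, st, mul_assoc]

theorem n_tinv : n q * tinv q = (q : ℂ)⁻¹ • (tinv q * n q) := by
  have hq := q.ne_zero
  have h : s q * (n q * e q) = (q : ℂ)⁻¹ • (n q * (s q * e q)) := by
    rw [← mul_assoc, sn, smul_mul_assoc, mul_assoc]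
  simp only [tinv, mul_assoc, en, mul_smul_comm, h]
  match_scalars
  field_simp

theorem s_tinv : s q * tinv q = tinv q * s q := by
  rw [tinv, mul_assoc, es]

theorem comul_t : comul (R := ℂ) (t q) = t q ⊗ₜ t q := by
  rw [t, parabolicMk, Ideal.Quotient.mkₐ_eq_mk, Bialgebra.Quotient.comul_mk, GL2.comul_gen,
    GL2.comulGen]
  simp [mk_self_eq_zero]

theorem comul_n : comul (R := ℂ) (n q) = t q ⊗ₜ n q + n q ⊗ₜ s q := by
  rw [n, parabolicMk, Ideal.Quotient.mkₐ_eq_mk, Bialgebra.Quotient.comul_mk, GL2.comul_gen,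
    GL2.comulGen]
  simp [t, n, s]

theorem comul_s : comul (R := ℂ) (s q) = s q ⊗ₜ s q := by
  rw [s, parabolicMk, Ideal.Quotient.mkₐ_eq_mk, Bialgebra.Quotient.comul_mk, GL2.comul_gen,
    GL2.comulGen]
  simp [mk_self_eq_zero]

theorem comul_e : comul (R := ℂ) (e q) = e q ⊗ₜ e q := by
  rw [e, parabolicMk, Ideal.Quotient.mkₐ_eq_mk, Bialgebra.Quotient.comul_mk, GL2.comul_gen,
    GL2.comulGen]
  simp

theorem comul_tinv : comul (R := ℂ) (tinv q) = tinv q ⊗ₜ tinv q := by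
  rw [tinv, Bialgebra.comul_mul, comul_s, comul_e, Algebra.TensorProduct.tmul_mul_tmul]

theorem counit_t : counit (R := ℂ) (t q) = 1 := by
  rw [t, parabolicMk, Ideal.Quotient.mkₐ_eq_mk, Bialgebra.Quotient.counit_mk, GL2.counit_gen]
  rfl

theorem counit_n : counit (R := ℂ) (n q) = 0 := by
  rw [n, parabolicMk, Ideal.Quotient.mkₐ_eq_mk, Bialgebra.Quotient.counit_mk, GL2.counit_gen]
  rfl

theorem counit_s : counit (R := ℂ) (s q) = 1 := by
  rw [s, parabolicMk, Ideal.Quotient.mkₐ_eq_mk, Bialgebra.Quotient.counit_mk, GL2.counit_gen]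
  rfl

theorem counit_e : counit (R := ℂ) (e q) = 1 := by
  rw [e, parabolicMk, Ideal.Quotient.mkₐ_eq_mk, Bialgebra.Quotient.counit_mk, GL2.counit_gen]
  rfl

theorem counit_tinv : counit (R := ℂ) (tinv q) = 1 := by
  rw [tinv, Bialgebra.counit_mul, counit_s, counit_e, mul_one]

theorem antipode_n : HopfAlgebra.antipode ℂ (n q) = -((q : ℂ) • (n q * e q)) := by
  rw [n, parabolicMk, Ideal.Quotient.mkₐ_eq_mk, HopfAlgebra.Quotient.antipode_mk, GL2.antipode_gen]
  rfl

end Parabolic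

/-- The ideal of `H` generated by `n`. -/
abbrev leviIdeal (q : ℂˣ) : Ideal (Parabolic q) := idealOf (Parabolic.n q)

instance (q : ℂˣ) : (leviIdeal q).IsHopfIdeal ℂ :=
  isHopfIdeal_idealOf Parabolic.counit_n
    (by
      rw [Parabolic.comul_n]
      simp [mk_self_eq_zero])
    (by
      rw [Parabolic.antipode_n, ← smul_mul_assoc, Algebra.smul_def, mul_assoc]
      exact neg_mem (Ideal.mul_mem_left _ _ (Ideal.mul_mem_right _ _ (mem_idealOf_self _))))

/-- The Hopf algebra `H₀ = H ⧸ (n)` of the quantum Levi subgroup. -/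
abbrev Levi (q : ℂˣ) : Type := Parabolic q ⧸ leviIdeal q

end Parabolic

/-! ## The projective line and its structure sheaf -/

/-- The complex projective line. -/
def ProjLine : Type := Projectivization ℂ (Fin 2 → ℂ)

/-- The set of points `[x₀ : x₁]` with `xᵢ ≠ 0`. -/
def chartSet (i : Fin 2) : Set ProjLine := {p | Projectivization.rep p i ≠ 0}

/-- The topology generated by the two affine charts. -/
instance : TopologicalSpace ProjLine :=
  TopologicalSpace.generateFrom (Set.range chartSet)

/-- The projective line as a topological space. -/
def projLine : TopCat.{0} := TopCat.of ProjLine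

/-- The affine charts `U₁ = chart 0` and `U₂ = chart 1`. -/
def chart (i : Fin 2) : Opens projLine :=
  ⟨chartSet i, TopologicalSpace.isOpen_generateFrom_of_mem ⟨i, rfl⟩⟩

/-- The affine coordinate on the `i`-th chart, that is `x₁ / x₀` for `i = 0` and `x₀ / x₁` for
`i = 1`. -/
def coordinate (U : Opens projLine) (i : Fin 2) : U → ℂ := fun p =>
  Projectivization.rep (K := ℂ) (V := Fin 2 → ℂ) p.1 i.rev /
    Projectivization.rep (K := ℂ) (V := Fin 2 → ℂ) p.1 i

/-- The algebra of regular functions on the open set `U`: the algebra of functions generated by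
the affine coordinates of the charts that contain `U`. These are the polynomials in
`z = x₁ / x₀` on `U₁`, the polynomials in `z⁻¹` on `U₂`, the Laurent polynomials in `z` on
`U₁ ∩ U₂`, and the constants on the projective line. -/
def regularFunctions (U : Opens projLine) : Subalgebra ℂ (U → ℂ) :=
  Algebra.adjoin ℂ {f | ∃ i, U ≤ chart i ∧ f = coordinate U i}

/-- The restriction of functions from `U` to `V`. -/
def restrictFun {U V : Opens projLine} (h : V ≤ U) : (U → ℂ) →ₐ[ℂ] (V → ℂ) where
  toFun f p := f ⟨p.1, h p.2⟩
  map_one' := rfl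
  map_mul' _ _ := rfl
  map_zero' := rfl
  map_add' _ _ := rfl
  commutes' _ := rfl

theorem restrictFun_mem {U V : Opens projLine} (h : V ≤ U) (f : U → ℂ)
    (hf : f ∈ regularFunctions U) : restrictFun h f ∈ regularFunctions V := by
  have : regularFunctions U ≤ (regularFunctions V).comap (restrictFun h) := by
    refine Algebra.adjoin_le ?_
    rintro _ ⟨i, hi, rfl⟩
    exact Algebra.subset_adjoin ⟨i, h.trans hi, rfl⟩
  exact this hf

/-- The restriction of regular functions. -/
def restrictRegular {U V : Opens projLine} (h : V ≤ U) :
    regularFunctions U →ₐ[ℂ] regularFunctions V :=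
  ((restrictFun h).comp (regularFunctions U).val).codRestrict _ fun f =>
    restrictFun_mem h f.1 f.2

/-- The structure sheaf of the projective line. -/
def structureSheaf : TopCat.Presheaf (AlgCat.{0} ℂ) projLine where
  obj U := AlgCat.of ℂ (regularFunctions U.unop)
  map i := AlgCat.ofHom (restrictRegular (leOfHom i.unop))
  map_id _ := rfl
  map_comp _ _ := rfl

/-! ## The sheaf `F` -/

/-- Generators of the algebra of sections of `F` over `U`. The inverse of `a` is present over the
open subsets of `U₁`, the inverse of `c` over the open subsets of `U₂`. -/
inductive SecGen (U : Opens projLine) : Type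
  | a | c | x | D | Dinv
  | ainv (h : U ≤ chart 0)
  | cinv (h : U ≤ chart 1)

section Relations

open SecGen FreeAlgebra

/-- The relations between the generators of the algebra of sections of `F` over `U`. -/
inductive SecRel (q : ℂˣ) (U : Opens projLine) :
    FreeAlgebra ℂ (SecGen U) → FreeAlgebra ℂ (SecGen U) → Prop
  | ac : SecRel q U (ι ℂ a * ι ℂ c) ((q : ℂ) • (ι ℂ c * ι ℂ a))
  | ax : SecRel q U (ι ℂ a * ι ℂ x) ((q : ℂ)⁻¹ • (ι ℂ x * ι ℂ a))
  | cx : SecRel q U (ι ℂ c * ι ℂ x) ((q : ℂ)⁻¹ • (ι ℂ x * ι ℂ c))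
  | aD : SecRel q U (ι ℂ a * ι ℂ D) (ι ℂ D * ι ℂ a)
  | cD : SecRel q U (ι ℂ c * ι ℂ D) ((q : ℂ)⁻¹ ^ 2 • (ι ℂ D * ι ℂ c))
  | xD : SecRel q U (ι ℂ x * ι ℂ D) ((q : ℂ) ^ 2 • (ι ℂ D * ι ℂ x))
  | D_mul_Dinv : SecRel q U (ι ℂ D * ι ℂ Dinv) 1
  | Dinv_mul_D : SecRel q U (ι ℂ Dinv * ι ℂ D) 1
  | a_mul_ainv (h : U ≤ chart 0) : SecRel q U (ι ℂ a * ι ℂ (ainv h)) 1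
  | ainv_mul_a (h : U ≤ chart 0) : SecRel q U (ι ℂ (ainv h) * ι ℂ a) 1
  | c_mul_cinv (h : U ≤ chart 1) : SecRel q U (ι ℂ c * ι ℂ (cinv h)) 1
  | cinv_mul_c (h : U ≤ chart 1) : SecRel q U (ι ℂ (cinv h) * ι ℂ c) 1
  | empty (h : U = ⊥) : SecRel q U 1 0

end Relations

/-- The algebra of sections of `F` over `U`. Over `U₁` it is the localization `GL(2)[a⁻¹]` of the
Takhtajan-Sudbery algebra, with `x = a⁻¹ b`; over `U₂` it is the localization `GL(2)[c⁻¹]`, with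
`x = c⁻¹ d` (this is the element usually called `y`). The two are glued by identifying
`a⁻¹ b` with `c⁻¹ d`, and `a`, `c` and the quantum determinant `D` with themselves. -/
def Sec (q : ℂˣ) (U : Opens projLine) : Type := RingQuot (SecRel q U)

instance (q : ℂˣ) (U : Opens projLine) : Ring (Sec q U) :=
  inferInstanceAs (Ring (RingQuot (SecRel q U)))

instance (q : ℂˣ) (U : Opens projLine) : Algebra ℂ (Sec q U) :=
  inferInstanceAs (Algebra ℂ (RingQuot (SecRel q U)))

namespace Sec

open SecGen

/-- The generators. -/
def gen (q : ℂˣ) {U : Opens projLine} (g : SecGen U) : Sec q U :=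
  RingQuot.mkAlgHom ℂ (SecRel q U) (FreeAlgebra.ι ℂ g)

variable {q : ℂˣ} {U V W : Opens projLine} {B : Type} [Ring B] [Algebra ℂ B]

/-- The algebra map determined by its values on the generators. -/
def lift (f : SecGen U → B)
    (h : ∀ x y, SecRel q U x y → FreeAlgebra.lift ℂ f x = FreeAlgebra.lift ℂ f y) :
    Sec q U →ₐ[ℂ] B :=
  RingQuot.liftAlgHom ℂ (s := SecRel q U) ⟨FreeAlgebra.lift ℂ f, h⟩

@[simp]
theorem lift_gen (f : SecGen U → B)
    (h : ∀ x y, SecRel q U x y → FreeAlgebra.lift ℂ f x = FreeAlgebra.lift ℂ f y)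
    (g : SecGen U) : lift f h (gen q g) = f g := by
  simp only [lift, gen]
  exact (RingQuot.liftAlgHom_mkAlgHom_apply ℂ (FreeAlgebra.lift ℂ f) h _).trans (by simp)

theorem hom_ext {f g : Sec q U →ₐ[ℂ] B} (h : ∀ x, f (gen q x) = g (gen q x)) : f = g := by
  apply RingQuot.ringQuot_ext' (S := ℂ) (s := SecRel q U)
  apply FreeAlgebra.hom_ext
  funext x
  exact h x

/-- The quotient map from the free algebra. -/
def mk (q : ℂˣ) (U : Opens projLine) : FreeAlgebra ℂ (SecGen U) →ₐ[ℂ] Sec q U :=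
  RingQuot.mkAlgHom ℂ (SecRel q U)

theorem mk_ι (g : SecGen U) : mk q U (FreeAlgebra.ι ℂ g) = gen q g := rfl

theorem rel {x y : FreeAlgebra ℂ (SecGen U)} (h : SecRel q U x y) : mk q U x = mk q U y :=
  RingQuot.mkAlgHom_rel ℂ h

theorem ca : gen q (c : SecGen U) * gen q a = (q : ℂ)⁻¹ • (gen q a * gen q c) := by
  have h := rel (SecRel.ac (q := q) (U := U))
  simp only [map_mul, map_smul, mk_ι] at h
  rw [h, smul_smul, inv_mul_cancel₀ q.ne_zero, one_smul]

theorem xa : gen q (x : SecGen U) * gen q a = (q : ℂ) • (gen q a * gen q x) := by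
  have h := rel (SecRel.ax (q := q) (U := U))
  simp only [map_mul, map_smul, mk_ι] at h
  rw [h, smul_smul, mul_inv_cancel₀ q.ne_zero, one_smul]

theorem xc : gen q (x : SecGen U) * gen q c = (q : ℂ) • (gen q c * gen q x) := by
  have h := rel (SecRel.cx (q := q) (U := U))
  simp only [map_mul, map_smul, mk_ι] at h
  rw [h, smul_smul, mul_inv_cancel₀ q.ne_zero, one_smul]

theorem Da : gen q (D : SecGen U) * gen q a = gen q a * gen q D := by
  have h := rel (SecRel.aD (q := q) (U := U))
  simp only [map_mul, mk_ι] at h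
  exact h.symm

theorem Dc : gen q (D : SecGen U) * gen q c = (q : ℂ) ^ 2 • (gen q c * gen q D) := by
  have h := rel (SecRel.cD (q := q) (U := U))
  simp only [map_mul, map_smul, mk_ι] at h
  rw [h, smul_smul, ← mul_pow, mul_inv_cancel₀ q.ne_zero, one_pow, one_smul]

theorem Dx : gen q (D : SecGen U) * gen q x = (q : ℂ)⁻¹ ^ 2 • (gen q x * gen q D) := by
  have h := rel (SecRel.xD (q := q) (U := U))
  simp only [map_mul, map_smul, mk_ι] at h
  rw [h, smul_smul, ← mul_pow, inv_mul_cancel₀ q.ne_zero, one_pow, one_smul]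

theorem D_mul_Dinv : gen q (D : SecGen U) * gen q Dinv = 1 := by
  simpa only [map_mul, map_one, mk_ι] using rel (SecRel.D_mul_Dinv (q := q) (U := U))

theorem Dinv_mul_D : gen q (Dinv : SecGen U) * gen q D = 1 := by
  simpa only [map_mul, map_one, mk_ι] using rel (SecRel.Dinv_mul_D (q := q) (U := U))

theorem a_mul_ainv (h : U ≤ chart 0) : gen q (a : SecGen U) * gen q (ainv h) = 1 := by
  simpa only [map_mul, map_one, mk_ι] using rel (SecRel.a_mul_ainv (q := q) h)

theorem ainv_mul_a (h : U ≤ chart 0) : gen q (ainv h) * gen q (a : SecGen U) = 1 := by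
  simpa only [map_mul, map_one, mk_ι] using rel (SecRel.ainv_mul_a (q := q) h)

theorem c_mul_cinv (h : U ≤ chart 1) : gen q (c : SecGen U) * gen q (cinv h) = 1 := by
  simpa only [map_mul, map_one, mk_ι] using rel (SecRel.c_mul_cinv (q := q) h)

theorem cinv_mul_c (h : U ≤ chart 1) : gen q (cinv h) * gen q (c : SecGen U) = 1 := by
  simpa only [map_mul, map_one, mk_ι] using rel (SecRel.cinv_mul_c (q := q) h)

theorem one_eq_zero (h : U = ⊥) : (1 : Sec q U) = 0 := by
  simpa only [map_one, map_zero] using rel (SecRel.empty (q := q) h)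

/-- Restriction of generators. -/
def resGen (h : V ≤ U) : SecGen U → SecGen V
  | a => a
  | c => c
  | x => x
  | D => D
  | Dinv => Dinv
  | ainv h' => ainv (h.trans h')
  | cinv h' => cinv (h.trans h')

/-- The restriction map, sending each generator to the generator of the same name. -/
def res (q : ℂˣ) (h : V ≤ U) : Sec q U →ₐ[ℂ] Sec q V :=
  lift (fun g => gen q (resGen h g)) <| by
    have hq := q.ne_zero
    intro x y r
    cases r with
    | D_mul_Dinv => simpa [resGen] using D_mul_Dinv
    | Dinv_mul_D => simpa [resGen] using Dinv_mul_D
    | a_mul_ainv h' => simpa [resGen] using a_mul_ainv _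
    | ainv_mul_a h' => simpa [resGen] using ainv_mul_a _
    | c_mul_cinv h' => simpa [resGen] using c_mul_cinv _
    | cinv_mul_c h' => simpa [resGen] using cinv_mul_c _
    | empty h' => simpa using one_eq_zero (le_bot_iff.1 (h' ▸ h))
    | _ =>
      simp only [map_mul, map_smul, FreeAlgebra.lift_ι_apply, resGen, ca, xa, xc, Da, Dc, Dx,
        smul_smul]
      try (match_scalars; field_simp)

@[simp]
theorem res_gen (h : V ≤ U) (g : SecGen U) : res q h (gen q g) = gen q (resGen h g) :=
  lift_gen _ _ g

theorem res_refl : res q (le_refl U) = AlgHom.id ℂ (Sec q U) := by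
  apply hom_ext
  intro g
  cases g <;> simp [resGen]

theorem res_comp (h : V ≤ U) (h' : W ≤ V) :
    (res q h').comp (res q h) = res q (h'.trans h) := by
  apply hom_ext
  intro g
  cases g <;> simp [resGen]

open scoped TensorProduct

/-- The coaction of `H` on the generators. -/
def coactionGen (q : ℂˣ) (U : Opens projLine) : SecGen U → Sec q U ⊗[ℂ] Parabolic q
  | a => gen q a ⊗ₜ Parabolic.t q
  | c => gen q c ⊗ₜ Parabolic.t q
  | x => 1 ⊗ₜ (Parabolic.tinv q * Parabolic.n q) +
      gen q x ⊗ₜ (Parabolic.tinv q * Parabolic.s q)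
  | D => gen q D ⊗ₜ (Parabolic.t q * Parabolic.s q)
  | Dinv => gen q Dinv ⊗ₜ Parabolic.e q
  | ainv h => gen q (ainv h) ⊗ₜ Parabolic.tinv q
  | cinv h => gen q (cinv h) ⊗ₜ Parabolic.tinv q

/-- The coaction of `H` on the sections over `U`, as an algebra map. -/
def coactionHom (q : ℂˣ) (U : Opens projLine) : Sec q U →ₐ[ℂ] Sec q U ⊗[ℂ] Parabolic q :=
  lift (coactionGen q U) <| by
    have hq := q.ne_zero
    have h₁ : ∀ v : Parabolic q, Parabolic.tinv q * (Parabolic.t q * v) = v := fun v => by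
      rw [← mul_assoc, Parabolic.tinv_t, one_mul]
    have h₂ : ∀ v : Parabolic q, Parabolic.t q * (Parabolic.tinv q * v) = v := fun v => by
      rw [← mul_assoc, Parabolic.t_tinv, one_mul]
    have h₃ : Parabolic.t q * (Parabolic.s q * Parabolic.e q) = 1 := Parabolic.t_tinv
    have h₄ : Parabolic.e q * (Parabolic.t q * Parabolic.s q) = 1 := by
      rw [← mul_assoc, Parabolic.et, mul_assoc, Parabolic.es, h₃]
    have h₅ : ∀ v : Parabolic q, Parabolic.n q * (Parabolic.t q * v) =
        (q : ℂ) • (Parabolic.t q * (Parabolic.n q * v)) := fun v => by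
      rw [← mul_assoc, Parabolic.nt, smul_mul_assoc, mul_assoc]
    have h₆ : ∀ v : Parabolic q, Parabolic.s q * (Parabolic.t q * v) =
        Parabolic.t q * (Parabolic.s q * v) := fun v => by
      rw [← mul_assoc, Parabolic.st, mul_assoc]
    have h₇ : ∀ v : Parabolic q, Parabolic.s q * (Parabolic.tinv q * v) =
        Parabolic.tinv q * (Parabolic.s q * v) := fun v => by
      rw [← mul_assoc, Parabolic.s_tinv, mul_assoc]
    intro x y r
    cases r with
    | D_mul_Dinv =>
      simp only [map_mul, map_one, FreeAlgebra.lift_ι_apply, coactionGen,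
        Algebra.TensorProduct.tmul_mul_tmul, D_mul_Dinv, mul_assoc, h₃]
      rfl
    | Dinv_mul_D =>
      simp only [map_mul, map_one, FreeAlgebra.lift_ι_apply, coactionGen,
        Algebra.TensorProduct.tmul_mul_tmul, Dinv_mul_D, h₄]
      rfl
    | a_mul_ainv h' =>
      simp only [map_mul, map_one, FreeAlgebra.lift_ι_apply, coactionGen,
        Algebra.TensorProduct.tmul_mul_tmul, a_mul_ainv, Parabolic.t_tinv]
      rfl
    | ainv_mul_a h' =>
      simp only [map_mul, map_one, FreeAlgebra.lift_ι_apply, coactionGen,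
        Algebra.TensorProduct.tmul_mul_tmul, ainv_mul_a, Parabolic.tinv_t]
      rfl
    | c_mul_cinv h' =>
      simp only [map_mul, map_one, FreeAlgebra.lift_ι_apply, coactionGen,
        Algebra.TensorProduct.tmul_mul_tmul, c_mul_cinv, Parabolic.t_tinv]
      rfl
    | cinv_mul_c h' =>
      simp only [map_mul, map_one, FreeAlgebra.lift_ι_apply, coactionGen,
        Algebra.TensorProduct.tmul_mul_tmul, cinv_mul_c, Parabolic.tinv_t]
      rfl
    | empty h' =>
      simp only [map_one, map_zero]
      rw [Algebra.TensorProduct.one_def, one_eq_zero h', TensorProduct.zero_tmul]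
    | _ =>
      simp only [map_mul, map_smul, FreeAlgebra.lift_ι_apply, coactionGen, mul_add, add_mul,
        Algebra.TensorProduct.tmul_mul_tmul, ca, xa, xc, Da, Dc, Dx, mul_assoc, one_mul, mul_one,
        Parabolic.nt, Parabolic.st, Parabolic.sn, h₁, h₂, h₅, h₆, h₇, mul_smul_comm,
        TensorProduct.tmul_smul, ← TensorProduct.smul_tmul', smul_smul, smul_add]
      try (match_scalars <;> field_simp)

@[simp]
theorem coactionHom_gen (g : SecGen U) : coactionHom q U (gen q g) = coactionGen q U g :=
  lift_gen _ _ g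

/-- The coaction of `H` on the sections over `U`. -/
def coaction (q : ℂˣ) (U : Opens projLine) : RightCoaction ℂ (Parabolic q) (Sec q U) where
  toAlgHom := coactionHom q U
  coassoc := by
    apply hom_ext
    intro g
    cases g <;> simp [coactionGen, Parabolic.comul_t, Parabolic.comul_tinv, Parabolic.comul_n,
      Parabolic.comul_s, Parabolic.comul_e, TensorProduct.tmul_add, TensorProduct.add_tmul,
      mul_add, Parabolic.tinv_t, Algebra.TensorProduct.one_def, add_assoc]
  counit := by
    apply hom_ext
    intro g
    cases g <;> simp [coactionGen, Parabolic.counit_t, Parabolic.counit_tinv,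
      Parabolic.counit_n, Parabolic.counit_s, Parabolic.counit_e]

theorem res_coaction (h : V ≤ U) : (coactionHom q V).comp (res q h) =
    (Algebra.TensorProduct.map (res q h) (AlgHom.id ℂ (Parabolic q))).comp (coactionHom q U) := by
  apply hom_ext
  intro g
  cases g <;> simp [coactionGen, resGen]

end Sec

/-- The sheaf `F` of `H`-comodule algebras on the projective line. -/
def sheafF (q : ℂˣ) : ComoduleAlgebraPresheaf ℂ (Parabolic q) projLine where
  presheaf :=
    { obj := fun U => AlgCat.of ℂ (Sec q U.unop)
      map := fun i => AlgCat.ofHom (Sec.res q (leOfHom i.unop))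
      map_id := fun _ => congrArg AlgCat.ofHom Sec.res_refl
      map_comp := fun i j =>
        congrArg AlgCat.ofHom (Sec.res_comp (leOfHom i.unop) (leOfHom j.unop)).symm }
  coaction U := Sec.coaction q U
  map_coaction i := Sec.res_coaction (leOfHom i)

/-! ## The sheaf `F₀` -/

/-- The sections of `F₀` over `U`: the quotient of the sections of `F` by the ideal `(x)`. -/
abbrev Sec₀ (q : ℂˣ) (U : Opens projLine) : Type :=
  Sec q U ⧸ idealOf (Sec.gen q (SecGen.x : SecGen U))

namespace Sec₀

variable {q : ℂˣ} {U V W : Opens projLine}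

/-- The quotient map. -/
def quotientMap (q : ℂˣ) (U : Opens projLine) : Sec q U →ₐ[ℂ] Sec₀ q U :=
  Ideal.Quotient.mkₐ ℂ (idealOf (Sec.gen q (SecGen.x : SecGen U)))

theorem quotientMap_x : quotientMap q U (Sec.gen q SecGen.x) = 0 := mk_self_eq_zero _

theorem quotientMap_surjective : Function.Surjective (quotientMap q U) :=
  Ideal.Quotient.mk_surjective

theorem hom_ext {B : Type} [Ring B] [Algebra ℂ B] {f g : Sec₀ q U →ₐ[ℂ] B}
    (h : f.comp (quotientMap q U) = g.comp (quotientMap q U)) : f = g :=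
  Ideal.Quotient.algHom_ext ℂ h

/-- The algebra map induced by an algebra map that sends `x` to `0`. -/
def lift {B : Type} [Ring B] [Algebra ℂ B] (f : Sec q U →ₐ[ℂ] B)
    (hf : f (Sec.gen q SecGen.x) = 0) : Sec₀ q U →ₐ[ℂ] B :=
  Ideal.Quotient.liftₐ _ f fun _ h => eq_zero_of_mem_idealOf f.toRingHom hf h

theorem lift_comp {B : Type} [Ring B] [Algebra ℂ B] (f : Sec q U →ₐ[ℂ] B)
    (hf : f (Sec.gen q SecGen.x) = 0) : (lift f hf).comp (quotientMap q U) = f := rfl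

/-- The restriction maps of `F₀`, induced by those of `F`. -/
def res (q : ℂˣ) (h : V ≤ U) : Sec₀ q U →ₐ[ℂ] Sec₀ q V :=
  lift ((quotientMap q V).comp (Sec.res q h)) (by simp [Sec.resGen, quotientMap_x])

theorem res_comp_quotientMap (h : V ≤ U) :
    (res q h).comp (quotientMap q U) = (quotientMap q V).comp (Sec.res q h) := rfl

theorem res_refl : res q (le_refl U) = AlgHom.id ℂ (Sec₀ q U) := by
  apply hom_ext
  rw [res_comp_quotientMap, Sec.res_refl]
  rfl

theorem res_comp (h : V ≤ U) (h' : W ≤ V) :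
    (res q h').comp (res q h) = res q (h'.trans h) := by
  apply hom_ext
  rw [AlgHom.comp_assoc, res_comp_quotientMap, ← AlgHom.comp_assoc, res_comp_quotientMap,
    res_comp_quotientMap, AlgHom.comp_assoc, Sec.res_comp]

open scoped TensorProduct

theorem quotient_coactionHom_x (q : ℂˣ) (U : Opens projLine) :
    Algebra.TensorProduct.map
        (Ideal.Quotient.mkₐ ℂ (idealOf (Sec.gen q (SecGen.x : SecGen U))))
        (Ideal.Quotient.mkₐ ℂ (leviIdeal q))
      ((Sec.coaction q U).toAlgHom (Sec.gen q SecGen.x)) = 0 := by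
  change Algebra.TensorProduct.map _ _ (Sec.coactionHom q U (Sec.gen q SecGen.x)) = 0
  simp [Sec.coactionGen, mk_self_eq_zero]

/-- The coaction of `H₀` on `F₀`, induced by the coaction of `H` on `F`. -/
def coaction (q : ℂˣ) (U : Opens projLine) : RightCoaction ℂ (Levi q) (Sec₀ q U) :=
  (Sec.coaction q U).quotient (leviIdeal q) (Sec.gen q SecGen.x) (quotient_coactionHom_x q U)

theorem res_coaction (h : V ≤ U) : (coaction q V).toAlgHom.comp (res q h) =
    (Algebra.TensorProduct.map (res q h) (AlgHom.id ℂ (Levi q))).comp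
      (coaction q U).toAlgHom :=
  RightCoaction.quotient_natural _ _ (leviIdeal q) _ _ _ _ (Sec.res q h) (res q h) rfl
    (Sec.res_coaction h)

end Sec₀

/-- The sheaf `F₀` of `H₀`-comodule algebras on the projective line. -/
def sheafF₀ (q : ℂˣ) : ComoduleAlgebraPresheaf ℂ (Levi q) projLine where
  presheaf :=
    { obj := fun U => AlgCat.of ℂ (Sec₀ q U.unop)
      map := fun i => AlgCat.ofHom (Sec₀.res q (leOfHom i.unop))
      map_id := fun _ => congrArg AlgCat.ofHom Sec₀.res_refl
      map_comp := fun i j =>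
        congrArg AlgCat.ofHom (Sec₀.res_comp (leOfHom i.unop) (leOfHom j.unop)).symm }
  coaction U := Sec₀.coaction q U
  map_coaction i := Sec₀.res_coaction (leOfHom i)

/-! ## Localizations of algebras -/

/-- The algebra map `f : A → R` is the localization `A[s⁻¹]`: it makes `s` invertible, and it is
universal among the algebra maps with this property. -/
def IsLocalizationAt {A R : Type} [Ring A] [Algebra ℂ A] [Ring R] [Algebra ℂ R]
    (f : A →ₐ[ℂ] R) (s : A) : Prop :=
  IsUnit (f s) ∧ ∀ (T : Type) [Ring T] [Algebra ℂ T] (g : A →ₐ[ℂ] T), IsUnit (g s) →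
    ∃! h : R →ₐ[ℂ] T, h.comp f = g

/-- The right coaction of `H` on the Takhtajan-Sudbery algebra, the projection of the
coproduct. -/
def coactionGL2 (q : ℂˣ) : GL2 q →ₐ[ℂ] GL2 q ⊗[ℂ] Parabolic q :=
  (Algebra.TensorProduct.map (AlgHom.id ℂ (GL2 q)) (parabolicMk q)).comp
    (Bialgebra.comulAlgHom ℂ (GL2 q))

end QuantumBundle

end

open QuantumBundle

noncomputable section

namespace QuantumBundle

/-! ### Free modules over noncommutative rings and faithful flatness -/

section FreeModules

variable {B : Type} [Ring B]

/-! Everything is read off from monomial bases. For a nonempty open set U the algebra F(U) has as a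
basis the monomials a^i c^j x^k D^l with k ≥ 0, where i may be negative only if U ⊆ U₁ and j only if
U ⊆ U₂. They span because the generators commute up to nonzero scalars (`Sec.span_mon`). They are
independent because the generators act by weighted shifts on one fixed vector space with basis ℤ × ℤ
× ℕ × ℤ, and the monomials carry the basis vector of index 0 to distinct basis vectors
(`Sec.ev_mon`). In this representation x may be scaled by a parameter ε: the value 1 serves F, and
the value 0 kills x and gives the monomial basis of F₀.

Sheaf property. Every nonempty open set contains U₁ ∩ U₂, and the only cover with a nontrivial
gluing condition is essentially {U₁, U₂} (`isSheaf_of_glue`). Restriction does not change monomial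
coordinates, so sections over U₁ and U₂ that agree on the overlap have a common coordinate vector.
Its exponents of a and of c are all nonnegative, hence it comes from a global section. For the
structure sheaf, a polynomial in z equal to a polynomial in z⁻¹ is constant.

Principality. On U₁ put u = a and z = c a⁻¹; on U₂ put u = c and z = a c⁻¹. Up to nonzero scalars
the monomial basis consists of the products z^n u^j x^k D^l. So F(Uᵢ) is free over ℂ[z] with basis
u^j x^k D^l, on the left and, since z commutes with these elements up to scalars, also on the right;
faithful flatness follows. With w = t⁻¹n, the Hopf algebra H has the basis t^j w^k (ts)^l, and the
coaction sends u^j x^k D^l to u^j D^l ⊗ t^j w^k (ts)^l plus terms of lower degree in w. This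
triangularity (`RightCoaction.eq_zero_of_triangular`) shows both that the coinvariants are exactly
ℂ[z] and that the canonical map is injective. Surjectivity needs to be tested only on algebra
generators of H. For F₀ the variable x is gone and the coaction is diagonal with group-like
coefficients, which also gives the cleaving map. The same diagonal argument makes H principal over
H₀, with coinvariants ℂ[w].

The basis of H is itself taken from F(U₁), of which H is the retract obtained by setting c = 0; that
of H₀ comes from F₀(U₁) in the same way. The embedding of the structure sheaf sends the affine
coordinate to c a⁻¹, and its image over Uᵢ is ℂ[z], which matches coinvariants of F with those of
F₀.

Localizations. Solving D = ad − q⁻¹bc for d when b = ax, or for b when d = cx, gives the maps from A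
to F(U₁) and F(U₂). The universal properties are then checked on generators and relations. -/

open scoped Classical in
theorem exact_mapRange_iff {K N₁ N₂ N₃ : Type} [Nonempty K] [AddCommGroup N₁] [AddCommGroup N₂]
    [AddCommGroup N₃] (f : N₁ →+ N₂) (g : N₂ →+ N₃) :
    Function.Exact f g ↔ Function.Exact (Finsupp.mapRange.addMonoidHom (ι := K) f)
      (Finsupp.mapRange.addMonoidHom (ι := K) g) := by
  constructor
  · intro h v
    constructor
    · intro hv
      have hv' : ∀ k, ∃ w, f w = v k := fun k => (h _).1 (by simpa using DFunLike.congr_fun hv k)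
      choose w hw using hv'
      -- The chosen preimage of 0 need not be 0, so it is replaced by 0 off the support of v to keep
      -- the family finitely supported.
      refine ⟨Finsupp.onFinset v.support (fun k => if v k = 0 then 0 else w k) fun k hk => ?_, ?_⟩
      · by_contra h'
        simp [Finsupp.notMem_support_iff.1 h'] at hk
      · ext k
        by_cases hk : v k = 0 <;> simp [hk, hw]
    · rintro ⟨w, rfl⟩
      ext k
      simpa using (h _).2 ⟨w k, rfl⟩
  · intro h v
    obtain ⟨k⟩ := ‹Nonempty K›
    constructor
    · intro hv
      obtain ⟨w, hw⟩ := (h (Finsupp.single k v)).1 (by simp [hv])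
      exact ⟨w k, by simpa using DFunLike.congr_fun hw k⟩
    · rintro ⟨w, rfl⟩
      have := (h _).2 ⟨Finsupp.single k w, rfl⟩
      simpa using DFunLike.congr_fun this k

/-- The isomorphism `N ⊗_B M ≃ K →₀ N` given by a basis of `M`. -/
def balancedLeftHom {K N M : Type} [AddCommGroup N] [Module Bᵐᵒᵖ N] [AddCommGroup M] [Module B M]
    (β : Module.Basis K B M) : BalancedTensor B N M →+ (K →₀ N) :=
  QuotientAddGroup.lift _ (TensorProduct.liftAddHom
    (AddMonoidHom.mk' (fun n => AddMonoidHom.mk' (fun m => (β.repr m).mapRange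
      (fun b => MulOpposite.op b • n) (by simp)) (fun x y => by ext k; simp [add_smul]))
      (fun x y => by ext m k; simp))
    fun r n m => by ext k; simp [mul_smul, Int.cast_smul_eq_zsmul]) <| by
  rw [balancedRelations, AddSubgroup.closure_le]
  rintro _ ⟨n, b, m, rfl⟩
  rw [SetLike.mem_coe, AddMonoidHom.mem_ker, map_sub, sub_eq_zero]
  ext k
  simp [mul_smul]

theorem balancedLeftHom_mk {K N M : Type} [AddCommGroup N] [Module Bᵐᵒᵖ N] [AddCommGroup M]
    [Module B M] (β : Module.Basis K B M) (n : N) (m : M) (k : K) :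
    balancedLeftHom β (QuotientAddGroup.mk (n ⊗ₜ[ℤ] m)) k = MulOpposite.op (β.repr m k) • n := rfl

theorem balanced_induction {N M : Type} [AddCommGroup N] [Module Bᵐᵒᵖ N]
    [AddCommGroup M] [Module B M] {p : BalancedTensor B N M → Prop} (h0 : p 0)
    (ht : ∀ n m, p (QuotientAddGroup.mk (n ⊗ₜ[ℤ] m))) (ha : ∀ x y, p x → p y → p (x + y))
    (w : BalancedTensor B N M) : p w := by
  obtain ⟨w, rfl⟩ := QuotientAddGroup.mk_surjective w
  induction w with
  | zero => exact h0
  | tmul n m => exact ht n m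
  | add x y hx hy => exact ha _ _ hx hy

theorem balanced_mk_smul {N M : Type} [AddCommGroup N] [Module Bᵐᵒᵖ N] [AddCommGroup M]
    [Module B M] (n : N) (b : B) (m : M) :
    (QuotientAddGroup.mk (n ⊗ₜ[ℤ] (b • m)) : BalancedTensor B N M) =
      QuotientAddGroup.mk ((MulOpposite.op b • n) ⊗ₜ[ℤ] m) := by
  rw [eq_comm, ← sub_eq_zero, ← QuotientAddGroup.mk_sub, QuotientAddGroup.eq_zero_iff]
  exact AddSubgroup.subset_closure ⟨n, b, m, rfl⟩

/-- The map `n ↦ n ⊗ m`. -/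
def balancedTmulRight (B : Type) [Ring B] {N M : Type} [AddCommGroup N] [Module Bᵐᵒᵖ N]
    [AddCommGroup M] [Module B M] (m : M) : N →+ BalancedTensor B N M :=
  (QuotientAddGroup.mk' _).comp ((TensorProduct.mk ℤ N M).flip m).toAddMonoidHom

/-- The map `m ↦ n ⊗ m`. -/
def balancedTmulLeft (B : Type) [Ring B] {N M : Type} [AddCommGroup N] [Module Bᵐᵒᵖ N]
    [AddCommGroup M] [Module B M] (n : N) : M →+ BalancedTensor B N M :=
  (QuotientAddGroup.mk' _).comp (TensorProduct.mk ℤ N M n).toAddMonoidHom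

theorem balancedTmulRight_apply {N M : Type} [AddCommGroup N] [Module Bᵐᵒᵖ N] [AddCommGroup M]
    [Module B M] (n : N) (m : M) :
    balancedTmulRight B m n = QuotientAddGroup.mk (n ⊗ₜ[ℤ] m) := rfl

theorem balancedTmulLeft_apply {N M : Type} [AddCommGroup N] [Module Bᵐᵒᵖ N] [AddCommGroup M]
    [Module B M] (n : N) (m : M) :
    balancedTmulLeft B n m = QuotientAddGroup.mk (n ⊗ₜ[ℤ] m) := rfl

/-- The inverse of `balancedLeftHom`. -/
def balancedLeftInv {K N M : Type} [AddCommGroup N] [Module Bᵐᵒᵖ N] [AddCommGroup M] [Module B M]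
    (β : Module.Basis K B M) : (K →₀ N) →+ BalancedTensor B N M :=
  Finsupp.liftAddHom fun k => balancedTmulRight B (β k)

theorem balancedLeftInv_single {K N M : Type} [AddCommGroup N] [Module Bᵐᵒᵖ N] [AddCommGroup M]
    [Module B M] (β : Module.Basis K B M) (k : K) (n : N) :
    balancedLeftInv β (Finsupp.single k n) = QuotientAddGroup.mk (n ⊗ₜ[ℤ] β k) := by
  simp [balancedLeftInv, balancedTmulRight_apply]

/-- The isomorphism `N ⊗_B M ≃ K →₀ N` given by a basis of the left `B`-module `M`. -/
def balancedLeftEquiv {K N M : Type} [AddCommGroup N] [Module Bᵐᵒᵖ N] [AddCommGroup M] [Module B M]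
    (β : Module.Basis K B M) : BalancedTensor B N M ≃+ (K →₀ N) :=
  AddMonoidHom.toAddEquiv (balancedLeftHom β) (balancedLeftInv β)
    (by
      refine AddMonoidHom.ext fun w => ?_
      obtain ⟨w, rfl⟩ := QuotientAddGroup.mk_surjective w
      induction w with
      | zero => simp
      | add x y hx hy => rw [QuotientAddGroup.mk_add, map_add, map_add, hx, hy]
      | tmul n m =>
        obtain ⟨v, rfl⟩ := β.repr.symm.surjective m
        induction v using Finsupp.induction_linear with
        | zero => simp
        | add x y hx hy =>
          rw [map_add, TensorProduct.tmul_add, QuotientAddGroup.mk_add, map_add, map_add, hx, hy]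
        | single k b =>
          have h : balancedLeftHom β (QuotientAddGroup.mk (n ⊗ₜ[ℤ] β.repr.symm (Finsupp.single k b)))
              = Finsupp.single k (MulOpposite.op b • n) := by
            ext k'
            by_cases hk : k = k' <;> simp [balancedLeftHom_mk, hk]
          rw [AddMonoidHom.comp_apply, h, balancedLeftInv_single, Module.Basis.repr_symm_single,
            balanced_mk_smul]
          rfl)
    (by
      apply Finsupp.addHom_ext
      intro k n
      ext k'
      by_cases hk : k = k' <;>
        simp [balancedLeftInv_single, balancedLeftHom_mk, hk])

/-- A basis indexed by K identifies - ⊗_B M, naturally in the right module, with the direct sum of K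
copies. Such a direct sum preserves exactness, and reflects it as soon as K is nonempty. -/
theorem isFaithfullyFlatLeft_of_basis {K M : Type} [Nonempty K] [AddCommGroup M] [Module B M]
    (β : Module.Basis K B M) : IsFaithfullyFlatLeft B M := by
  intro N₁ N₂ N₃ _ _ _ _ _ _ f g
  refine (exact_mapRange_iff (K := K) f.toAddMonoidHom g.toAddMonoidHom).trans ?_
  have nat : ∀ {N N' : Type} [AddCommGroup N] [AddCommGroup N'] [Module Bᵐᵒᵖ N] [Module Bᵐᵒᵖ N']
      (f : N →ₗ[Bᵐᵒᵖ] N'),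
      (Finsupp.mapRange.addMonoidHom f.toAddMonoidHom).comp
        (balancedLeftEquiv β).toAddMonoidHom =
      (balancedLeftEquiv β).toAddMonoidHom.comp
        (BalancedTensor.map f (LinearMap.id : M →ₗ[B] M)) := by
    intro N N' _ _ _ _ f
    refine AddMonoidHom.ext fun w => Finsupp.ext fun _ => ?_
    obtain ⟨w, rfl⟩ := QuotientAddGroup.mk_surjective w
    induction w with
    | zero => simp
    | add x y hx hy => rw [QuotientAddGroup.mk_add, map_add, map_add, Finsupp.add_apply,
        Finsupp.add_apply, hx, hy]
    | tmul n m => exact map_smul f _ _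
  exact (Function.Exact.iff_of_ladder_addEquiv (balancedLeftEquiv (N := N₁) β)
    (balancedLeftEquiv (N := N₂) β) (balancedLeftEquiv (N := N₃) β) (nat f) (nat g))

/-- The isomorphism `N ⊗_B M ≃ K →₀ M` given by a basis of `N`. -/
def balancedRightHom {K N M : Type} [AddCommGroup N] [Module Bᵐᵒᵖ N] [AddCommGroup M] [Module B M]
    (β : Module.Basis K Bᵐᵒᵖ N) : BalancedTensor B N M →+ (K →₀ M) :=
  QuotientAddGroup.lift _ (TensorProduct.liftAddHom
    (AddMonoidHom.mk' (fun n => AddMonoidHom.mk' (fun m => (β.repr n).mapRange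
      (fun b => b.unop • m) (by simp)) (fun x y => by ext k; simp))
      (fun x y => by ext m k; simp [add_smul]))
    fun r n m => by ext k; simp [mul_smul, Int.cast_smul_eq_zsmul]) <| by
  rw [balancedRelations, AddSubgroup.closure_le]
  rintro _ ⟨n, b, m, rfl⟩
  rw [SetLike.mem_coe, AddMonoidHom.mem_ker, map_sub, sub_eq_zero]
  ext k
  simp [mul_smul]

theorem balancedRightHom_mk {K N M : Type} [AddCommGroup N] [Module Bᵐᵒᵖ N] [AddCommGroup M]
    [Module B M] (β : Module.Basis K Bᵐᵒᵖ N) (n : N) (m : M) (k : K) :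
    balancedRightHom β (QuotientAddGroup.mk (n ⊗ₜ[ℤ] m)) k = (β.repr n k).unop • m := rfl

/-- The inverse of `balancedRightHom`. -/
def balancedRightInv {K N M : Type} [AddCommGroup N] [Module Bᵐᵒᵖ N] [AddCommGroup M] [Module B M]
    (β : Module.Basis K Bᵐᵒᵖ N) : (K →₀ M) →+ BalancedTensor B N M :=
  Finsupp.liftAddHom fun k => balancedTmulLeft B (β k)

theorem balancedRightInv_single {K N M : Type} [AddCommGroup N] [Module Bᵐᵒᵖ N] [AddCommGroup M]
    [Module B M] (β : Module.Basis K Bᵐᵒᵖ N) (k : K) (m : M) :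
    balancedRightInv β (Finsupp.single k m) = QuotientAddGroup.mk (β k ⊗ₜ[ℤ] m) := by
  simp [balancedRightInv, balancedTmulLeft_apply]

/-- The isomorphism `N ⊗_B M ≃ K →₀ M` given by a basis of the right `B`-module `N`. -/
def balancedRightEquiv {K N M : Type} [AddCommGroup N] [Module Bᵐᵒᵖ N] [AddCommGroup M]
    [Module B M] (β : Module.Basis K Bᵐᵒᵖ N) : BalancedTensor B N M ≃+ (K →₀ M) :=
  AddMonoidHom.toAddEquiv (balancedRightHom β) (balancedRightInv β)
    (by
      refine AddMonoidHom.ext fun w => ?_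
      obtain ⟨w, rfl⟩ := QuotientAddGroup.mk_surjective w
      induction w with
      | zero => simp
      | add x y hx hy => rw [QuotientAddGroup.mk_add, map_add, map_add, hx, hy]
      | tmul n m =>
        obtain ⟨v, rfl⟩ := β.repr.symm.surjective n
        induction v using Finsupp.induction_linear with
        | zero => simp
        | add x y hx hy =>
          rw [map_add, TensorProduct.add_tmul, QuotientAddGroup.mk_add, map_add, map_add, hx, hy]
        | single k b =>
          have h : balancedRightHom β
              (QuotientAddGroup.mk (β.repr.symm (Finsupp.single k b) ⊗ₜ[ℤ] m))
              = Finsupp.single k (b.unop • m) := by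
            ext k'
            by_cases hk : k = k' <;> simp [balancedRightHom_mk, hk]
          rw [AddMonoidHom.comp_apply, h, balancedRightInv_single, Module.Basis.repr_symm_single,
            balanced_mk_smul]
          rfl)
    (by
      apply Finsupp.addHom_ext
      intro k n
      ext k'
      by_cases hk : k = k' <;>
        simp [balancedRightInv_single, balancedRightHom_mk, hk])

theorem isFaithfullyFlatRight_of_basis {K N : Type} [Nonempty K] [AddCommGroup N] [Module Bᵐᵒᵖ N]
    (β : Module.Basis K Bᵐᵒᵖ N) : IsFaithfullyFlatRight B N := by
  intro M₁ M₂ M₃ _ _ _ _ _ _ f g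
  refine (exact_mapRange_iff (K := K) f.toAddMonoidHom g.toAddMonoidHom).trans ?_
  have nat : ∀ {M M' : Type} [AddCommGroup M] [AddCommGroup M'] [Module B M] [Module B M']
      (f : M →ₗ[B] M'),
      (Finsupp.mapRange.addMonoidHom f.toAddMonoidHom).comp
        (balancedRightEquiv β).toAddMonoidHom =
      (balancedRightEquiv β).toAddMonoidHom.comp
        (BalancedTensor.map (LinearMap.id : N →ₗ[Bᵐᵒᵖ] N) f) := by
    intro M M' _ _ _ _ f
    refine AddMonoidHom.ext fun w => Finsupp.ext fun _ => ?_
    obtain ⟨w, rfl⟩ := QuotientAddGroup.mk_surjective w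
    induction w with
    | zero => simp
    | add x y hx hy => rw [QuotientAddGroup.mk_add, map_add, map_add, Finsupp.add_apply,
        Finsupp.add_apply, hx, hy]
    | tmul n m => exact map_smul f _ _
  exact (Function.Exact.iff_of_ladder_addEquiv (balancedRightEquiv (M := M₁) β)
    (balancedRightEquiv (M := M₂) β) (balancedRightEquiv (M := M₃) β) (nat f) (nat g))

/-- A module over an algebra generated by one element `z` is free as soon as the elements
`z ^ i • e k` form a basis over the base field. -/
theorem exists_basis_of_basis_pow {k S M K : Type} [Field k] [Ring S] [Algebra k S]
    [AddCommGroup M] [Module k M] [Module S M] [IsScalarTower k S M] {z : S}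
    (hz : ∀ s, ∃ p : Polynomial k, Polynomial.aeval z p = s) (e : K → M)
    (hli : LinearIndependent k (fun m : ℕ × K => z ^ m.1 • e m.2))
    (hsp : ⊤ ≤ Submodule.span k (Set.range fun m : ℕ × K => z ^ m.1 • e m.2)) :
    ∃ β : Module.Basis K S M, ∀ k, β k = e k := by
  have hS : LinearIndependent S e := by
    choose p hp using hz
    rw [linearIndependent_iff']
    intro s c hc κ hκ
    set N := s.sup (fun κ => (p (c κ)).natDegree) + 1 with hN
    have hdeg : ∀ κ ∈ s, (p (c κ)).natDegree < N := fun κ hκ =>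
      Nat.lt_succ_of_le (Finset.le_sup (f := fun κ => (p (c κ)).natDegree) hκ)
    -- Writing every coefficient as a polynomial in z, with N a common strict bound on the degrees,
    -- turns a relation over S into a relation over k among the z ^ i • e κ.
    have key : ∑ m ∈ Finset.range N ×ˢ s, (p (c m.2)).coeff m.1 • (z ^ m.1 • e m.2) = 0 := by
      rw [Finset.sum_product_right, ← hc]
      refine Finset.sum_congr rfl fun κ hκ => ?_
      conv_rhs => rw [← hp (c κ), Polynomial.aeval_eq_sum_range' (hdeg κ hκ), Finset.sum_smul]
      exact Finset.sum_congr rfl fun i _ => (smul_assoc _ _ _).symm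
    rw [← hp (c κ)]
    have hp0 : p (c κ) = 0 := by
      ext i
      by_cases hi : i < N
      · exact linearIndependent_iff'.1 hli _ _ key (i, κ)
          (Finset.mem_product.2 ⟨Finset.mem_range.2 hi, hκ⟩)
      · exact Polynomial.coeff_eq_zero_of_natDegree_lt ((hdeg κ hκ).trans_le (not_lt.1 hi))
    rw [hp0, map_zero]
  have hspan : ⊤ ≤ Submodule.span S (Set.range e) := by
    intro x _
    have hx : x ∈ Submodule.span k (Set.range fun m : ℕ × K => z ^ m.1 • e m.2) := hsp trivial
    induction hx using Submodule.span_induction with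
    | mem x h =>
      obtain ⟨m, rfl⟩ := h
      exact Submodule.smul_mem _ _ (Submodule.subset_span ⟨_, rfl⟩)
    | zero => exact zero_mem _
    | add x y _ _ hx hy => exact add_mem (hx trivial) (hy trivial)
    | smul r x _ hx =>
      rw [← algebraMap_smul S r x]
      exact Submodule.smul_mem _ _ (hx trivial)
  exact ⟨Module.Basis.mk hS hspan, fun k => by simp⟩

end FreeModules

/-! ### Criteria for principal and cleft comodule algebras -/

section PrincipalCriteria

variable {k A K : Type} [Field k] [Ring A] [Algebra k A] {z : A} {e : K → A}

theorem exists_aeval_eq_of_adjoin (z : A) (s : Algebra.adjoin k {z}) :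
    ∃ p : Polynomial k, Polynomial.aeval
      (⟨z, Algebra.subset_adjoin rfl⟩ : Algebra.adjoin k {z}) p = s := by
  obtain ⟨s, hs⟩ := s
  have hs' := hs
  rw [Algebra.adjoin_singleton_eq_range_aeval] at hs'
  obtain ⟨p, rfl⟩ := hs'
  exact ⟨p, Subtype.ext (Polynomial.aeval_subalgebra_coe p _ _)⟩

theorem aeval_op (z : A) (p : Polynomial k) :
    Polynomial.aeval (MulOpposite.op z) p = MulOpposite.op (Polynomial.aeval z p) := by
  induction p using Polynomial.induction_on' with
  | add p r hp hr => simp [hp, hr]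
  | monomial i r => simp [Polynomial.aeval_monomial, Algebra.commutes]

theorem exists_left_basis (hli : LinearIndependent k (fun m : ℕ × K => z ^ m.1 * e m.2))
    (hsp : ⊤ ≤ Submodule.span k (Set.range fun m : ℕ × K => z ^ m.1 * e m.2)) :
    ∃ β : Module.Basis K (Algebra.adjoin k {z}) A, ∀ κ, β κ = e κ :=
  exists_basis_of_basis_pow (exists_aeval_eq_of_adjoin z) e hli hsp

/-- Because z and e κ commute up to a unit r, the product e κ * z ^ i is r ^ i times z ^ i * e κ.
Rescaling the k-basis by these units therefore gives the k-basis that freeness on the right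
requires. -/
theorem exists_right_basis (hli : LinearIndependent k (fun m : ℕ × K => z ^ m.1 * e m.2))
    (hsp : ⊤ ≤ Submodule.span k (Set.range fun m : ℕ × K => z ^ m.1 * e m.2))
    (hq : ∀ κ, ∃ r : kˣ, e κ * z = r • (z * e κ)) :
    ∃ β : Module.Basis K (Algebra.adjoin k {z})ᵐᵒᵖ A, ∀ κ, β κ = e κ := by
  choose r hr using hq
  have hpow : ∀ κ (i : ℕ), e κ * z ^ i = (r κ ^ i) • (z ^ i * e κ) := by
    intro κ i
    induction i with
    | zero => simp
    | succ i ih => rw [pow_succ, ← mul_assoc, ih, smul_mul_assoc, mul_assoc, hr, mul_smul_comm,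
        smul_smul, pow_succ, mul_assoc]
  have : IsScalarTower k (Algebra.adjoin k {z})ᵐᵒᵖ A :=
    ⟨fun c b a => by
      change a * ((c • b.unop : Algebra.adjoin k {z}) : A) = c • (a * (b.unop : A))
      simp⟩
  let β := (Module.Basis.mk hli hsp).unitsSMul fun m => r m.2 ^ m.1
  have hβ : ∀ m, β m = e m.2 * z ^ m.1 := fun m => by
    rw [Module.Basis.unitsSMul_apply, Module.Basis.mk_apply, hpow]
  have hfun : (fun m : ℕ × K => (MulOpposite.op
      (⟨z, Algebra.subset_adjoin rfl⟩ : Algebra.adjoin k {z})) ^ m.1 • e m.2) = β := by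
    funext m
    rw [hβ, ← MulOpposite.op_pow, subalgebra_op_smul]
    rfl
  refine exists_basis_of_basis_pow (k := k) (z := MulOpposite.op
      (⟨z, Algebra.subset_adjoin rfl⟩ : Algebra.adjoin k {z})) (fun s => ?_) e ?_ ?_
  · obtain ⟨p, hp⟩ := exists_aeval_eq_of_adjoin z s.unop
    exact ⟨p, by rw [aeval_op, hp, MulOpposite.op_unop]⟩
  · rw [hfun]; exact β.linearIndependent
  · rw [hfun, β.span_eq]

namespace RightCoaction

variable {H : Type} [Ring H] [Bialgebra k H] (δ : RightCoaction k H A)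

/-- Expand a coinvariant f as Σ b_κ e_κ with b_κ in k[z]. Then Σ b_κ δ(e_κ) = δ(f) = f ⊗ 1 = f
δ(e_κ₀). By `hind` the δ(e_κ) are independent over A, so comparing coefficients at κ₀ yields f =
b_κ₀. -/
theorem coinvariants_eq_adjoin {κ₀ : K} (he : e κ₀ = 1) (hz : z ∈ δ.coinvariants)
    (hli : LinearIndependent k (fun m : ℕ × K => z ^ m.1 * e m.2))
    (hsp : ⊤ ≤ Submodule.span k (Set.range fun m : ℕ × K => z ^ m.1 * e m.2))
    (hind : ∀ a : K →₀ A, (a.sum fun κ x => x ⊗ₜ[k] (1 : H) * δ.toAlgHom (e κ)) = 0 → a = 0) :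
    δ.coinvariants = Algebra.adjoin k {z} := by
  classical
  have hle : Algebra.adjoin k {z} ≤ δ.coinvariants := Algebra.adjoin_le (by simpa using hz)
  refine le_antisymm (fun f hf => ?_) hle
  obtain ⟨β, hβ⟩ := exists_left_basis hli hsp
  have hf' : ∑ κ ∈ (β.repr f).support, (β.repr f κ : A) * e κ = f := by
    conv_rhs => rw [← β.linearCombination_repr f, Finsupp.linearCombination_apply, Finsupp.sum]
    exact Finset.sum_congr rfl fun κ _ => by rw [hβ]; rfl
  let b : K →₀ A := (β.repr f).mapRange (fun x : Algebra.adjoin k {z} => (x : A)) rfl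
  have hb : (b.sum fun κ x => x ⊗ₜ[k] (1 : H) * δ.toAlgHom (e κ)) = δ.toAlgHom f := by
    rw [Finsupp.sum_mapRange_index (by simp)]
    conv_rhs => rw [← hf', map_sum]
    refine Finset.sum_congr rfl fun κ _ => ?_
    rw [map_mul, (δ.mem_coinvariants _).1 (hle (β.repr f κ).2)]
  have hs : ((Finsupp.single κ₀ f).sum fun κ x => x ⊗ₜ[k] (1 : H) * δ.toAlgHom (e κ)) =
      δ.toAlgHom f := by
    rw [Finsupp.sum_single_index (by simp), he, map_one, mul_one, (δ.mem_coinvariants _).1 hf]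
  have h0 : b - Finsupp.single κ₀ f = 0 := hind _ <| by
    rw [Finsupp.sum_sub_index (by intros; rw [TensorProduct.sub_tmul, sub_mul]), hb, hs, sub_self]
  have : f = (β.repr f κ₀ : A) := by
    have := DFunLike.congr_fun (sub_eq_zero.1 h0) κ₀
    simpa [b] using this.symm
  rw [this]
  exact (β.repr f κ₀).2

/-- In the coordinates of A ⊗_B A given by the left basis e of the second factor, the canonical map
is a ↦ Σ a_κ δ(e_κ). So `hind` is precisely its injectivity, and flatness is freeness on each side.
-/
theorem isPrincipal_of_basis {κ₀ : K} (he : e κ₀ = 1) (hz : z ∈ δ.coinvariants)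
    (hli : LinearIndependent k (fun m : ℕ × K => z ^ m.1 * e m.2))
    (hsp : ⊤ ≤ Submodule.span k (Set.range fun m : ℕ × K => z ^ m.1 * e m.2))
    (hq : ∀ κ, ∃ r : kˣ, e κ * z = r • (z * e κ))
    (hind : ∀ a : K →₀ A, (a.sum fun κ x => x ⊗ₜ[k] (1 : H) * δ.toAlgHom (e κ)) = 0 → a = 0)
    (hsurj : Function.Surjective δ.canonicalMap) : δ.IsPrincipal := by
  have hco := δ.coinvariants_eq_adjoin he hz hli hsp hind
  have : Nonempty K := ⟨κ₀⟩
  have hL : ∃ β : Module.Basis K δ.coinvariants A, ∀ κ, β κ = e κ := by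
    rw [hco]; exact exists_left_basis hli hsp
  have hR : ∃ β : Module.Basis K (δ.coinvariants)ᵐᵒᵖ A, ∀ κ, β κ = e κ := by
    rw [hco]; exact exists_right_basis hli hsp hq
  obtain ⟨β, hβ⟩ := hL
  obtain ⟨β', -⟩ := hR
  refine ⟨⟨(injective_iff_map_eq_zero _).2 fun w hw => ?_, hsurj⟩,
    isFaithfullyFlatLeft_of_basis β, isFaithfullyFlatRight_of_basis β'⟩
  have ha : ∀ a, δ.canonicalMap (balancedLeftInv β a) =
      a.sum fun κ x => x ⊗ₜ[k] (1 : H) * δ.toAlgHom (e κ) := by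
    intro a
    induction a using Finsupp.induction_linear with
    | zero => simp
    | add x y hx hy =>
      rw [map_add, map_add, hx, hy, Finsupp.sum_add_index' (by simp)
        (by intros; rw [TensorProduct.add_tmul, add_mul])]
    | single κ x =>
      rw [balancedLeftInv_single, canonicalMap_mk, Finsupp.sum_single_index (by simp), hβ]
  obtain ⟨a, rfl⟩ := (balancedLeftEquiv β).symm.surjective w
  rw [hind a ((ha a).symm.trans hw), map_zero]

theorem mul_mem_range_canonicalMap {y : A ⊗[k] H} (hy : y ∈ δ.canonicalMap.range) (a b : A) :
    a ⊗ₜ[k] (1 : H) * y * δ.toAlgHom b ∈ δ.canonicalMap.range := by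
  obtain ⟨w, rfl⟩ := hy
  induction w using balanced_induction with
  | h0 => simp
  | ha x y hx hy => rw [map_add, mul_add, add_mul]; exact add_mem hx hy
  | ht n m =>
    refine ⟨QuotientAddGroup.mk ((a * n) ⊗ₜ[ℤ] (m * b)), ?_⟩
    rw [canonicalMap_mk, canonicalMap_mk, map_mul, ← mul_assoc, ← mul_assoc,
      Algebra.TensorProduct.tmul_mul_tmul, mul_one]

/-- Since 1 ⊗ h commutes with n ⊗ 1, multiplying (n ⊗ 1) δ(m) by it gives (n ⊗ 1)(1 ⊗ h) δ(m), and
the range is stable under A on the left and under δ(A) on the right. Hence the h with 1 ⊗ h in the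
range are closed under products, although the canonical map is not multiplicative. -/
theorem mul_mem_range_canonicalMap_of_mem {h : H}
    (hh : (1 : A) ⊗ₜ[k] h ∈ δ.canonicalMap.range) {y : A ⊗[k] H}
    (hy : y ∈ δ.canonicalMap.range) : (1 : A) ⊗ₜ[k] h * y ∈ δ.canonicalMap.range := by
  obtain ⟨w, rfl⟩ := hy
  induction w using balanced_induction with
  | h0 => simp
  | ha x y hx hy => rw [map_add, mul_add]; exact add_mem hx hy
  | ht n m =>
    have := δ.mul_mem_range_canonicalMap hh n m
    rw [canonicalMap_mk, ← mul_assoc]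
    simpa using this

theorem canonicalMap_surjective (S : Set H) (hS : Algebra.adjoin k S = ⊤)
    (h : ∀ s ∈ S, (1 : A) ⊗ₜ[k] s ∈ δ.canonicalMap.range) :
    Function.Surjective δ.canonicalMap := by
  have key : ∀ y : H, (1 : A) ⊗ₜ[k] y ∈ δ.canonicalMap.range := by
    intro y
    have hy : y ∈ Algebra.adjoin k S := hS ▸ trivial
    induction hy using Algebra.adjoin_induction with
    | mem s hs => exact h s hs
    | algebraMap r =>
      refine ⟨QuotientAddGroup.mk (algebraMap k A r ⊗ₜ[ℤ] 1), ?_⟩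
      rw [canonicalMap_mk, map_one, mul_one, Algebra.algebraMap_eq_smul_one,
        Algebra.algebraMap_eq_smul_one, TensorProduct.smul_tmul]
    | add x y _ _ hx hy => rw [TensorProduct.tmul_add]; exact add_mem hx hy
    | mul x y _ _ hx hy =>
      have := δ.mul_mem_range_canonicalMap_of_mem hx hy
      rwa [Algebra.TensorProduct.tmul_mul_tmul, one_mul] at this
  intro y
  rw [← AddMonoidHom.mem_range]
  induction y with
  | zero => exact zero_mem _
  | add x y hx hy => exact add_mem hx hy
  | tmul a y => simpa using δ.mul_mem_range_canonicalMap (key y) a 1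

open scoped Classical in
theorem basis_coord_mul (β : Module.Basis K k H) (a : A) (y : A ⊗[k] H) (κ : K) :
    TensorProduct.equivFinsuppOfBasisRight β (a ⊗ₜ[k] (1 : H) * y) κ =
      a * TensorProduct.equivFinsuppOfBasisRight β y κ := by
  induction y with
  | zero => simp
  | add x y hx hy => simp only [mul_add, map_add, Finsupp.add_apply, hx, hy]
  | tmul b y => simp

/-- Independence of the elements `δ (e κ)` that are triangular with respect to a basis of the
coacting bialgebra. -/
theorem eq_zero_of_triangular (β : Module.Basis K k H) (d : K → ℕ) (u : K → Aˣ)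
    (hδ : ∀ κ, δ.toAlgHom (e κ) - (u κ : A) ⊗ₜ[k] β κ ∈
      Submodule.span k {y | ∃ a : A, ∃ κ', d κ' < d κ ∧ y = a ⊗ₜ[k] β κ'})
    (a : K →₀ A) (ha : (a.sum fun κ x => x ⊗ₜ[k] (1 : H) * δ.toAlgHom (e κ)) = 0) : a = 0 := by
  classical
  set T := TensorProduct.equivFinsuppOfBasisRight (M := A) β with hT
  have hlow : ∀ κ κ', d κ ≤ d κ' → ∀ y ∈
      Submodule.span k {y | ∃ a : A, ∃ κ', d κ' < d κ ∧ y = a ⊗ₜ[k] β κ'}, T y κ' = 0 := by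
    intro κ κ' hd y hy
    induction hy using Submodule.span_induction with
    | mem y h =>
      obtain ⟨a, κ'', h, rfl⟩ := h
      have : κ'' ≠ κ' := by rintro rfl; omega
      simp [hT, this]
    | zero => simp
    | add x y _ _ hx hy => simp [hx, hy]
    | smul r x _ hx => simp [hx]
  have hcoord : ∀ κ κ', d κ ≤ d κ' →
      T (δ.toAlgHom (e κ)) κ' = if κ = κ' then (u κ : A) else 0 := by
    intro κ κ' hd
    have := hlow κ κ' hd _ (hδ κ)
    rw [map_sub, Finsupp.sub_apply, sub_eq_zero] at this
    rw [this]
    by_cases h : κ = κ' <;> simp [hT, h]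
  by_contra hne
  -- For κ of maximal degree in the support of a, no other term contributes to the coordinate at β
  -- κ, which is therefore a κ * u κ with u κ a unit.
  obtain ⟨κ, hκ, hmax⟩ := a.support.exists_max_image d (Finsupp.support_nonempty_iff.2 hne)
  have h0 := congrArg (fun y => T y κ) ha
  simp only [Finsupp.sum, map_sum, Finsupp.finsetSum_apply, map_zero, Finsupp.zero_apply] at h0
  rw [Finset.sum_eq_single κ] at h0
  · rw [basis_coord_mul, hcoord κ κ le_rfl, if_pos rfl, Units.mul_left_eq_zero] at h0
    exact Finsupp.mem_support_iff.1 hκ h0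
  · intro κ' hκ' hne
    rw [basis_coord_mul, hcoord κ' κ (hmax κ' hκ'), if_neg hne, mul_zero]
  · exact fun h => absurd hκ h

theorem eq_zero_of_groupLike (β : Module.Basis K k H) (u : K → Aˣ)
    (hδ : ∀ κ, δ.toAlgHom (u κ) = (u κ : A) ⊗ₜ[k] β κ) (a : K →₀ A)
    (ha : (a.sum fun κ x => x ⊗ₜ[k] (1 : H) * δ.toAlgHom (u κ)) = 0) : a = 0 :=
  δ.eq_zero_of_triangular (k := k) (e := fun κ => (u κ : A)) β (fun _ => 0) u
    (fun κ => by rw [hδ, sub_self]; exact zero_mem _) a ha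

/-- On a basis of group-like elements convolution is pointwise multiplication. So β κ ↦ u κ, which
is colinear by `hδ`, has the convolution inverse β κ ↦ (u κ)⁻¹. -/
theorem isCleft_of_groupLike (β : Module.Basis K k H) (u : K → Aˣ)
    (hβ : ∀ κ, Coalgebra.comul (R := k) (β κ) = β κ ⊗ₜ β κ)
    (hβ' : ∀ κ, Coalgebra.counit (R := k) (β κ) = 1)
    (hδ : ∀ κ, δ.toAlgHom (u κ) = (u κ : A) ⊗ₜ[k] β κ) : δ.IsCleft := by
  refine ⟨β.constr k fun κ => (u κ : A), β.ext fun κ => by simp [hβ, hδ], ?_⟩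
  refine ⟨⟨_, WithConv.toConv (β.constr k fun κ => ((u κ)⁻¹ : Aˣ).val), ?_, ?_⟩, rfl⟩
  · rw [LinearMap.convMul_def, LinearMap.convOne_def]
    congr 1
    exact β.ext fun κ => by simp [hβ, hβ']
  · rw [LinearMap.convMul_def, LinearMap.convOne_def]
    congr 1
    exact β.ext fun κ => by simp [hβ, hβ']

theorem canonicalMap_surjective_of_groupLike (β : Module.Basis K k H) (u : K → Aˣ)
    (hδ : ∀ κ, δ.toAlgHom (u κ) = (u κ : A) ⊗ₜ[k] β κ) :
    Function.Surjective δ.canonicalMap := by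
  refine δ.canonicalMap_surjective (Set.range β) ?_ ?_
  · rw [eq_top_iff]
    intro x _
    have hx : x ∈ Submodule.span k (Set.range β) := β.span_eq ▸ trivial
    exact Algebra.span_le_adjoin k _ hx
  · rintro _ ⟨κ, rfl⟩
    exact ⟨QuotientAddGroup.mk (((u κ)⁻¹ : Aˣ).val ⊗ₜ[ℤ] (u κ : A)), by
      rw [canonicalMap_mk, hδ]; simp⟩

end RightCoaction

namespace LeftCoaction

variable {H : Type} [Ring H] [Bialgebra k H] (δ : LeftCoaction k H A)

/-- The coaction grades A by K, with component k[z] * u κ in degree κ, and the coinvariants are the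
component of κ₀. In the right basis u κ of the first tensor factor the canonical map becomes
diagonal, multiplying the coordinate at κ by the unit u κ; so it is bijective. -/
theorem isPrincipal_of_groupLike (β : Module.Basis K k H) (u : K → Aˣ) {κ₀ : K} (h₀ : u κ₀ = 1)
    (h₁ : β κ₀ = 1)
    (hδ : ∀ κ, δ.toAlgHom (u κ) = β κ ⊗ₜ[k] (u κ : A)) (hz : z ∈ δ.coinvariants)
    (hli : LinearIndependent k (fun m : ℕ × K => z ^ m.1 * (u m.2 : A)))
    (hsp : ⊤ ≤ Submodule.span k (Set.range fun m : ℕ × K => z ^ m.1 * (u m.2 : A)))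
    (hq : ∀ κ, ∃ r : kˣ, (u κ : A) * z = r • (z * u κ)) : δ.IsPrincipal := by
  classical
  have hmem : ∀ b, b ∈ δ.coinvariants ↔ δ.toAlgHom b = 1 ⊗ₜ[k] b := fun b => Iff.rfl
  set T := TensorProduct.equivFinsuppOfBasisLeft (N := A) β with hT
  have hTβ : ∀ κ a, T (β κ ⊗ₜ a) = Finsupp.single κ a := fun κ a => by
    ext κ'
    by_cases h : κ = κ' <;> simp [hT, h]
  have hco : δ.coinvariants = Algebra.adjoin k {z} := by
    have hle : Algebra.adjoin k {z} ≤ δ.coinvariants := Algebra.adjoin_le (by simpa using hz)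
    refine le_antisymm (fun f hf => ?_) hle
    obtain ⟨γ, hγ⟩ := exists_left_basis (e := fun κ => (u κ : A)) hli hsp
    have hf' : ∑ κ ∈ (γ.repr f).support, (γ.repr f κ : A) * u κ = f := by
      conv_rhs => rw [← γ.linearCombination_repr f, Finsupp.linearCombination_apply, Finsupp.sum]
      exact Finset.sum_congr rfl fun κ _ => by rw [hγ]; rfl
    have hδf : δ.toAlgHom f =
        ∑ κ ∈ (γ.repr f).support, β κ ⊗ₜ[k] ((γ.repr f κ : A) * u κ) := by
      conv_lhs => rw [← hf', map_sum]
      refine Finset.sum_congr rfl fun κ _ => ?_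
      rw [map_mul, hδ, (hmem _).1 (hle (γ.repr f κ).2), Algebra.TensorProduct.tmul_mul_tmul,
        one_mul]
    rw [(hmem f).1 hf, ← h₁] at hδf
    -- Both sides are expanded along the basis of H, with 1 = β κ₀. The coordinate at κ₀ says that f
    -- equals its own coefficient in k[z], or 0 if κ₀ is not in the support.
    have h2 := congrArg (fun y => T y κ₀) hδf
    simp only [map_sum, hTβ, Finsupp.single_apply, Finsupp.finsetSum_apply, if_true,
      Finset.sum_ite_eq', h₀, Units.val_one, mul_one] at h2
    rw [h2]
    split_ifs
    · exact (γ.repr f κ₀).2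
    · exact zero_mem _
  have : Nonempty K := ⟨κ₀⟩
  have hL : ∃ γ : Module.Basis K δ.coinvariants A, ∀ κ, γ κ = u κ := by
    rw [hco]; exact exists_left_basis (e := fun κ => (u κ : A)) hli hsp
  have hR : ∃ γ : Module.Basis K (δ.coinvariants)ᵐᵒᵖ A, ∀ κ, γ κ = u κ := by
    rw [hco]; exact exists_right_basis (e := fun κ => (u κ : A)) hli hsp hq
  obtain ⟨γ, -⟩ := hL
  obtain ⟨γ', hγ'⟩ := hR
  refine ⟨⟨(injective_iff_map_eq_zero _).2 fun w hw => ?_, fun y => ?_⟩,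
    isFaithfullyFlatLeft_of_basis γ, isFaithfullyFlatRight_of_basis γ'⟩
  · have ha : ∀ a κ, T (δ.canonicalMap (balancedRightInv γ' a)) κ = u κ * a κ := by
      intro a κ
      induction a using Finsupp.induction_linear with
      | zero => simp
      | add x y hx hy => simp only [map_add, Finsupp.add_apply, hx, hy, mul_add]
      | single κ' x =>
        rw [balancedRightInv_single, canonicalMap_mk, hγ', hδ, Algebra.TensorProduct.tmul_mul_tmul,
          mul_one, hTβ]
        by_cases h : κ' = κ
        · subst h; simp
        · simp [h]
    obtain ⟨a, rfl⟩ := (balancedRightEquiv γ').symm.surjective w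
    have : a = 0 := Finsupp.ext fun κ => by
      have h := ha a κ
      rw [show δ.canonicalMap (balancedRightInv γ' a) = 0 from hw] at h
      simpa using h.symm
    rw [this, map_zero]
  · obtain ⟨v, rfl⟩ := T.symm.surjective y
    rw [← AddMonoidHom.mem_range]
    induction v using Finsupp.induction_linear with
    | zero => simp
    | add x y hx hy => rw [map_add]; exact add_mem hx hy
    | single κ a =>
      refine ⟨QuotientAddGroup.mk ((u κ : A) ⊗ₜ[ℤ] (((u κ)⁻¹ : Aˣ).val * a)), ?_⟩
      rw [canonicalMap_mk, hδ, Algebra.TensorProduct.tmul_mul_tmul, ← hTβ, mul_one,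
        Units.mul_inv_cancel_left, LinearEquiv.symm_apply_apply]

end LeftCoaction

end PrincipalCriteria

/-! ## Integer powers -/

section IntegerPowers

variable {A : Type} [Ring A] {a b : A}

/-- The power `a ^ i` for an integer `i`, where `b` plays the role of the inverse of `a`. -/
def zp (a b : A) (i : ℤ) : A := a ^ i.toNat * b ^ (-i).toNat

@[simp]
theorem zp_zero (a b : A) : zp a b 0 = 1 := by simp [zp]

theorem zp_units (u : Aˣ) (i : ℤ) : zp (u : A) (u⁻¹ : Aˣ) i = (u ^ i : Aˣ) := by
  rcases Int.eq_nat_or_neg i with ⟨n, rfl | rfl⟩ <;> simp [zp]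

/-- The value 0 as a placeholder for a missing inverse makes negative powers vanish. This allows one
index set for the monomials over all open sets. -/
theorem zp_of_neg (a : A) {i : ℤ} (hi : i < 0) : zp a 0 i = 0 := by
  have : (-i).toNat ≠ 0 := by omega
  simp [zp, this]

theorem mul_zp_of_nonneg (a b : A) {i : ℤ} (hi : 0 ≤ i) : a * zp a b i = zp a b (i + 1) := by
  obtain ⟨n, rfl⟩ := Int.eq_ofNat_of_zero_le hi
  have h1 : ((n : ℤ) + 1).toNat = n + 1 := by omega
  have h2 : (-((n : ℤ) + 1)).toNat = 0 := by omega
  rw [zp, zp, h1, h2, pow_succ']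
  simp

theorem mul_zp (hab : a * b = 1) (hba : b * a = 1) (i : ℤ) : a * zp a b i = zp a b (i + 1) := by
  have h1 := zp_units (⟨a, b, hab, hba⟩ : Aˣ) i
  have h2 := zp_units (⟨a, b, hab, hba⟩ : Aˣ) (i + 1)
  simp only [Units.inv_mk] at h1 h2
  rw [h1, h2, zpow_add_one, (Commute.zpow_self _ i).eq, Units.val_mul]

theorem inv_mul_zp (hab : a * b = 1) (hba : b * a = 1) (i : ℤ) :
    b * zp a b i = zp a b (i - 1) := by
  have h := mul_zp hab hba (i - 1)
  rw [sub_add_cancel] at h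
  rw [← h, ← mul_assoc, hba, one_mul]

end IntegerPowers

/-! ## Elements that commute up to a scalar -/

section QCommute

variable {A B : Type} [Ring A] [Algebra ℂ A] [Ring B] [Algebra ℂ B] {x y w a b : A}

/-- The elements `x` and `y` commute up to a nonzero scalar. -/
def QCommute (x y : A) : Prop := ∃ r : ℂˣ, x * y = r • (y * x)

namespace QCommute

theorem symm (h : QCommute x y) : QCommute y x := by
  obtain ⟨r, h⟩ := h
  exact ⟨r⁻¹, by rw [h, inv_smul_smul]⟩

theorem refl (x : A) : QCommute x x := ⟨1, by simp⟩

theorem one_right (x : A) : QCommute x 1 := ⟨1, by simp⟩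

theorem zero_right (x : A) : QCommute x 0 := ⟨1, by simp⟩

theorem mul_right (h : QCommute x y) (h' : QCommute x w) : QCommute x (y * w) := by
  obtain ⟨r, h⟩ := h
  obtain ⟨s, h'⟩ := h'
  exact ⟨r * s, by rw [← mul_assoc, h, smul_mul_assoc, mul_assoc, h', mul_smul_comm, smul_smul,
    mul_assoc]⟩

theorem mul_left (h : QCommute x w) (h' : QCommute y w) : QCommute (x * y) w :=
  (h.symm.mul_right h'.symm).symm

theorem pow_right (h : QCommute x y) (n : ℕ) : QCommute x (y ^ n) := by
  induction n with
  | zero => rw [pow_zero]; exact one_right x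
  | succ n ih => rw [pow_succ]; exact ih.mul_right h

theorem inv_right (h : QCommute x a) (hab : a * b = 1) (hba : b * a = 1) : QCommute x b := by
  obtain ⟨r, h⟩ := h.symm
  refine ⟨r, ?_⟩
  calc x * b = b * (a * x) * b := by rw [← mul_assoc, hba, one_mul]
    _ = r • (b * x) := by rw [h, mul_smul_comm, smul_mul_assoc, mul_assoc, mul_assoc, hab, mul_one]

theorem map (f : A →ₐ[ℂ] B) (h : QCommute x y) : QCommute (f x) (f y) := by
  obtain ⟨r, h⟩ := h
  refine ⟨r, ?_⟩
  rw [← map_mul, h, Units.smul_def, map_smul, map_mul, Units.smul_def]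

theorem mul_mul (h : QCommute y w) (v : A) :
    ∃ r : ℂˣ, y * (w * v) = r • (w * (y * v)) := by
  obtain ⟨r, h⟩ := h
  exact ⟨r, by rw [← mul_assoc, h, smul_mul_assoc, mul_assoc]⟩

theorem of_smul (r : ℂ) (hr : r ≠ 0) (h : x * y = r • (y * x)) : QCommute x y :=
  ⟨Units.mk0 r hr, h⟩

end QCommute

theorem map_zp (f : A →ₐ[ℂ] B) (a b : A) (i : ℤ) : f (zp a b i) = zp (f a) (f b) i := by
  simp [zp]

theorem QCommute.zp_right (h : QCommute x a) (h' : QCommute x b) (i : ℤ) :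
    QCommute x (zp a b i) := (h.pow_right _).mul_right (h'.pow_right _)

end QCommute

/-! ## Weighted shift operators -/

/-- The index set of the monomials `a ^ i * c ^ j * x ^ k * D ^ l`. -/
abbrev MonIndex : Type := ℤ × ℤ × ℕ × ℤ

section Shift

variable {I : Type}

/-- The operator that sends the basis vector `m` to `s m` times the basis vector `f m`. -/
def shiftOp (f : I → I) (s : I → ℂ) : Module.End ℂ (I →₀ ℂ) :=
  Finsupp.linearCombination ℂ fun m => Finsupp.single (f m) (s m)

@[simp]
theorem shiftOp_single (f : I → I) (s : I → ℂ) (m : I) (r : ℂ) :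
    shiftOp f s (Finsupp.single m r) = Finsupp.single (f m) (r * s m) := by
  simp [shiftOp]

theorem shiftOp_mul (f f' : I → I) (s s' : I → ℂ) :
    shiftOp f s * shiftOp f' s' = shiftOp (fun m => f (f' m)) (fun m => s' m * s (f' m)) := by
  ext m : 2
  simp

theorem smul_shiftOp (r : ℂ) (f : I → I) (s : I → ℂ) :
    r • shiftOp f s = shiftOp f (fun m => r * s m) := by
  ext m : 2
  simp

theorem one_eq_shiftOp : (1 : Module.End ℂ (I →₀ ℂ)) = shiftOp (fun m => m) (fun _ => 1) := by
  ext m : 2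
  simp

theorem shiftOp_congr {f f' : I → I} {s s' : I → ℂ} (hf : ∀ m, f m = f' m)
    (hs : ∀ m, s m = s' m) : shiftOp f s = shiftOp f' s' := by
  rw [funext hf, funext hs]

end Shift

/-! ### Monomial bases of the algebras F(U) -/

namespace Sec

open SecGen

variable {q : ℂˣ} {U V : Opens projLine}

/-- The action of the generators on monomials, with `x` scaled by `ε`. -/
def repGen (q : ℂˣ) (ε : ℂ) (U : Opens projLine) : SecGen U → Module.End ℂ (MonIndex →₀ ℂ)
  -- The weights are the scalars that arise when a generator is moved from the left to its place in
  -- a^i c^j x^k D^l: for instance c a^i = q^(-i) a^i c, while x picks up q^(i+j) and D picks up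
  -- q^(2j-2k).
  | a => shiftOp (fun m => (m.1 + 1, m.2)) fun _ => 1
  | c => shiftOp (fun m => (m.1, m.2.1 + 1, m.2.2)) fun m => (q : ℂ) ^ (-m.1)
  | x => shiftOp (fun m => (m.1, m.2.1, m.2.2.1 + 1, m.2.2.2)) fun m =>
      ε * (q : ℂ) ^ (m.1 + m.2.1)
  | D => shiftOp (fun m => (m.1, m.2.1, m.2.2.1, m.2.2.2 + 1)) fun m =>
      (q : ℂ) ^ (2 * m.2.1 - 2 * m.2.2.1)
  | Dinv => shiftOp (fun m => (m.1, m.2.1, m.2.2.1, m.2.2.2 - 1)) fun m =>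
      (q : ℂ) ^ (-(2 * m.2.1 - 2 * m.2.2.1))
  | ainv _ => shiftOp (fun m => (m.1 - 1, m.2)) fun _ => 1
  | cinv _ => shiftOp (fun m => (m.1, m.2.1 - 1, m.2.2)) fun m => (q : ℂ) ^ m.1

/-- The representation of the algebra of sections on the space of monomials. -/
def rep (q : ℂˣ) (ε : ℂ) (hU : U ≠ ⊥) : Sec q U →ₐ[ℂ] Module.End ℂ (MonIndex →₀ ℂ) :=
  lift (repGen q ε U) <| by
    have hq := q.ne_zero
    intro x y r
    cases r with
    | empty h => exact absurd h hU
    | _ =>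
      -- Each relation compares two weighted shifts, so index maps and weights are compared
      -- separately. The factor ε is harmless because every relation that contains x is linear in x
      -- on both sides.
      simp only [map_mul, map_smul, map_one, FreeAlgebra.lift_ι_apply, repGen, shiftOp_mul,
        smul_shiftOp, one_eq_shiftOp]
      refine shiftOp_congr (fun m => by simp) (fun m => ?_)
      simp [zpow_add₀ hq, zpow_sub₀ hq, zpow_neg, mul_add, zpow_mul]
      try field_simp
      try exact zpow_ne_zero _ (pow_ne_zero _ hq)

theorem rep_gen (q : ℂˣ) (ε : ℂ) (hU : U ≠ ⊥) (g : SecGen U) :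
    rep q ε hU (gen q g) = repGen q ε U g := lift_gen _ _ g

theorem rep_comp_res (ε : ℂ) (hV : V ≠ ⊥) (hU : U ≠ ⊥) (h : V ≤ U) :
    (rep q ε hV).comp (res q h) = rep q ε hU := by
  refine hom_ext (B := Module.End ℂ (MonIndex →₀ ℂ)) fun g => ?_
  cases g <;> simp [rep_gen, resGen, repGen]

/-- The coordinates of a section with respect to the monomials. -/
def ev (q : ℂˣ) (ε : ℂ) (hU : U ≠ ⊥) : Sec q U →ₗ[ℂ] (MonIndex →₀ ℂ) :=
  LinearMap.applyₗ (Finsupp.single 0 1) ∘ₗ (rep q ε hU).toLinearMap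

theorem ev_apply (ε : ℂ) (hU : U ≠ ⊥) (y : Sec q U) :
    ev q ε hU y = rep q ε hU y (Finsupp.single 0 1) := rfl

/-- The representation space is the same for all nonempty open sets, and generators of the same name
act by the same operator. So restriction leaves coordinates unchanged, and gluing becomes a question
about supports. -/
theorem ev_res (ε : ℂ) (hV : V ≠ ⊥) (hU : U ≠ ⊥) (h : V ≤ U) (y : Sec q U) :
    ev q ε hV (res q h y) = ev q ε hU y := by
  rw [ev_apply, ev_apply, ← rep_comp_res ε hV hU h]
  rfl

open scoped Classical in
/-- The inverse of `a` where it exists, and otherwise `0`. -/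
def ainv₀ (q : ℂˣ) (U : Opens projLine) : Sec q U :=
  if h : U ≤ chart 0 then gen q (ainv h) else 0

open scoped Classical in
/-- The inverse of `c` where it exists, and otherwise `0`. -/
def cinv₀ (q : ℂˣ) (U : Opens projLine) : Sec q U :=
  if h : U ≤ chart 1 then gen q (cinv h) else 0

theorem ainv₀_eq (h : U ≤ chart 0) : ainv₀ q U = gen q (ainv h) := dif_pos h

theorem cinv₀_eq (h : U ≤ chart 1) : cinv₀ q U = gen q (cinv h) := dif_pos h

/-- The monomials. -/
def mon (q : ℂˣ) (U : Opens projLine) (m : MonIndex) : Sec q U :=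
  zp (gen q a) (ainv₀ q U) m.1 * (zp (gen q c) (cinv₀ q U) m.2.1 *
    (gen q x ^ m.2.2.1 * zp (gen q D) (gen q Dinv) m.2.2.2))

/-- The set of exponents of the monomials that are defined over `U`. -/
def monSet (U : Opens projLine) : Set MonIndex :=
  {m | (U ≤ chart 0 ∨ 0 ≤ m.1) ∧ (U ≤ chart 1 ∨ 0 ≤ m.2.1)}

theorem mon_eq_zero {m : MonIndex} (hm : m ∉ monSet U) : mon q U m = 0 := by
  rw [monSet, Set.mem_ofPred_eq, not_and_or, not_or, not_or] at hm
  rcases hm with ⟨h, hm⟩ | ⟨h, hm⟩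
  · rw [mon, ainv₀, dif_neg h, zp_of_neg _ (not_le.1 hm), zero_mul]
  · rw [mon, cinv₀, dif_neg h, zp_of_neg _ (not_le.1 hm), zero_mul, mul_zero]

theorem mon_zero : mon q U 0 = 1 := by simp [mon]

/-! Commutation relations up to scalars -/

theorem qcommute_ac : QCommute (gen q (a : SecGen U)) (gen q c) :=
  (QCommute.of_smul _ (inv_ne_zero q.ne_zero) ca).symm

theorem qcommute_ax : QCommute (gen q (a : SecGen U)) (gen q x) :=
  (QCommute.of_smul _ q.ne_zero xa).symm

theorem qcommute_cx : QCommute (gen q (c : SecGen U)) (gen q x) :=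
  (QCommute.of_smul _ q.ne_zero xc).symm

theorem qcommute_aD : QCommute (gen q (a : SecGen U)) (gen q D) :=
  (QCommute.of_smul 1 one_ne_zero (by rw [one_smul, Da])).symm

theorem qcommute_cD : QCommute (gen q (c : SecGen U)) (gen q D) :=
  (QCommute.of_smul _ (pow_ne_zero 2 q.ne_zero) Dc).symm

theorem qcommute_xD : QCommute (gen q (x : SecGen U)) (gen q D) :=
  (QCommute.of_smul _ (pow_ne_zero 2 (inv_ne_zero q.ne_zero)) Dx).symm

theorem QCommute_ainv₀ {y : Sec q U} (h : QCommute y (gen q a)) : QCommute y (ainv₀ q U) := by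
  rw [ainv₀]
  split_ifs with hU
  · exact h.inv_right (a_mul_ainv hU) (ainv_mul_a hU)
  · exact QCommute.zero_right _

theorem QCommute_cinv₀ {y : Sec q U} (h : QCommute y (gen q c)) : QCommute y (cinv₀ q U) := by
  rw [cinv₀]
  split_ifs with hU
  · exact h.inv_right (c_mul_cinv hU) (cinv_mul_c hU)
  · exact QCommute.zero_right _

theorem QCommute_Dinv {y : Sec q U} (h : QCommute y (gen q D)) : QCommute y (gen q Dinv) :=
  h.inv_right D_mul_Dinv Dinv_mul_D

theorem QCommute_zpa {y : Sec q U} (h : QCommute y (gen q a)) (i : ℤ) :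
    QCommute y (zp (gen q a) (ainv₀ q U) i) := h.zp_right (QCommute_ainv₀ h) i

theorem QCommute_zpc {y : Sec q U} (h : QCommute y (gen q c)) (i : ℤ) :
    QCommute y (zp (gen q c) (cinv₀ q U) i) := h.zp_right (QCommute_cinv₀ h) i

theorem QCommute_zpD {y : Sec q U} (h : QCommute y (gen q D)) (i : ℤ) :
    QCommute y (zp (gen q D) (gen q Dinv) i) := h.zp_right (QCommute_Dinv h) i

/-- The hypothesis excludes the exponent -1 when a has no inverse over U: there the monomial on the
left is 0 by convention, while the one on the right need not be. -/
theorem a_mul_mon {m : MonIndex} (h : U ≤ chart 0 ∨ 0 ≤ m.1) :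
    gen q a * mon q U m = mon q U (m.1 + 1, m.2) := by
  rw [mon, mon, ← mul_assoc]
  rcases h with h | h
  · rw [ainv₀_eq h, mul_zp (a_mul_ainv h) (ainv_mul_a h)]
  · rw [mul_zp_of_nonneg _ _ h]

theorem ainv_mul_mon (h : U ≤ chart 0) (m : MonIndex) :
    gen q (ainv h) * mon q U m = mon q U (m.1 - 1, m.2) := by
  rw [mon, mon, ← mul_assoc, ainv₀_eq h, inv_mul_zp (a_mul_ainv h) (ainv_mul_a h)]

theorem c_mul_mon {m : MonIndex} (h : U ≤ chart 1 ∨ 0 ≤ m.2.1) :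
    ∃ r : ℂˣ, gen q c * mon q U m = r • mon q U (m.1, m.2.1 + 1, m.2.2) := by
  rw [mon, mon]
  obtain ⟨r, hr⟩ := (QCommute_zpa (qcommute_ac.symm : QCommute (gen q c) (gen q (a : SecGen U)))
    m.1).mul_mul (zp (gen q c) (cinv₀ q U) m.2.1 *
    (gen q x ^ m.2.2.1 * zp (gen q D) (gen q Dinv) m.2.2.2))
  refine ⟨r, ?_⟩
  rw [hr, ← mul_assoc (gen q c)]
  rcases h with h | h
  · rw [cinv₀_eq h, mul_zp (c_mul_cinv h) (cinv_mul_c h)]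
  · rw [mul_zp_of_nonneg _ _ h]

theorem cinv_mul_mon (h : U ≤ chart 1) (m : MonIndex) :
    ∃ r : ℂˣ, gen q (cinv h) * mon q U m = r • mon q U (m.1, m.2.1 - 1, m.2.2) := by
  rw [mon, mon]
  have hc : QCommute (gen q (cinv h)) (gen q (a : SecGen U)) :=
    (qcommute_ac.inv_right (c_mul_cinv h) (cinv_mul_c h)).symm
  obtain ⟨r, hr⟩ := (QCommute_zpa hc m.1).mul_mul (zp (gen q c) (cinv₀ q U) m.2.1 *
    (gen q x ^ m.2.2.1 * zp (gen q D) (gen q Dinv) m.2.2.2))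
  refine ⟨r, ?_⟩
  rw [hr, ← mul_assoc (gen q (cinv h)), cinv₀_eq h, inv_mul_zp (c_mul_cinv h) (cinv_mul_c h)]

theorem x_mul_mon (m : MonIndex) :
    ∃ r : ℂˣ, gen q x * mon q U m = r • mon q U (m.1, m.2.1, m.2.2.1 + 1, m.2.2.2) := by
  have hx : QCommute (gen q x) (zp (gen q (a : SecGen U)) (ainv₀ q U) m.1 *
      zp (gen q c) (cinv₀ q U) m.2.1) :=
    (QCommute_zpa qcommute_ax.symm _).mul_right (QCommute_zpc qcommute_cx.symm _)
  obtain ⟨r, hr⟩ := hx.mul_mul (gen q x ^ m.2.2.1 * zp (gen q D) (gen q Dinv) m.2.2.2)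
  refine ⟨r, ?_⟩
  rw [mon, mon, ← mul_assoc (zp _ _ _), hr, ← mul_assoc (gen q x), ← pow_succ', mul_assoc]

theorem D_mul_mon (m : MonIndex) :
    ∃ r : ℂˣ, gen q D * mon q U m = r • mon q U (m.1, m.2.1, m.2.2.1, m.2.2.2 + 1) := by
  have hx : QCommute (gen q D) (zp (gen q (a : SecGen U)) (ainv₀ q U) m.1 *
      (zp (gen q c) (cinv₀ q U) m.2.1 * gen q x ^ m.2.2.1)) :=
    (QCommute_zpa qcommute_aD.symm _).mul_right ((QCommute_zpc qcommute_cD.symm _).mul_right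
      (qcommute_xD.symm.pow_right _))
  obtain ⟨r, hr⟩ := hx.mul_mul (zp (gen q D) (gen q Dinv) m.2.2.2)
  refine ⟨r, ?_⟩
  simp only [mul_assoc] at hr
  rw [mon, mon, hr, mul_zp D_mul_Dinv Dinv_mul_D]

theorem Dinv_mul_mon (m : MonIndex) :
    ∃ r : ℂˣ, gen q Dinv * mon q U m = r • mon q U (m.1, m.2.1, m.2.2.1, m.2.2.2 - 1) := by
  obtain ⟨r, hr⟩ := D_mul_mon (q := q) (U := U) (m.1, m.2.1, m.2.2.1, m.2.2.2 - 1)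
  refine ⟨r⁻¹, ?_⟩
  simp only [sub_add_cancel] at hr
  have := congrArg (fun y => r⁻¹ • (gen q Dinv * y)) hr
  simp only [← mul_assoc, Dinv_mul_D, one_mul, mul_smul_comm, inv_smul_smul] at this
  exact this.symm

theorem induction {p : Sec q U → Prop} (hC : ∀ r : ℂ, p (algebraMap ℂ (Sec q U) r))
    (hg : ∀ g, p (gen q g)) (hm : ∀ x y, p x → p y → p (x * y))
    (ha : ∀ x y, p x → p y → p (x + y)) (y : Sec q U) : p y := by
  obtain ⟨y, rfl⟩ := RingQuot.mkAlgHom_surjective ℂ (SecRel q U) y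
  induction y using FreeAlgebra.induction with
  | grade0 r => rw [AlgHom.commutes]; exact hC r
  | grade1 g => exact hg g
  | mul x y hx hy => rw [map_mul]; exact hm _ _ hx hy
  | add x y hx hy => rw [map_add]; exact ha _ _ hx hy

/-- The scalar is not required to be a unit, because a monomial that is not defined over U is 0. -/
theorem gen_mul_mon (g : SecGen U) (m : MonIndex) :
    ∃ r : ℂ, ∃ m', gen q g * mon q U m = r • mon q U m' := by
  by_cases hm : m ∈ monSet U
  · cases g with
    | a => exact ⟨1, _, by rw [a_mul_mon hm.1, one_smul]⟩
    | c => obtain ⟨r, hr⟩ := c_mul_mon (q := q) hm.2; exact ⟨r, _, hr⟩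
    | x => obtain ⟨r, hr⟩ := x_mul_mon (q := q) (U := U) m; exact ⟨r, _, hr⟩
    | D => obtain ⟨r, hr⟩ := D_mul_mon (q := q) (U := U) m; exact ⟨r, _, hr⟩
    | Dinv => obtain ⟨r, hr⟩ := Dinv_mul_mon (q := q) (U := U) m; exact ⟨r, _, hr⟩
    | ainv h => exact ⟨1, _, by rw [ainv_mul_mon, one_smul]⟩
    | cinv h => obtain ⟨r, hr⟩ := cinv_mul_mon (q := q) h m; exact ⟨r, _, hr⟩
  · exact ⟨0, 0, by rw [mon_eq_zero hm, mul_zero, zero_smul]⟩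

/-- The span contains 1 and is stable under left multiplication by the generators, hence is a left
ideal containing 1. -/
theorem span_mon (q : ℂˣ) (U : Opens projLine) :
    Submodule.span ℂ (Set.range (mon q U)) = ⊤ := by
  rw [eq_top_iff]
  intro y _
  have key : ∀ y : Sec q U, ∀ w ∈ Submodule.span ℂ (Set.range (mon q U)),
      y * w ∈ Submodule.span ℂ (Set.range (mon q U)) := by
    intro y
    induction y using induction with
    | hC r => intro w hw; rw [← Algebra.smul_def]; exact Submodule.smul_mem _ _ hw
    | hg g =>
      intro w hw
      induction hw using Submodule.span_induction with
      | mem w hw =>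
        obtain ⟨m, rfl⟩ := hw
        obtain ⟨r, m', h⟩ := gen_mul_mon (q := q) g m
        rw [h]
        exact Submodule.smul_mem _ _ (Submodule.subset_span ⟨m', rfl⟩)
      | zero => rw [mul_zero]; exact zero_mem _
      | add x y _ _ hx hy => rw [mul_add]; exact add_mem hx hy
      | smul r x _ hx => rw [mul_smul_comm]; exact Submodule.smul_mem _ _ hx
    | hm x y hx hy => intro w hw; rw [mul_assoc]; exact hx _ (hy _ hw)
    | ha x y hx hy => intro w hw; rw [add_mul]; exact add_mem (hx _ hw) (hy _ hw)
  have := key y 1 (Submodule.subset_span ⟨0, mon_zero⟩)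
  rwa [mul_one] at this

theorem rep_zp (ε : ℂ) (hU : U ≠ ⊥) (y w : Sec q U) (i : ℤ) :
    rep q ε hU (zp y w i) = zp (rep q ε hU y) (rep q ε hU w) i := by
  simp [zp]

theorem pow_apply_shift {W : Type} [AddCommGroup W] [Module ℂ W] (f : Module.End ℂ W)
    (w : ℕ → W) (hw : ∀ n, f (w n) = w (n + 1)) (n : ℕ) : (f ^ n) (w 0) = w n := by
  induction n with
  | zero => simp
  | succ n ih => rw [pow_succ', Module.End.mul_apply, ih, hw]

theorem zp_apply_shift {W : Type} [AddCommGroup W] [Module ℂ W] (f g : Module.End ℂ W)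
    (w : ℤ → W) (hf : ∀ n, f (w n) = w (n + 1)) (i : ℤ) (hg : 0 ≤ i ∨ ∀ n, g (w n) = w (n - 1)) :
    zp f g i (w 0) = w i := by
  rcases Int.eq_nat_or_neg i with ⟨n, rfl | rfl⟩
  · simpa [zp] using pow_apply_shift f (fun n => w n) (fun n => by simp [hf]) n
  · rcases hg with hg | hg
    · obtain rfl : n = 0 := by omega
      simp
    · simpa [zp] using pow_apply_shift g (fun n => w (-n)) (fun n => by
        simp [hg, sub_eq_add_neg, add_comm]) n

/-- The powers of D, x, c, a are applied in this order to the vector of index 0. The weight of a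
letter involves only exponents of letters to its left in the monomial, which are still 0 at that
stage. So all powers of q are 1, and only the factor ε of each x survives. -/
theorem ev_mon (ε : ℂ) (hU : U ≠ ⊥) {m : MonIndex} (hm : m ∈ monSet U) :
    ev q ε hU (mon q U m) = Finsupp.single m (ε ^ m.2.2.1) := by
  obtain ⟨i, j, k, l⟩ := m
  obtain ⟨hi, hj⟩ := hm
  simp only at hi hj
  have hD : rep q ε hU (zp (gen q D) (gen q Dinv) l) (Finsupp.single 0 1) =
      Finsupp.single (0, 0, 0, l) 1 := by
    rw [rep_zp]
    exact zp_apply_shift _ _ (fun l => Finsupp.single ((0, 0, 0, l) : MonIndex) (1 : ℂ))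
      (fun n => by simp [rep_gen, repGen]) l (Or.inr fun n => by simp [rep_gen, repGen])
  have hx : rep q ε hU (gen q x ^ k) (Finsupp.single (0, 0, 0, l) 1) =
      Finsupp.single (0, 0, k, l) (ε ^ k) := by
    rw [map_pow]
    have := pow_apply_shift (rep q ε hU (gen q x))
      (fun k => Finsupp.single ((0, 0, k, l) : MonIndex) (ε ^ k))
      (fun n => by simp [rep_gen, repGen, pow_succ]) k
    simpa using this
  have hc : rep q ε hU (zp (gen q c) (cinv₀ q U) j) (Finsupp.single (0, 0, k, l) (ε ^ k)) =
      Finsupp.single (0, j, k, l) (ε ^ k) := by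
    rw [rep_zp]
    refine zp_apply_shift _ _ (fun j => Finsupp.single ((0, j, k, l) : MonIndex) (ε ^ k))
      (fun n => by simp [rep_gen, repGen]) j (hj.symm.imp id fun h n => ?_)
    simp [cinv₀_eq h, rep_gen, repGen]
  have ha : rep q ε hU (zp (gen q a) (ainv₀ q U) i) (Finsupp.single (0, j, k, l) (ε ^ k)) =
      Finsupp.single (i, j, k, l) (ε ^ k) := by
    rw [rep_zp]
    refine zp_apply_shift _ _ (fun i => Finsupp.single ((i, j, k, l) : MonIndex) (ε ^ k))
      (fun n => by simp [rep_gen, repGen]) i (hi.symm.imp id fun h n => ?_)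
    simp [ainv₀_eq h, rep_gen, repGen]
  rw [ev_apply, mon, map_mul, map_mul, map_mul, Module.End.mul_apply, Module.End.mul_apply,
    Module.End.mul_apply, hD, hx, hc, ha]

/-- The linear combination of monomials with the given coefficients. -/
def ofCoeff (q : ℂˣ) (U : Opens projLine) : (MonIndex →₀ ℂ) →ₗ[ℂ] Sec q U :=
  Finsupp.linearCombination ℂ (mon q U)

/-- Together with `ev_mem_supported` and `ev_ofCoeff` this says that the monomials with exponents in
`monSet U` form a basis: coordinates identify the sections with the vectors supported there. -/
theorem ofCoeff_ev (hU : U ≠ ⊥) (y : Sec q U) : ofCoeff q U (ev q 1 hU y) = y := by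
  have hy : y ∈ Submodule.span ℂ (Set.range (mon q U)) := span_mon q U ▸ trivial
  induction hy using Submodule.span_induction with
  | mem y hy =>
    obtain ⟨m, rfl⟩ := hy
    by_cases hm : m ∈ monSet U
    · simp [ev_mon 1 hU hm, ofCoeff]
    · simp [mon_eq_zero hm]
  | zero => simp
  | add x y _ _ hx hy => rw [map_add, map_add, hx, hy]
  | smul r x _ hx => rw [map_smul, map_smul, hx]

theorem ev_injective (hU : U ≠ ⊥) : Function.Injective (ev q 1 hU) :=
  Function.LeftInverse.injective (ofCoeff_ev hU)

theorem ev_mem_supported (hU : U ≠ ⊥) (y : Sec q U) :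
    ev q 1 hU y ∈ Finsupp.supported ℂ ℂ (monSet U) := by
  have hy : y ∈ Submodule.span ℂ (Set.range (mon q U)) := span_mon q U ▸ trivial
  induction hy using Submodule.span_induction with
  | mem y hy =>
    obtain ⟨m, rfl⟩ := hy
    by_cases hm : m ∈ monSet U
    · rw [ev_mon 1 hU hm]
      exact Finsupp.single_mem_supported _ _ hm
    · rw [mon_eq_zero hm, map_zero]
      exact zero_mem _
  | zero => simp
  | add x y _ _ hx hy => rw [map_add]; exact add_mem hx hy
  | smul r x _ hx => rw [map_smul]; exact Submodule.smul_mem _ _ hx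

theorem ev_ofCoeff (hU : U ≠ ⊥) {v : MonIndex →₀ ℂ} (hv : v ∈ Finsupp.supported ℂ ℂ (monSet U)) :
    ev q 1 hU (ofCoeff q U v) = v := by
  rw [Finsupp.supported_eq_span_single] at hv
  induction hv using Submodule.span_induction with
  | mem v hv =>
    obtain ⟨m, hm, rfl⟩ := hv
    simp [ofCoeff, ev_mon 1 hU hm]
  | zero => simp
  | add x y _ _ hx hy => rw [map_add, map_add, hx, hy]
  | smul r x _ hx => rw [map_smul, map_smul, hx]

end Sec

/-! ### Monomial bases of the algebras F₀(U) -/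

namespace Sec₀

open SecGen

variable {q : ℂˣ} {U V : Opens projLine}

/-- The representation of the quotient by `x` on the space of monomials. -/
def rep (q : ℂˣ) (hU : U ≠ ⊥) : Sec₀ q U →ₐ[ℂ] Module.End ℂ (MonIndex →₀ ℂ) :=
  lift (B := Module.End ℂ (MonIndex →₀ ℂ)) (Sec.rep q 0 hU) <| by
    rw [Sec.rep_gen, Sec.repGen]
    ext m : 2
    simp

/-- The coordinates of a section with respect to the monomials. -/
def ev (q : ℂˣ) (hU : U ≠ ⊥) : Sec₀ q U →ₗ[ℂ] (MonIndex →₀ ℂ) :=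
  LinearMap.applyₗ (Finsupp.single 0 1) ∘ₗ (rep q hU).toLinearMap

theorem ev_quotientMap (hU : U ≠ ⊥) (y : Sec q U) :
    ev q hU (quotientMap q U y) = Sec.ev q 0 hU y := rfl

theorem ev_res (hV : V ≠ ⊥) (hU : U ≠ ⊥) (h : V ≤ U) (y : Sec₀ q U) :
    ev q hV (res q h y) = ev q hU y := by
  obtain ⟨y, rfl⟩ := quotientMap_surjective y
  exact Sec.ev_res 0 hV hU h y

/-- The set of exponents of the monomials that are defined over `U` and do not contain `x`. -/
def monSet (U : Opens projLine) : Set MonIndex := {m | m ∈ Sec.monSet U ∧ m.2.2.1 = 0}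

theorem quotientMap_mon_eq_zero {m : MonIndex} (hm : m ∉ monSet U) :
    quotientMap q U (Sec.mon q U m) = 0 := by
  rcases not_and_or.1 hm with hm | hm
  · rw [Sec.mon_eq_zero hm, map_zero]
  · rw [Sec.mon, map_mul, map_mul, map_mul, map_pow, quotientMap_x, zero_pow hm]
    simp

/-- This is the representation at ε = 0, which factors through the quotient by x. The coefficient ε
^ k is 0 ^ 0 = 1 since m has no factor x. -/
theorem ev_mon (hU : U ≠ ⊥) {m : MonIndex} (hm : m ∈ monSet U) :
    ev q hU (quotientMap q U (Sec.mon q U m)) = Finsupp.single m 1 := by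
  rw [ev_quotientMap, Sec.ev_mon 0 hU hm.1, hm.2, pow_zero]

/-- The linear combination of monomials with the given coefficients. -/
def ofCoeff (q : ℂˣ) (U : Opens projLine) : (MonIndex →₀ ℂ) →ₗ[ℂ] Sec₀ q U :=
  (quotientMap q U).toLinearMap ∘ₗ Sec.ofCoeff q U

theorem ofCoeff_single (m : MonIndex) :
    ofCoeff q U (Finsupp.single m 1) = quotientMap q U (Sec.mon q U m) := by
  simp [ofCoeff, Sec.ofCoeff]

theorem span_mon (q : ℂˣ) (U : Opens projLine) :
    Submodule.span ℂ (Set.range fun m => quotientMap q U (Sec.mon q U m)) = ⊤ := by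
  have : (Set.range fun m => quotientMap q U (Sec.mon q U m)) =
      (quotientMap q U).toLinearMap '' Set.range (Sec.mon q U) := (Set.range_comp _ _)
  rw [this, Submodule.span_image, Sec.span_mon, Submodule.map_top, LinearMap.range_eq_top]
  exact quotientMap_surjective

theorem ofCoeff_ev (hU : U ≠ ⊥) (y : Sec₀ q U) : ofCoeff q U (ev q hU y) = y := by
  have hy : y ∈ Submodule.span ℂ (Set.range fun m => quotientMap q U (Sec.mon q U m)) :=
    span_mon q U ▸ trivial
  induction hy using Submodule.span_induction with
  | mem y hy =>
    obtain ⟨m, rfl⟩ := hy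
    by_cases hm : m ∈ monSet U
    · simp only [ev_mon hU hm, ofCoeff_single]
    · simp only [quotientMap_mon_eq_zero hm, map_zero]
  | zero => simp
  | add x y _ _ hx hy => rw [map_add, map_add, hx, hy]
  | smul r x _ hx => rw [map_smul, map_smul, hx]

theorem ev_injective (hU : U ≠ ⊥) : Function.Injective (ev q hU) :=
  Function.LeftInverse.injective (ofCoeff_ev hU)

theorem ev_mem_supported (hU : U ≠ ⊥) (y : Sec₀ q U) :
    ev q hU y ∈ Finsupp.supported ℂ ℂ (monSet U) := by
  have hy : y ∈ Submodule.span ℂ (Set.range fun m => quotientMap q U (Sec.mon q U m)) :=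
    span_mon q U ▸ trivial
  induction hy using Submodule.span_induction with
  | mem y hy =>
    obtain ⟨m, rfl⟩ := hy
    by_cases hm : m ∈ monSet U
    · simp only [ev_mon hU hm]
      exact Finsupp.single_mem_supported _ _ hm
    · simp only [quotientMap_mon_eq_zero hm, map_zero]
      exact zero_mem _
  | zero => simp
  | add x y _ _ hx hy => rw [map_add]; exact add_mem hx hy
  | smul r x _ hx => rw [map_smul]; exact Submodule.smul_mem _ _ hx

theorem ev_ofCoeff (hU : U ≠ ⊥) {v : MonIndex →₀ ℂ} (hv : v ∈ Finsupp.supported ℂ ℂ (monSet U)) :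
    ev q hU (ofCoeff q U v) = v := by
  rw [Finsupp.supported_eq_span_single] at hv
  induction hv using Submodule.span_induction with
  | mem v hv =>
    obtain ⟨m, hm, rfl⟩ := hv
    simp only [ofCoeff_single, ev_mon hU hm]
  | zero => simp
  | add x y _ _ hx hy => rw [map_add, map_add, hx, hy]
  | smul r x _ hx => rw [map_smul, map_smul, hx]

end Sec₀

/-! ## The topology of the projective line -/

section ProjectiveLine

variable {U V : Opens projLine}

theorem mem_chart {i : Fin 2} {p : projLine} :
    p ∈ chart i ↔ Projectivization.rep (K := ℂ) (V := Fin 2 → ℂ) p i ≠ 0 := Iff.rfl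

theorem mem_chart_or (p : projLine) : p ∈ chart 0 ∨ p ∈ chart 1 := by
  by_contra! h
  simp only [mem_chart, not_not] at h
  refine Projectivization.rep_nonzero (K := ℂ) (V := Fin 2 → ℂ) p (funext fun i => ?_)
  fin_cases i
  · exact h.1
  · exact h.2

/-- The property is true of the two charts and survives finite intersections and unions, hence holds
for all open sets of the topology they generate. All that follows about open sets comes from it: the
only ones are ∅, U₁ ∩ U₂, U₁, U₂ and the whole line. -/
theorem mem_open_of_forall {p p' : projLine} (hp : p ∈ U)
    (h : ∀ i, p ∈ chart i → p' ∈ chart i) : p' ∈ U := by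
  obtain ⟨U, hU⟩ := U
  change p ∈ U at hp
  change p' ∈ U
  induction hU with
  | basic s hs => obtain ⟨i, rfl⟩ := hs; exact h i hp
  | univ => trivial
  | inter s t _ _ hs ht => exact ⟨hs hp.1, ht hp.2⟩
  | sUnion S _ hS =>
    obtain ⟨s, hs, hps⟩ := hp
    exact ⟨s, hs, hS s hs hps⟩

theorem inf_le_of_mem {p : projLine} (hp : p ∈ U) : chart 0 ⊓ chart 1 ≤ U := fun p' hp' =>
  mem_open_of_forall hp fun i _ => by
    fin_cases i
    · exact hp'.1
    · exact hp'.2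

theorem exists_mem_of_ne_bot (hU : U ≠ ⊥) : ∃ p, p ∈ U := by
  by_contra! h
  exact hU (le_bot_iff.1 fun p hp => absurd hp (h p))

theorem inf_le_of_ne_bot (hU : U ≠ ⊥) : chart 0 ⊓ chart 1 ≤ U :=
  inf_le_of_mem (exists_mem_of_ne_bot hU).choose_spec

theorem chart_zero_le_of_mem {p : projLine} (hp : p ∈ U) (h : p ∉ chart 1) : chart 0 ≤ U :=
  fun p' hp' => mem_open_of_forall hp fun i hi => by
    fin_cases i
    · exact hp'
    · exact absurd hi h

theorem chart_one_le_of_mem {p : projLine} (hp : p ∈ U) (h : p ∉ chart 0) : chart 1 ≤ U :=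
  fun p' hp' => mem_open_of_forall hp fun i hi => by
    fin_cases i
    · exact absurd hi h
    · exact hp'

theorem iSup_chart : ⨆ i, chart i = ⊤ := by
  rw [eq_top_iff]
  intro p _
  rw [Opens.mem_iSup]
  rcases mem_chart_or p with h | h
  exacts [⟨0, h⟩, ⟨1, h⟩]

theorem eq_top_of_chart_le (h₀ : chart 0 ≤ U) (h₁ : chart 1 ≤ U) : U = ⊤ := by
  rw [eq_top_iff]
  intro p _
  rcases mem_chart_or p with h | h
  exacts [h₀ h, h₁ h]

theorem top_or_le_chart (U : Opens projLine) : U = ⊤ ∨ U ≤ chart 0 ∨ U ≤ chart 1 := by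
  by_contra! h
  obtain ⟨h, h₀, h₁⟩ := h
  obtain ⟨p, hp, hp'⟩ := Set.not_subset.1 h₀
  obtain ⟨r, hr, hr'⟩ := Set.not_subset.1 h₁
  exact h (eq_top_of_chart_le (chart_zero_le_of_mem hr hr') (chart_one_le_of_mem hp hp'))

/-- The point with the given homogeneous coordinates. -/
def pt (v : Fin 2 → ℂ) (hv : v ≠ 0) : projLine := Projectivization.mk ℂ v hv

theorem rep_pt (v : Fin 2 → ℂ) (hv : v ≠ 0) : ∃ r : ℂˣ, ∀ i,
    Projectivization.rep (K := ℂ) (V := Fin 2 → ℂ) (pt v hv) i = r * v i := by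
  obtain ⟨r, hr⟩ := Projectivization.exists_smul_eq_mk_rep ℂ v hv
  exact ⟨r, fun i => (congrFun hr i).symm⟩

theorem pt_mem_chart (v : Fin 2 → ℂ) (hv : v ≠ 0) (i : Fin 2) : pt v hv ∈ chart i ↔ v i ≠ 0 := by
  obtain ⟨r, hr⟩ := rep_pt v hv
  rw [mem_chart, hr]
  simp

/-- The point of the projective line with affine coordinate `x₁ / x₀ = w`. -/
def affinePt (w : ℂ) : projLine := pt ![1, w] fun h => one_ne_zero (congrFun h 0)

theorem affinePt_mem_zero (w : ℂ) : affinePt w ∈ chart 0 := by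
  rw [affinePt, pt_mem_chart]; simp

theorem affinePt_mem_one {w : ℂ} : affinePt w ∈ chart 1 ↔ w ≠ 0 := by
  rw [affinePt, pt_mem_chart]; simp

theorem coordinate_affinePt_zero (w : ℂ) (h : affinePt w ∈ U) :
    coordinate U 0 ⟨affinePt w, h⟩ = w := by
  obtain ⟨r, hr⟩ := rep_pt ![1, w] fun h => one_ne_zero (congrFun h 0)
  simp only [coordinate, affinePt, hr]
  simp

theorem coordinate_affinePt_one (w : ℂ) (h : affinePt w ∈ U) :
    coordinate U 1 ⟨affinePt w, h⟩ = w⁻¹ := by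
  obtain ⟨r, hr⟩ := rep_pt ![1, w] fun h => one_ne_zero (congrFun h 0)
  simp only [coordinate, affinePt, hr]
  simp [div_mul_eq_div_div]

theorem chart_not_le {i j : Fin 2} (h : i ≠ j) : ¬ chart i ≤ chart j := by
  intro hle
  have hv : (Pi.single i 1 : Fin 2 → ℂ) ≠ 0 := by simp
  have := hle ((pt_mem_chart _ hv i).2 (by simp))
  rw [pt_mem_chart] at this
  simp [h.symm] at this

theorem inf_ne_bot : chart 0 ⊓ chart 1 ≠ ⊥ := by
  intro h
  have : affinePt 1 ∈ chart 0 ⊓ chart 1 := ⟨affinePt_mem_zero 1, affinePt_mem_one.2 one_ne_zero⟩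
  rw [h] at this
  exact this

theorem chart_ne_bot (i : Fin 2) : chart i ≠ ⊥ := by
  intro h
  refine inf_ne_bot (le_bot_iff.1 (h ▸ ?_))
  fin_cases i
  exacts [inf_le_left, inf_le_right]

theorem top_ne_bot' : (⊤ : Opens projLine) ≠ ⊥ := fun h =>
  chart_ne_bot 0 (le_bot_iff.1 (h ▸ le_top))

/-- On the projective line with the topology generated by the two charts, the sheaf condition
has to be checked on the empty set and for the cover by the two charts only. -/
theorem isSheaf_of_glue (F : TopCat.Presheaf Type projLine)
    (h₀ : ∀ s t : F.obj (op ⊥), s = t) (h₁ : Nonempty (F.obj (op ⊥)))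
    (hg : ∀ (s₀ : F.obj (op (chart 0))) (s₁ : F.obj (op (chart 1))),
      F.map (homOfLE (inf_le_left : chart 0 ⊓ chart 1 ≤ chart 0)).op s₀ =
        F.map (homOfLE (inf_le_right : chart 0 ⊓ chart 1 ≤ chart 1)).op s₁ →
      ∃! s : F.obj (op ⊤), F.map (homOfLE le_top).op s = s₀ ∧ F.map (homOfLE le_top).op s = s₁) :
    F.IsSheaf := by
  have hres : ∀ {U V W : Opens projLine} (h : V ≤ U) (h' : W ≤ V) (s : F.obj (op U)),
      F.map (homOfLE h').op (F.map (homOfLE h).op s) = F.map (homOfLE (h'.trans h)).op s := by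
    intro U V W h h' s
    rw [← Functor.map_comp_apply]
    rfl
  have hid : ∀ {U : Opens projLine} (h : U ≤ U) (s : F.obj (op U)),
      F.map (homOfLE h).op s = s := fun h s => F.map_id_apply _ s
  rw [TopCat.Presheaf.isSheaf_iff_isSheafUniqueGluing_types]
  intro ι U sf hsf
  have hsf' : ∀ {W : Opens projLine} (i j : ι) (hi : W ≤ U i) (hj : W ≤ U j),
      F.map (homOfLE hi).op (sf i) = F.map (homOfLE hj).op (sf j) := by
    intro W i j hi hj
    have := congrArg (F.map (homOfLE (le_inf hi hj)).op) (hsf i j)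
    exact ((hres inf_le_left (le_inf hi hj) (sf i)).symm.trans this).trans
      (hres inf_le_right (le_inf hi hj) (sf j))
  -- If one member of the cover is the whole union, its section is the gluing.
  by_cases hi : ∃ i, iSup U ≤ U i
  · obtain ⟨i, hi⟩ := hi
    refine ⟨F.map (homOfLE hi).op (sf i), fun j => ?_, fun t ht => ?_⟩
    · refine (hres hi (le_iSup U j) (sf i)).trans ?_
      rw [hsf' i j ((le_iSup U j).trans hi) le_rfl, hid]
    · rw [← ht i]
      refine ((hres (le_iSup U i) hi t).trans (hid _ t)).symm
  · by_cases hW : iSup U = ⊥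
    · have hs : ∀ {V : Opens projLine} (_ : V = ⊥) (s t : F.obj (op V)), s = t := by
        rintro V rfl
        exact h₀
      have hn : ∀ {V : Opens projLine} (_ : V = ⊥), Nonempty (F.obj (op V)) := by
        rintro V rfl
        exact h₁
      obtain ⟨s⟩ := hn hW
      exact ⟨s, fun i => hs (le_bot_iff.1 (hW ▸ le_iSup U i)) _ _, fun t _ => hs hW _ _⟩
    -- In the remaining case no member contains the union. Points lying in only one chart force a
    -- member to contain that chart; so members containing U₁ and U₂ exist, and the union is the
    -- whole line.
    · have hnot : ∀ i, ∀ V : Opens projLine, V ≤ U i → ¬ iSup U ≤ V :=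
        fun i V h h' => hi ⟨i, h'.trans h⟩
      have hinf : ¬ iSup U ≤ chart 0 ⊓ chart 1 := by
        intro h
        obtain ⟨p, hp⟩ := exists_mem_of_ne_bot hW
        obtain ⟨i, hp⟩ := Opens.mem_iSup.1 hp
        exact hnot i _ (inf_le_of_mem hp) h
      have hp₀ : ∃ i, chart 0 ≤ U i := by
        by_contra! h
        have h1 : iSup U ≤ chart 1 := by
          intro p hp
          obtain ⟨i, hp⟩ := Opens.mem_iSup.1 hp
          by_contra hp'
          exact h i (chart_zero_le_of_mem hp hp')
        obtain ⟨p, hp, hp'⟩ := Set.not_subset.1 fun h2 : iSup U ≤ chart 0 => hinf (le_inf h2 h1)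
        obtain ⟨i, hp⟩ := Opens.mem_iSup.1 hp
        exact hnot i _ (chart_one_le_of_mem hp hp') h1
      have hp₁ : ∃ i, chart 1 ≤ U i := by
        by_contra! h
        have h1 : iSup U ≤ chart 0 := by
          intro p hp
          obtain ⟨i, hp⟩ := Opens.mem_iSup.1 hp
          by_contra hp'
          exact h i (chart_one_le_of_mem hp hp')
        obtain ⟨p, hp, hp'⟩ := Set.not_subset.1 fun h2 : iSup U ≤ chart 1 => hinf (le_inf h1 h2)
        obtain ⟨i, hp⟩ := Opens.mem_iSup.1 hp
        exact hnot i _ (chart_zero_le_of_mem hp hp') h1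
      obtain ⟨i₀, hi₀⟩ := hp₀
      obtain ⟨i₁, hi₁⟩ := hp₁
      have htop : ⊤ ≤ iSup U := (eq_top_of_chart_le (hi₀.trans (le_iSup U i₀))
        (hi₁.trans (le_iSup U i₁))).ge
      obtain ⟨s, ⟨hs₀, hs₁⟩, huniq⟩ := hg (F.map (homOfLE hi₀).op (sf i₀))
        (F.map (homOfLE hi₁).op (sf i₁)) (by
          rw [hres, hres]
          exact hsf' _ _ _ _)
      -- The section s was glued from the two members containing the charts only. Every other member
      -- is proper, hence lies in one chart, where the value of s is known.
      refine ⟨F.map (homOfLE le_top).op s, fun j => ?_, fun t ht => ?_⟩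
      · refine (hres le_top (le_iSup U j) s).trans ?_
        rcases top_or_le_chart (U j) with h | h | h
        · exact absurd (le_top.trans h.ge) (hnot j _ le_rfl)
        · rw [← hres le_top h, hs₀, hres, hsf' i₀ j _ le_rfl, hid]
        · rw [← hres le_top h, hs₁, hres, hsf' i₁ j _ le_rfl, hid]
      · have := huniq (F.map (homOfLE htop).op t) ⟨by
          rw [hres, ← ht i₀]
          exact (hres (le_iSup U i₀) hi₀ t).symm, by
          rw [hres, ← ht i₁]
          exact (hres (le_iSup U i₁) hi₁ t).symm⟩
        rw [← this, hres, hid]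

theorem isSheaf_of_glue_alg (F : TopCat.Presheaf (AlgCat.{0} ℂ) projLine)
    (h₀ : ∀ s t : F.obj (op ⊥), s = t)
    (hg : ∀ (s₀ : F.obj (op (chart 0))) (s₁ : F.obj (op (chart 1))),
      F.map (homOfLE (inf_le_left : chart 0 ⊓ chart 1 ≤ chart 0)).op s₀ =
        F.map (homOfLE (inf_le_right : chart 0 ⊓ chart 1 ≤ chart 1)).op s₁ →
      ∃! s : F.obj (op ⊤), F.map (homOfLE le_top).op s = s₀ ∧ F.map (homOfLE le_top).op s = s₁) :
    F.IsSheaf := by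
  rw [TopCat.Presheaf.isSheaf_iff_isSheaf_comp (forget (AlgCat.{0} ℂ))]
  exact isSheaf_of_glue _ h₀ ⟨(0 : F.obj (op ⊥))⟩ hg

end ProjectiveLine

/-! ## The sheaf conditions -/

theorem sheafF_isSheaf (q : ℂˣ) : (sheafF q).presheaf.IsSheaf := by
  refine isSheaf_of_glue_alg _ (fun s t => ?_) fun s₀ s₁ h => ?_
  · change Sec q ⊥ at s t
    rw [← mul_one s, ← mul_one t, Sec.one_eq_zero rfl, mul_zero, mul_zero]
  · change Sec q (chart 0) at s₀
    change Sec q (chart 1) at s₁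
    change Sec.res q inf_le_left s₀ = Sec.res q inf_le_right s₁ at h
    have h01 : Sec.ev q 1 (chart_ne_bot 0) s₀ = Sec.ev q 1 (chart_ne_bot 1) s₁ := by
      rw [← Sec.ev_res 1 inf_ne_bot _ inf_le_left, h, Sec.ev_res]
    -- Over U₁ the exponents of c are nonnegative and over U₂ those of a. The common coordinate
    -- vector satisfies both, so it only involves monomials defined globally.
    have hsupp : Sec.ev q 1 (chart_ne_bot 0) s₀ ∈ Finsupp.supported ℂ ℂ (Sec.monSet ⊤) := by
      have h0 := Sec.ev_mem_supported (chart_ne_bot 0) s₀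
      have h1 := Sec.ev_mem_supported (chart_ne_bot 1) s₁
      rw [← h01] at h1
      rw [Finsupp.mem_supported] at h0 h1 ⊢
      exact fun m hm => ⟨Or.inr ((h1 hm).1.resolve_left (chart_not_le (by decide))),
        Or.inr ((h0 hm).2.resolve_left (chart_not_le (by decide)))⟩
    have key := Sec.ev_ofCoeff (q := q) top_ne_bot' hsupp
    refine ⟨Sec.ofCoeff q ⊤ (Sec.ev q 1 (chart_ne_bot 0) s₀), ⟨?_, ?_⟩, fun t ht => ?_⟩
    · change Sec.res q le_top _ = _
      apply Sec.ev_injective (chart_ne_bot 0)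
      rw [Sec.ev_res 1 _ top_ne_bot', key]
    · change Sec.res q le_top _ = _
      apply Sec.ev_injective (chart_ne_bot 1)
      rw [Sec.ev_res 1 _ top_ne_bot', key, h01]
    · change Sec q ⊤ at t
      have ht : Sec.res q le_top t = s₀ := ht.1
      apply Sec.ev_injective top_ne_bot'
      rw [key, ← ht, Sec.ev_res]

theorem sheafF₀_isSheaf (q : ℂˣ) : (sheafF₀ q).presheaf.IsSheaf := by
  refine isSheaf_of_glue_alg _ (fun s t => ?_) fun s₀ s₁ h => ?_
  · change Sec₀ q ⊥ at s t
    have : (1 : Sec₀ q ⊥) = 0 := by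
      rw [← map_one (Sec₀.quotientMap q ⊥), Sec.one_eq_zero rfl, map_zero]
    rw [← mul_one s, ← mul_one t, this, mul_zero, mul_zero]
  · change Sec₀ q (chart 0) at s₀
    change Sec₀ q (chart 1) at s₁
    change Sec₀.res q inf_le_left s₀ = Sec₀.res q inf_le_right s₁ at h
    have h01 : Sec₀.ev q (chart_ne_bot 0) s₀ = Sec₀.ev q (chart_ne_bot 1) s₁ := by
      rw [← Sec₀.ev_res inf_ne_bot _ inf_le_left, h, Sec₀.ev_res]
    have hsupp : Sec₀.ev q (chart_ne_bot 0) s₀ ∈ Finsupp.supported ℂ ℂ (Sec₀.monSet ⊤) := by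
      have h0 := Sec₀.ev_mem_supported (chart_ne_bot 0) s₀
      have h1 := Sec₀.ev_mem_supported (chart_ne_bot 1) s₁
      rw [← h01] at h1
      rw [Finsupp.mem_supported] at h0 h1 ⊢
      exact fun m hm => ⟨⟨Or.inr ((h1 hm).1.1.resolve_left (chart_not_le (by decide))),
        Or.inr ((h0 hm).1.2.resolve_left (chart_not_le (by decide)))⟩, (h0 hm).2⟩
    have key := Sec₀.ev_ofCoeff (q := q) top_ne_bot' hsupp
    refine ⟨Sec₀.ofCoeff q ⊤ (Sec₀.ev q (chart_ne_bot 0) s₀), ⟨?_, ?_⟩, fun t ht => ?_⟩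
    · change Sec₀.res q le_top _ = _
      apply Sec₀.ev_injective (chart_ne_bot 0)
      rw [Sec₀.ev_res _ top_ne_bot', key]
    · change Sec₀.res q le_top _ = _
      apply Sec₀.ev_injective (chart_ne_bot 1)
      rw [Sec₀.ev_res _ top_ne_bot', key, h01]
    · change Sec₀ q ⊤ at t
      have ht : Sec₀.res q le_top t = s₀ := ht.1
      apply Sec₀.ev_injective top_ne_bot'
      rw [key, ← ht, Sec₀.ev_res]

/-! ## The structure sheaf -/

section StructureSheaf

/-- With n = deg Q, the identity P(w) = Q(1/w) says that the reverse of Q is X^n P. The reverse has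
degree at most n, so P is constant, and then Q is too. -/
theorem Polynomial.eq_C_of_eval_eq_eval_inv {P Q : Polynomial ℂ}
    (h : ∀ w : ℂ, w ≠ 0 → P.eval w = Q.eval w⁻¹) : ∃ c, P = Polynomial.C c ∧ Q = Polynomial.C c := by
  have hinf : {w : ℂ | w ≠ 0}.Infinite := (Set.finite_singleton (0 : ℂ)).infinite_compl
  have hrev : Q.reverse = Polynomial.X ^ Q.natDegree * P := by
    refine Polynomial.eq_of_infinite_eval_eq _ _ (hinf.mono fun w (hw : w ≠ 0) => ?_)
    let _ : Invertible w⁻¹ := invertibleOfNonzero (inv_ne_zero hw)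
    have := Polynomial.eval₂_reverse_mul_pow (RingHom.id ℂ) w⁻¹ Q
    rw [invOf_eq_inv, inv_inv, Polynomial.eval₂_id, Polynomial.eval₂_id, ← h w hw, inv_pow] at this
    rw [Set.mem_ofPred_eq, Polynomial.eval_mul, Polynomial.eval_pow, Polynomial.eval_X, ← this]
    field_simp
  have hP : P.natDegree = 0 := by
    by_contra hne
    have hP0 : P ≠ 0 := by rintro rfl; simp at hne
    have h1 := Polynomial.reverse_natDegree_le Q
    rw [hrev, Polynomial.natDegree_X_pow_mul _ hP0] at h1
    omega
  obtain ⟨c, rfl⟩ : ∃ c, Polynomial.C c = P := ⟨_, (Polynomial.eq_C_of_natDegree_eq_zero hP).symm⟩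
  refine ⟨c, rfl, Polynomial.eq_of_infinite_eval_eq _ _ (hinf.mono fun w (hw : w ≠ 0) => ?_)⟩
  have := h w⁻¹ (inv_ne_zero hw)
  rw [inv_inv] at this
  simp [← this]

/-- The affine coordinate as a regular function. -/
def coord (U : Opens projLine) (i : Fin 2) (h : U ≤ chart i) : regularFunctions U :=
  ⟨coordinate U i, Algebra.subset_adjoin ⟨i, h, rfl⟩⟩

theorem exists_aeval_coord (i : Fin 2) (f : regularFunctions (chart i)) :
    ∃ P : Polynomial ℂ, Polynomial.aeval (coord (chart i) i le_rfl) P = f := by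
  obtain ⟨f, hf⟩ := f
  have hset : {f | ∃ j, chart i ≤ chart j ∧ f = coordinate (chart i) j} =
      {coordinate (chart i) i} := by
    ext g
    constructor
    · rintro ⟨j, hj, rfl⟩
      obtain rfl : i = j := by
        by_contra hne
        exact chart_not_le hne hj
      rfl
    · rintro rfl
      exact ⟨i, le_rfl, rfl⟩
  have hf' := hf
  rw [regularFunctions, hset, Algebra.adjoin_singleton_eq_range_aeval] at hf'
  obtain ⟨P, rfl⟩ := hf'
  exact ⟨P, Subtype.ext (Polynomial.aeval_subalgebra_coe P _ _)⟩

theorem aeval_coord_apply {U : Opens projLine} {i : Fin 2} (h : U ≤ chart i) (P : Polynomial ℂ)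
    (p : U) : (Polynomial.aeval (coord U i h) P).1 p = P.eval (coordinate U i p) := by
  rw [Polynomial.aeval_subalgebra_coe]
  change Pi.evalAlgHom ℂ (fun _ : U => ℂ) p (Polynomial.aeval (coordinate U i) P) = _
  rw [← Polynomial.aeval_algHom_apply, Polynomial.coe_aeval_eq_eval]
  rfl

theorem structureSheaf_isSheaf : structureSheaf.IsSheaf := by
  refine isSheaf_of_glue_alg _ (fun s t => ?_) fun s₀ s₁ h => ?_
  · exact Subtype.ext (funext fun p => absurd p.2 id)
  · obtain ⟨P, rfl⟩ := exists_aeval_coord 0 s₀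
    obtain ⟨Q, rfl⟩ := exists_aeval_coord 1 s₁
    have hPQ : ∀ w : ℂ, w ≠ 0 → P.eval w = Q.eval w⁻¹ := by
      intro w hw
      have hmem : affinePt w ∈ chart 0 ⊓ chart 1 := ⟨affinePt_mem_zero w, affinePt_mem_one.2 hw⟩
      have := congrFun (congrArg Subtype.val h) ⟨affinePt w, hmem⟩
      change (Polynomial.aeval (coord (chart 0) 0 le_rfl) P).1 ⟨affinePt w, hmem.1⟩ =
        (Polynomial.aeval (coord (chart 1) 1 le_rfl) Q).1 ⟨affinePt w, hmem.2⟩ at this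
      rwa [aeval_coord_apply, aeval_coord_apply, coordinate_affinePt_zero,
        coordinate_affinePt_one] at this
    obtain ⟨c, rfl, rfl⟩ := Polynomial.eq_C_of_eval_eq_eval_inv hPQ
    simp only [Polynomial.aeval_C]
    refine ⟨algebraMap ℂ (regularFunctions ⊤) c, ⟨rfl, rfl⟩, fun t ht => ?_⟩
    refine Subtype.ext (funext fun p => ?_)
    rcases mem_chart_or p.1 with hp | hp
    · exact congrFun (congrArg Subtype.val ht.1) ⟨p.1, hp⟩
    · exact congrFun (congrArg Subtype.val ht.2) ⟨p.1, hp⟩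

/-- Regular functions on a chart are polynomials in its coordinate, so the map is evaluation of
polynomials at z. It reduces the condition on coinvariants of a bundle to knowing the image of one
function. -/
theorem injective_and_range_of_coord {E : Type} [Ring E] [Algebra ℂ E] (i : Fin 2)
    (f : regularFunctions (chart i) →ₐ[ℂ] E) {z : E} (hf : f (coord (chart i) i le_rfl) = z)
    (hz : LinearIndependent ℂ (fun n : ℕ => z ^ n)) :
    Function.Injective f ∧ f.range = Algebra.adjoin ℂ {z} := by
  have hP : ∀ P, f (Polynomial.aeval (coord (chart i) i le_rfl) P) = Polynomial.aeval z P :=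
    fun P => by rw [← hf, Polynomial.aeval_algHom_apply]
  constructor
  · refine (injective_iff_map_eq_zero f).2 fun x hx => ?_
    obtain ⟨P, rfl⟩ := exists_aeval_coord i x
    rw [hP] at hx
    have : P = 0 := by
      ext n
      rw [Polynomial.aeval_eq_sum_range] at hx
      by_cases hn : n ∈ Finset.range (P.natDegree + 1)
      · exact linearIndependent_iff'.1 hz _ _ hx n hn
      · exact Polynomial.coeff_eq_zero_of_natDegree_lt (by simpa using hn)
    rw [this, map_zero]
  · rw [Algebra.adjoin_singleton_eq_range_aeval]
    apply le_antisymm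
    · rintro _ ⟨x, rfl⟩
      obtain ⟨P, rfl⟩ := exists_aeval_coord i x
      exact ⟨P, (hP P).symm⟩
    · rintro _ ⟨P, rfl⟩
      exact ⟨_, hP P⟩

end StructureSheaf

/-! ## The embedding of the structure sheaf -/

section Embedding

/-- The algebra map on Laurent polynomials given by a unit. -/
def laurentLift {E : Type} [Ring E] [Algebra ℂ E] (u : Eˣ) : LaurentPolynomial ℂ →ₐ[ℂ] E :=
  AddMonoidAlgebra.lift ℂ E ℤ ((Units.coeHom E).comp (zpowersHom Eˣ u))

theorem laurentLift_T {E : Type} [Ring E] [Algebra ℂ E] (u : Eˣ) (n : ℤ) :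
    laurentLift u (LaurentPolynomial.T n) = (u ^ n : Eˣ) := by
  rw [laurentLift, LaurentPolynomial.T, AddMonoidAlgebra.lift_single, one_smul]
  simp

theorem laurentLift_toLaurent {E : Type} [Ring E] [Algebra ℂ E] (u : Eˣ) (P : Polynomial ℂ) :
    laurentLift u (Polynomial.toLaurent P) = Polynomial.aeval (u : E) P := by
  have : (laurentLift u).comp Polynomial.toLaurentAlg = Polynomial.aeval (u : E) := by
    ext
    simp [laurentLift_T]
  exact DFunLike.congr_fun this P

/-- The coordinate on the intersection of the two charts. -/
def coordUnit : ((chart 0 ⊓ chart 1 : Opens projLine) → ℂ)ˣ where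
  val := coordinate _ 0
  inv := coordinate _ 1
  val_inv := funext fun p => by
    have h0 := mem_chart.1 p.2.1
    have h1 := mem_chart.1 p.2.2
    change _ / _ * (_ / _) = (1 : ℂ)
    exact (div_mul_div_cancel₀' h1 _ _).trans (div_self h0)
  inv_val := funext fun p => by
    have h0 := mem_chart.1 p.2.1
    have h1 := mem_chart.1 p.2.2
    change _ / _ * (_ / _) = (1 : ℂ)
    exact (div_mul_div_cancel₀' h0 _ _).trans (div_self h1)

/-- A power of T clears denominators; the resulting polynomial vanishes at every nonzero complex
number, hence is 0. -/
theorem laurentLift_coordUnit_injective : Function.Injective (laurentLift coordUnit) := by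
  refine (injective_iff_map_eq_zero _).2 fun f hf => ?_
  obtain ⟨n, P, hP⟩ := LaurentPolynomial.exists_T_pow f
  have hP0 : laurentLift coordUnit (Polynomial.toLaurent P) = 0 := by
    rw [hP, map_mul, hf, zero_mul]
  rw [laurentLift_toLaurent] at hP0
  have : P = 0 := by
    have hinf : {w : ℂ | w ≠ 0}.Infinite := (Set.finite_singleton (0 : ℂ)).infinite_compl
    refine Polynomial.eq_of_infinite_eval_eq _ _ (hinf.mono fun w (hw : w ≠ 0) => ?_)
    have hmem : affinePt w ∈ chart 0 ⊓ chart 1 := ⟨affinePt_mem_zero w, affinePt_mem_one.2 hw⟩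
    have h := congrFun hP0 ⟨affinePt w, hmem⟩
    have h' := aeval_coord_apply (U := chart 0 ⊓ chart 1) (i := 0) inf_le_left P ⟨affinePt w, hmem⟩
    rw [Polynomial.aeval_subalgebra_coe, coordinate_affinePt_zero] at h'
    rw [Set.mem_ofPred_eq, Polynomial.eval_zero, ← h']
    exact h
  rw [this, map_zero] at hP
  have h := congrArg (· * LaurentPolynomial.T (-n : ℤ)) hP
  simp only [zero_mul, mul_assoc, ← LaurentPolynomial.T_add, add_neg_cancel,
    LaurentPolynomial.T_zero, mul_one] at h
  exact h.symm

theorem regularFunctions_le_range :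
    regularFunctions (chart 0 ⊓ chart 1) ≤ (laurentLift coordUnit).range := by
  refine Algebra.adjoin_le ?_
  rintro _ ⟨i, -, rfl⟩
  fin_cases i
  · exact ⟨LaurentPolynomial.T 1, (laurentLift_T _ _).trans (by rw [zpow_one]; rfl)⟩
  · exact ⟨LaurentPolynomial.T (-1), (laurentLift_T _ _).trans (by rw [zpow_neg_one]; rfl)⟩

/-- Regular functions on the intersection of the charts are Laurent polynomials. -/
def toLaurentPoly : regularFunctions (chart 0 ⊓ chart 1) →ₐ[ℂ] LaurentPolynomial ℂ :=
  (AlgEquiv.ofInjective _ laurentLift_coordUnit_injective).symm.toAlgHom.comp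
    (Subalgebra.inclusion regularFunctions_le_range)

theorem toLaurentPoly_eq {f : regularFunctions (chart 0 ⊓ chart 1)} {P : LaurentPolynomial ℂ}
    (h : laurentLift coordUnit P = f.1) : toLaurentPoly f = P := by
  change (AlgEquiv.ofInjective _ laurentLift_coordUnit_injective).symm _ = P
  rw [AlgEquiv.symm_apply_eq]
  exact Subtype.ext h.symm

namespace Sec

open SecGen

variable {q : ℂˣ} {U V : Opens projLine}

/-- The invertible section `c * a⁻¹` over the intersection of the charts. -/
def ratio (q : ℂˣ) : (Sec q (chart 0 ⊓ chart 1))ˣ where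
  val := gen q c * gen q (ainv inf_le_left)
  inv := gen q a * gen q (cinv inf_le_right)
  val_inv := by
    rw [mul_assoc, ← mul_assoc (gen q (ainv _)), ainv_mul_a, one_mul, c_mul_cinv]
  inv_val := by
    rw [mul_assoc, ← mul_assoc (gen q (cinv _)), cinv_mul_c, one_mul, a_mul_ainv]

/-- The embedding of the structure sheaf over the intersection of the charts. -/
def embedInf (q : ℂˣ) : regularFunctions (chart 0 ⊓ chart 1) →ₐ[ℂ] Sec q (chart 0 ⊓ chart 1) :=
  (laurentLift (ratio q)).comp toLaurentPoly

theorem embedInf_coord_zero (h : chart 0 ⊓ chart 1 ≤ chart 0) : embedInf q (coord _ 0 h) =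
    gen q c * gen q (ainv h) := by
  rw [embedInf, AlgHom.comp_apply, toLaurentPoly_eq (P := LaurentPolynomial.T 1), laurentLift_T,
    zpow_one]
  · rfl
  · rw [laurentLift_T, zpow_one]; rfl

theorem embedInf_coord_one (h : chart 0 ⊓ chart 1 ≤ chart 1) : embedInf q (coord _ 1 h) =
    gen q a * gen q (cinv h) := by
  rw [embedInf, AlgHom.comp_apply, toLaurentPoly_eq (P := LaurentPolynomial.T (-1)), laurentLift_T,
    zpow_neg_one]
  · rfl
  · rw [laurentLift_T, zpow_neg_one]; rfl

theorem res_injective (hV : V ≠ ⊥) (h : V ≤ U) : Function.Injective (res q h) := by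
  have hU : U ≠ ⊥ := fun hU => hV (le_bot_iff.1 (hU ▸ h))
  intro s t hst
  apply ev_injective hU
  rw [← ev_res 1 hV hU h, hst, ev_res]

/-- A coordinate is among the generating functions over U only if U lies in its chart, and then the
inverse occurring in c a⁻¹ or a c⁻¹ is already a generator over U. -/
theorem embedInf_mem_range (h : chart 0 ⊓ chart 1 ≤ U) (f : regularFunctions U) :
    embedInf q (restrictRegular h f) ∈ (res q h).range := by
  obtain ⟨f, hf⟩ := f
  induction hf using Algebra.adjoin_induction with
  | mem f hf =>
    obtain ⟨i, hi, rfl⟩ := hf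
    change embedInf q (coord _ i (h.trans hi)) ∈ _
    fin_cases i
    · exact ⟨gen q c * gen q (ainv hi), (map_mul (res q h) _ _).trans (by
        rw [res_gen, res_gen]; exact (embedInf_coord_zero _).symm)⟩
    · exact ⟨gen q a * gen q (cinv hi), (map_mul (res q h) _ _).trans (by
        rw [res_gen, res_gen]; exact (embedInf_coord_one _).symm)⟩
  | algebraMap r =>
    change embedInf q (restrictRegular h (algebraMap ℂ _ r)) ∈ _
    rw [AlgHom.commutes, AlgHom.commutes]
    exact Subalgebra.algebraMap_mem _ r
  | add f g hf hg hf' hg' =>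
    have := add_mem hf' hg'
    rw [← map_add, ← map_add] at this
    exact this
  | mul f g hf hg hf' hg' =>
    have := mul_mem hf' hg'
    rw [← map_mul, ← map_mul] at this
    exact this

/-- The map is constructed only over U₁ ∩ U₂, where functions are Laurent polynomials in the
coordinate and an algebra map is given by a unit. It is pulled back to U along the injective
restriction map, which also makes naturality automatic. -/
theorem exists_embed (q : ℂˣ) (U : Opens projLine) : ∃ j : regularFunctions U →ₐ[ℂ] Sec q U,
    ∀ h : chart 0 ⊓ chart 1 ≤ U, (res q h).comp j = (embedInf q).comp (restrictRegular h) := by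
  by_cases hU : U = ⊥
  · have : Subsingleton (Sec q U) := subsingleton_of_zero_eq_one (one_eq_zero hU).symm
    -- Over the empty set the target is the zero ring, so the zero map is unital.
    exact ⟨AlgHom.ofLinearMap 0 (Subsingleton.elim _ _) fun _ _ => Subsingleton.elim _ _,
      fun h => absurd (le_bot_iff.1 (hU ▸ h)) inf_ne_bot⟩
  · have h := inf_le_of_ne_bot hU
    refine ⟨(AlgEquiv.ofInjective (res q h) (res_injective inf_ne_bot h)).symm.toAlgHom.comp
      (((embedInf q).comp (restrictRegular h)).codRestrict _ (embedInf_mem_range h)), fun _ => ?_⟩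
    ext f
    exact congrArg Subtype.val ((AlgEquiv.ofInjective (res q h)
      (res_injective inf_ne_bot h)).apply_symm_apply _)

/-- The embedding of the structure sheaf. -/
def embed (q : ℂˣ) (U : Opens projLine) : regularFunctions U →ₐ[ℂ] Sec q U :=
  (exists_embed q U).choose

theorem res_embed (h : chart 0 ⊓ chart 1 ≤ U) (f : regularFunctions U) :
    res q h (embed q U f) = embedInf q (restrictRegular h f) :=
  DFunLike.congr_fun ((exists_embed q U).choose_spec h) f

theorem embed_natural (h : V ≤ U) (f : regularFunctions U) :
    embed q V (restrictRegular h f) = res q h (embed q U f) := by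
  by_cases hV : V = ⊥
  · have : Subsingleton (Sec q V) := subsingleton_of_zero_eq_one (one_eq_zero hV).symm
    exact Subsingleton.elim _ _
  · have h' := inf_le_of_ne_bot hV
    apply res_injective inf_ne_bot h'
    rw [res_embed, ← AlgHom.comp_apply (res q h'), res_comp, res_embed]
    rfl

theorem embed_coord_zero (h : chart 0 ≤ chart 0) :
    embed q (chart 0) (coord _ 0 h) = gen q c * gen q (ainv h) := by
  apply res_injective inf_ne_bot inf_le_left
  rw [res_embed, map_mul, res_gen, res_gen]
  exact embedInf_coord_zero inf_le_left

theorem embed_coord_one (h : chart 1 ≤ chart 1) :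
    embed q (chart 1) (coord _ 1 h) = gen q a * gen q (cinv h) := by
  apply res_injective inf_ne_bot inf_le_right
  rw [res_embed, map_mul, res_gen, res_gen]
  exact embedInf_coord_one inf_le_right

end Sec

/-- The embedding of the structure sheaf into the sheaf `F`. -/
def embedF (q : ℂˣ) : structureSheaf ⟶ (sheafF q).presheaf where
  app U := AlgCat.ofHom (Sec.embed q U.unop)
  naturality U V i := by
    ext f
    exact Sec.embed_natural (leOfHom i.unop) f

/-- The quotient map of sheaves `F → F₀`. -/
def quotientF (q : ℂˣ) : (sheafF q).presheaf ⟶ (sheafF₀ q).presheaf where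
  app U := AlgCat.ofHom (Sec₀.quotientMap q U.unop)
  naturality _ _ _ := rfl

end Embedding

namespace Sec

open SecGen

variable {q : ℂˣ} {U : Opens projLine}

/-! ## Commutation relations with the inverses of the generators -/

theorem mul_inv_rel {A : Type} [Ring A] [Algebra ℂ A] {y a b : A} {r s : ℂ} (hrs : s * r = 1)
    (hab : a * b = 1) (hba : b * a = 1) (h : y * a = r • (a * y)) : y * b = s • (b * y) := by
  have h1 : b * (y * a) * b = r • (y * b) := by
    rw [h, mul_smul_comm, smul_mul_assoc, ← mul_assoc, hba, one_mul]
  rw [mul_assoc, mul_assoc, hab, mul_one] at h1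
  rw [h1, smul_smul, hrs, one_smul]

theorem inv_mul_rel {A : Type} [Ring A] [Algebra ℂ A] {y a b : A} {r s : ℂ} (hrs : s * r = 1)
    (hab : a * b = 1) (hba : b * a = 1) (h : a * y = r • (y * a)) : b * y = s • (y * b) := by
  have h1 : b * (a * y) * b = r • (b * y) := by
    rw [h, mul_smul_comm, smul_mul_assoc, mul_assoc, mul_assoc, hab, mul_one]
  rw [← mul_assoc b, hba, one_mul] at h1
  rw [h1, smul_smul, hrs, one_smul]

theorem c_ainv (h : U ≤ chart 0) :
    gen q (c : SecGen U) * gen q (ainv h) = (q : ℂ) • (gen q (ainv h) * gen q c) :=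
  mul_inv_rel (mul_inv_cancel₀ q.ne_zero) (a_mul_ainv h) (ainv_mul_a h) ca

theorem x_ainv (h : U ≤ chart 0) :
    gen q (x : SecGen U) * gen q (ainv h) = (q : ℂ)⁻¹ • (gen q (ainv h) * gen q x) :=
  mul_inv_rel (inv_mul_cancel₀ q.ne_zero) (a_mul_ainv h) (ainv_mul_a h) xa

theorem D_ainv (h : U ≤ chart 0) :
    gen q (D : SecGen U) * gen q (ainv h) = (1 : ℂ) • (gen q (ainv h) * gen q D) :=
  mul_inv_rel (mul_one 1) (a_mul_ainv h) (ainv_mul_a h) (by rw [Da, one_smul])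

theorem cinv_a (h : U ≤ chart 1) :
    gen q (cinv h) * gen q (a : SecGen U) = (q : ℂ) • (gen q a * gen q (cinv h)) :=
  inv_mul_rel (mul_inv_cancel₀ q.ne_zero) (c_mul_cinv h) (cinv_mul_c h) ca

theorem x_cinv (h : U ≤ chart 1) :
    gen q (x : SecGen U) * gen q (cinv h) = (q : ℂ)⁻¹ • (gen q (cinv h) * gen q x) :=
  mul_inv_rel (inv_mul_cancel₀ q.ne_zero) (c_mul_cinv h) (cinv_mul_c h) xc

theorem D_cinv (h : U ≤ chart 1) :
    gen q (D : SecGen U) * gen q (cinv h) = (q : ℂ)⁻¹ ^ 2 • (gen q (cinv h) * gen q D) :=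
  mul_inv_rel (by rw [← mul_pow, inv_mul_cancel₀ q.ne_zero, one_pow]) (c_mul_cinv h)
    (cinv_mul_c h) Dc

theorem Dinv_a : gen q (Dinv : SecGen U) * gen q a = (1 : ℂ) • (gen q a * gen q Dinv) :=
  inv_mul_rel (mul_one 1) D_mul_Dinv Dinv_mul_D (by rw [Da, one_smul])

theorem Dinv_c : gen q (Dinv : SecGen U) * gen q c = (q : ℂ)⁻¹ ^ 2 • (gen q c * gen q Dinv) :=
  inv_mul_rel (by rw [← mul_pow, inv_mul_cancel₀ q.ne_zero, one_pow]) D_mul_Dinv Dinv_mul_D Dc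

theorem Dinv_x : gen q (Dinv : SecGen U) * gen q x = (q : ℂ) ^ 2 • (gen q x * gen q Dinv) :=
  inv_mul_rel (by rw [← mul_pow, mul_inv_cancel₀ q.ne_zero, one_pow]) D_mul_Dinv Dinv_mul_D Dx

theorem Dinv_ainv (h : U ≤ chart 0) :
    gen q (Dinv : SecGen U) * gen q (ainv h) = (1 : ℂ) • (gen q (ainv h) * gen q Dinv) :=
  inv_mul_rel (mul_one 1) D_mul_Dinv Dinv_mul_D (D_ainv h)

theorem Dinv_cinv (h : U ≤ chart 1) :
    gen q (Dinv : SecGen U) * gen q (cinv h) = (q : ℂ) ^ 2 • (gen q (cinv h) * gen q Dinv) :=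
  inv_mul_rel (by rw [← mul_pow, mul_inv_cancel₀ q.ne_zero, one_pow]) D_mul_Dinv Dinv_mul_D
    (D_cinv h)

theorem mul_left_rel {A : Type} [Ring A] [Algebra ℂ A] {x y z w : A} {r : ℂ}
    (h : x * y = r • (z * w)) (v : A) : x * (y * v) = r • (z * (w * v)) := by
  rw [← mul_assoc, h, smul_mul_assoc, mul_assoc]

theorem mul_left_one {A : Type} [Ring A] {x y : A} (h : x * y = 1) (v : A) : x * (y * v) = v := by
  rw [← mul_assoc, h, one_mul]

theorem Da' : gen q (D : SecGen U) * gen q a = (1 : ℂ) • (gen q a * gen q D) := by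
  rw [Da, one_smul]

/-! ## The localizations of the Takhtajan-Sudbery algebra -/

/-- The values of the map `GL(2) → F(U₁)` on generators. -/
def fromGLGen₀ (q : ℂˣ) : GLGen → Sec q (chart 0)
  | .a => gen q a
  | .b => gen q a * gen q x
  | .c => gen q c
  -- Obtained by solving D = ad − q⁻¹bc for d with b = ax: the term q⁻¹ x c equals c x.
  | .d => gen q c * gen q x + gen q (ainv le_rfl) * gen q D
  | .Dinv => gen q Dinv

/-- The map `GL(2) → F(U₁)`. -/
def fromGL₀ (q : ℂˣ) : GL2 q →ₐ[ℂ] Sec q (chart 0) :=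
  GL2.lift (fromGLGen₀ q) <| by
    have hq := q.ne_zero
    intro x y r
    cases r with
    | _ =>
      simp only [map_mul, map_sub, map_smul, map_one, FreeAlgebra.lift_ι_apply, fromGLGen₀,
        mul_add, add_mul, mul_sub, sub_mul, mul_assoc, smul_mul_assoc, mul_smul_comm, smul_smul,
        smul_add, one_mul, mul_one,
        ca, mul_left_rel ca, mul_left_rel (c_ainv _), xa, mul_left_rel xa,
        mul_left_rel (x_ainv _), xc, mul_left_rel xc, Da', mul_left_rel Da',
        Dc, Dx,
        Dinv_a, mul_left_rel Dinv_a, Dinv_c, mul_left_rel Dinv_c, Dinv_x,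
        mul_left_rel (Dinv_ainv _), D_mul_Dinv, Dinv_mul_D,
        a_mul_ainv, mul_left_one (a_mul_ainv _),
        mul_left_one (ainv_mul_a _)]
      try (match_scalars <;> field_simp <;> try ring)

theorem fromGL₀_gen (g : GLGen) : fromGL₀ q (GL2.gen q g) = fromGLGen₀ q g := GL2.lift_gen _ _ g

/-- The values of the map `GL(2) → F(U₂)` on generators. -/
def fromGLGen₁ (q : ℂˣ) : GLGen → Sec q (chart 1)
  | .a => gen q a
  -- Obtained by solving D = ad − q⁻¹bc for b with d = cx: the term −q D c⁻¹ equals −q⁻¹ c⁻¹ D.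
  | .b => gen q a * gen q x - (q : ℂ)⁻¹ • (gen q (cinv le_rfl) * gen q D)
  | .c => gen q c
  | .d => gen q c * gen q x
  | .Dinv => gen q Dinv

/-- The map `GL(2) → F(U₂)`. -/
def fromGL₁ (q : ℂˣ) : GL2 q →ₐ[ℂ] Sec q (chart 1) :=
  GL2.lift (fromGLGen₁ q) <| by
    have hq := q.ne_zero
    intro x y r
    cases r with
    | _ =>
      simp only [map_mul, map_sub, map_smul, map_one, FreeAlgebra.lift_ι_apply, fromGLGen₁,
        mul_sub, sub_mul, mul_assoc, smul_mul_assoc, mul_smul_comm, smul_smul,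
        smul_sub, one_mul, mul_one,
        ca, mul_left_rel ca, mul_left_rel (cinv_a _), xa, mul_left_rel xa,
        mul_left_rel (x_cinv _), xc, mul_left_rel xc, Da',
        Dc, mul_left_rel Dc, Dx,
        Dinv_a, mul_left_rel Dinv_a, Dinv_c, mul_left_rel Dinv_c, Dinv_x,
        mul_left_rel (Dinv_cinv _), D_mul_Dinv, Dinv_mul_D,
        mul_left_one (c_mul_cinv _), cinv_mul_c,
        mul_left_one (cinv_mul_c _)]
      try (match_scalars <;> field_simp <;> try ring)

theorem fromGL₁_gen (g : GLGen) : fromGL₁ q (GL2.gen q g) = fromGLGen₁ q g := GL2.lift_gen _ _ g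

theorem fromGL₀_det : fromGL₀ q (GL2.det q) = gen q D := by
  have hq := q.ne_zero
  simp only [GL2.det, map_sub, map_mul, map_smul, fromGL₀_gen, fromGLGen₀, mul_add, mul_assoc, xc,
    mul_left_one (a_mul_ainv _), mul_smul_comm, smul_smul]
  match_scalars <;> field_simp
  ring

theorem fromGL₁_det : fromGL₁ q (GL2.det q) = gen q D := by
  have hq := q.ne_zero
  simp only [GL2.det, map_sub, map_mul, map_smul, fromGL₁_gen, fromGLGen₁, sub_mul, mul_assoc, xc,
    Dc, mul_left_one (cinv_mul_c _), mul_smul_comm, smul_smul, smul_sub, smul_mul_assoc]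
  match_scalars <;> field_simp
  ring

theorem tinv_mul_t_mul (v : Parabolic q) : Parabolic.tinv q * (Parabolic.t q * v) = v :=
  mul_left_one Parabolic.tinv_t v

theorem t_mul_tinv_mul (v : Parabolic q) : Parabolic.t q * (Parabolic.tinv q * v) = v :=
  mul_left_one Parabolic.t_tinv v

theorem coactionGL2_gen (g : GLGen) : coactionGL2 q (GL2.gen q g) =
    Algebra.TensorProduct.map (AlgHom.id ℂ (GL2 q)) (parabolicMk q) (GL2.comulGen q g) := by
  rw [← GL2.comul_gen]
  rfl

theorem coactionHom_fromGL₀ : (coactionHom q (chart 0)).comp (fromGL₀ q) =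
    (Algebra.TensorProduct.map (fromGL₀ q) (AlgHom.id ℂ (Parabolic q))).comp (coactionGL2 q) := by
  apply GL2.hom_ext
  intro g
  rw [AlgHom.comp_apply, AlgHom.comp_apply, coactionGL2_gen, fromGL₀_gen]
  cases g <;>
    simp [fromGLGen₀, GL2.comulGen, coactionGen, fromGL₀_gen, mk_self_eq_zero, mul_add,
      tinv_mul_t_mul, t_mul_tinv_mul, TensorProduct.add_tmul, add_assoc] <;> rfl

theorem coactionHom_fromGL₁ : (coactionHom q (chart 1)).comp (fromGL₁ q) =
    (Algebra.TensorProduct.map (fromGL₁ q) (AlgHom.id ℂ (Parabolic q))).comp (coactionGL2 q) := by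
  apply GL2.hom_ext
  intro g
  rw [AlgHom.comp_apply, AlgHom.comp_apply, coactionGL2_gen, fromGL₁_gen]
  cases g <;>
    simp [fromGLGen₁, GL2.comulGen, coactionGen, fromGL₁_gen, mk_self_eq_zero, mul_add,
      tinv_mul_t_mul, t_mul_tinv_mul, TensorProduct.sub_tmul, add_sub_assoc,
      TensorProduct.smul_tmul'] <;> rfl

theorem map_rel {A B : Type} [Ring A] [Algebra ℂ A] [Ring B] [Algebra ℂ B] (f : A →ₐ[ℂ] B)
    {x y z w : A} {r : ℂ} (h : x * y = r • (z * w)) : f x * f y = r • (f z * f w) := by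
  rw [← map_mul, h, map_smul, map_mul]

/-- The determinant is the two-sided inverse of `Dinv`, so its commutation rules are the inverses of
the defining ones; no expansion is needed. -/
theorem det_a : GL2.det q * GL2.gen q .a = (1 : ℂ) • (GL2.gen q .a * GL2.det q) :=
  inv_mul_rel (mul_one 1) GL2.Dinv_mul_det GL2.det_mul_Dinv (by rw [GL2.Da, one_smul])

theorem det_b : GL2.det q * GL2.gen q .b = (q : ℂ)⁻¹ ^ 2 • (GL2.gen q .b * GL2.det q) :=
  inv_mul_rel (by rw [← mul_pow, inv_mul_cancel₀ q.ne_zero, one_pow]) GL2.Dinv_mul_det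
    GL2.det_mul_Dinv GL2.Db

theorem det_c : GL2.det q * GL2.gen q .c = (q : ℂ) ^ 2 • (GL2.gen q .c * GL2.det q) :=
  inv_mul_rel (by rw [← mul_pow, mul_inv_cancel₀ q.ne_zero, one_pow]) GL2.Dinv_mul_det
    GL2.det_mul_Dinv GL2.Dc

theorem det_d : GL2.det q * GL2.gen q .d = (1 : ℂ) • (GL2.gen q .d * GL2.det q) :=
  inv_mul_rel (mul_one 1) GL2.Dinv_mul_det GL2.det_mul_Dinv (by rw [GL2.Dd, one_smul])

/-- The extension of an algebra map that makes `a` invertible. -/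
theorem exists_extension_zero {T : Type} [Ring T] [Algebra ℂ T] (g : GL2 q →ₐ[ℂ] T) (u : Tˣ)
    (hu : (u : T) = g (GL2.gen q .a)) : ∃ h : Sec q (chart 0) →ₐ[ℂ] T, h.comp (fromGL₀ q) = g := by
  have hq := q.ne_zero
  have h₁ : g (GL2.gen q .a) * (u⁻¹ : Tˣ) = 1 := by rw [← hu, Units.mul_inv]
  have h₂ : (u⁻¹ : Tˣ) * g (GL2.gen q .a) = 1 := by rw [← hu, Units.inv_mul]
  have ca := map_rel g (GL2.ca (q := q))
  have ba := map_rel g (GL2.ba (q := q))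
  have cb := map_rel g (GL2.cb (q := q))
  have Da := map_rel g (det_a (q := q))
  have Dc := map_rel g (det_c (q := q))
  have Db := map_rel g (det_b (q := q))
  have cA := mul_inv_rel (mul_inv_cancel₀ hq) h₁ h₂ ca
  have bA := mul_inv_rel (inv_mul_cancel₀ hq) h₁ h₂ ba
  have DA := mul_inv_rel (mul_one 1) h₁ h₂ Da
  let f : SecGen (chart 0) → T
    | .a => g (GL2.gen q .a)
    | .c => g (GL2.gen q .c)
    -- Forced by the relation b = ax.
    | .x => (u⁻¹ : Tˣ) * g (GL2.gen q .b)
    | .D => g (GL2.det q)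
    | .Dinv => g (GL2.gen q .Dinv)
    | .ainv _ => (u⁻¹ : Tˣ)
    | .cinv h => absurd h (chart_not_le zero_ne_one)
  refine ⟨lift f ?_, ?_⟩
  · intro x y r
    cases r with
    | D_mul_Dinv => simp only [map_mul, map_one, FreeAlgebra.lift_ι_apply, f, ← map_mul g,
        GL2.det_mul_Dinv]
    | Dinv_mul_D => simp only [map_mul, map_one, FreeAlgebra.lift_ι_apply, f, ← map_mul g,
        GL2.Dinv_mul_det]
    | a_mul_ainv => simp only [map_mul, map_one, FreeAlgebra.lift_ι_apply, f, h₁]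
    | ainv_mul_a => simp only [map_mul, map_one, FreeAlgebra.lift_ι_apply, f, h₂]
    | c_mul_cinv h => exact absurd h (chart_not_le zero_ne_one)
    | cinv_mul_c h => exact absurd h (chart_not_le zero_ne_one)
    | empty h => exact absurd h (chart_ne_bot 0)
    | _ =>
      simp only [map_mul, map_smul, FreeAlgebra.lift_ι_apply, f, mul_assoc, mul_smul_comm,
        smul_smul, ca, ba, cb, Da, Dc, Db, mul_left_rel cA, mul_left_rel DA,
        mul_left_one h₁, mul_left_one h₂]
      try (match_scalars; field_simp)
  · apply GL2.hom_ext
    intro γ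
    rw [AlgHom.comp_apply, fromGL₀_gen]
    cases γ with
    -- The image of a⁻¹D is d − q⁻¹ a⁻¹ b c, and c a⁻¹ b = q⁻¹ a⁻¹ b c, the image of cx, restores d.
    | d =>
      simp only [fromGLGen₀, map_add, map_mul, lift_gen, f, GL2.det, map_sub, map_smul, mul_sub,
        mul_left_one h₂, mul_left_rel cA, cb, mul_smul_comm, smul_smul]
      match_scalars <;> field_simp
      ring
    | b => simp only [fromGLGen₀, map_mul, lift_gen, f, mul_left_one h₁]
    | _ => simp only [fromGLGen₀, lift_gen, f]

/-- The extension of an algebra map that makes `c` invertible. -/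
theorem exists_extension_one {T : Type} [Ring T] [Algebra ℂ T] (g : GL2 q →ₐ[ℂ] T) (u : Tˣ)
    (hu : (u : T) = g (GL2.gen q .c)) : ∃ h : Sec q (chart 1) →ₐ[ℂ] T, h.comp (fromGL₁ q) = g := by
  have hq := q.ne_zero
  have h₁ : g (GL2.gen q .c) * (u⁻¹ : Tˣ) = 1 := by rw [← hu, Units.mul_inv]
  have h₂ : (u⁻¹ : Tˣ) * g (GL2.gen q .c) = 1 := by rw [← hu, Units.inv_mul]
  have ac : g (GL2.gen q .a) * g (GL2.gen q .c) =
      (q : ℂ) • (g (GL2.gen q .c) * g (GL2.gen q .a)) := by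
    rw [map_rel g (GL2.ca (q := q)), smul_smul, mul_inv_cancel₀ hq, one_smul]
  have ad : g (GL2.gen q .a) * g (GL2.gen q .d) = (1 : ℂ) •
      (g (GL2.gen q .d) * g (GL2.gen q .a)) := by
    rw [one_smul, ← map_mul, ← GL2.da, map_mul]
  have bc : g (GL2.gen q .b) * g (GL2.gen q .c) =
      (q : ℂ) ^ 2 • (g (GL2.gen q .c) * g (GL2.gen q .b)) := by
    rw [map_rel g (GL2.cb (q := q)), smul_smul, ← mul_pow, mul_inv_cancel₀ hq, one_pow, one_smul]
  have dc := map_rel g (GL2.dc (q := q))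
  have Da := map_rel g (det_a (q := q))
  have Dc := map_rel g (det_c (q := q))
  have Dd := map_rel g (det_d (q := q))
  have aC := mul_inv_rel (inv_mul_cancel₀ hq) h₁ h₂ ac
  have DC := mul_inv_rel (s := (q : ℂ)⁻¹ ^ 2)
    (by rw [← mul_pow, inv_mul_cancel₀ hq, one_pow]) h₁ h₂ Dc
  let f : SecGen (chart 1) → T
    | .a => g (GL2.gen q .a)
    | .c => g (GL2.gen q .c)
    -- Forced by the relation d = cx.
    | .x => (u⁻¹ : Tˣ) * g (GL2.gen q .d)
    | .D => g (GL2.det q)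
    | .Dinv => g (GL2.gen q .Dinv)
    | .cinv _ => (u⁻¹ : Tˣ)
    | .ainv h => absurd h (chart_not_le one_ne_zero)
  refine ⟨lift f ?_, ?_⟩
  · intro x y r
    cases r with
    | D_mul_Dinv => simp only [map_mul, map_one, FreeAlgebra.lift_ι_apply, f, ← map_mul g,
        GL2.det_mul_Dinv]
    | Dinv_mul_D => simp only [map_mul, map_one, FreeAlgebra.lift_ι_apply, f, ← map_mul g,
        GL2.Dinv_mul_det]
    | c_mul_cinv => simp only [map_mul, map_one, FreeAlgebra.lift_ι_apply, f, h₁]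
    | cinv_mul_c => simp only [map_mul, map_one, FreeAlgebra.lift_ι_apply, f, h₂]
    | a_mul_ainv h => exact absurd h (chart_not_le one_ne_zero)
    | ainv_mul_a h => exact absurd h (chart_not_le one_ne_zero)
    | empty h => exact absurd h (chart_ne_bot 1)
    | _ =>
      simp only [map_mul, map_smul, FreeAlgebra.lift_ι_apply, f, mul_assoc, mul_smul_comm,
        smul_smul, ac, ad, dc, Da, Dc, Dd, mul_left_rel aC, mul_left_rel DC,
        mul_left_one h₁, mul_left_one h₂]
      try (match_scalars <;> field_simp)
  · apply GL2.hom_ext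
    intro γ
    rw [AlgHom.comp_apply, fromGL₁_gen]
    cases γ with
    | b =>
      simp only [fromGLGen₁, map_sub, map_mul, lift_gen, f, GL2.det, map_smul, mul_sub,
        mul_left_one h₂, mul_left_rel aC, ad, bc, mul_smul_comm, smul_smul, smul_sub]
      match_scalars <;> field_simp
      ring
    | d => simp only [fromGLGen₁, map_mul, lift_gen, f, mul_left_one h₁]
    | _ => simp only [fromGLGen₁, lift_gen, f]

/-- Uniqueness holds because F(U₁) is generated by the image of A and a⁻¹: x = a⁻¹b, D is the image
of the determinant, and an algebra map is determined on an inverse. Existence is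
`exists_extension_zero`. -/
theorem isLocalizationAt_fromGL₀ : IsLocalizationAt (fromGL₀ q) (GL2.gen q .a) := by
  have hu : ∀ {T : Type} [Ring T] [Algebra ℂ T] (h h' : Sec q (chart 0) →ₐ[ℂ] T),
      h.comp (fromGL₀ q) = h'.comp (fromGL₀ q) → h = h' := by
    intro T _ _ h h' hh
    have hg : ∀ y, h (fromGL₀ q y) = h' (fromGL₀ q y) := fun y => DFunLike.congr_fun hh y
    have ha : h (gen q a) = h' (gen q a) := by simpa [fromGL₀_gen, fromGLGen₀] using hg (GL2.gen q .a)
    have hA : ∀ H, h (gen q (ainv H)) = h' (gen q (ainv H)) := fun H =>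
      left_inv_eq_right_inv (a := h (gen q a)) (by rw [← map_mul, ainv_mul_a, map_one])
        (by rw [ha, ← map_mul, a_mul_ainv, map_one])
    apply hom_ext
    intro γ
    cases γ with
    | a => exact ha
    | c => simpa [fromGL₀_gen, fromGLGen₀] using hg (GL2.gen q .c)
    | D => simpa [fromGL₀_det] using hg (GL2.det q)
    | Dinv => simpa [fromGL₀_gen, fromGLGen₀] using hg (GL2.gen q .Dinv)
    | x =>
      have hx : gen q x = gen q (ainv le_rfl) * fromGL₀ q (GL2.gen q .b) := by
        rw [fromGL₀_gen, fromGLGen₀, mul_left_one (ainv_mul_a _)]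
      rw [hx, map_mul, map_mul, hA, hg]
    | ainv H => exact hA H
    | cinv H => exact absurd H (chart_not_le zero_ne_one)
  refine ⟨⟨⟨gen q a, gen q (ainv le_rfl), a_mul_ainv _, ainv_mul_a _⟩, (fromGL₀_gen GLGen.a).symm⟩, ?_⟩
  rintro T _ _ g ⟨u, hg⟩
  obtain ⟨h, hh⟩ := exists_extension_zero g u hg
  exact ⟨h, hh, fun h' hh' => hu _ _ (hh'.trans hh.symm)⟩

theorem isLocalizationAt_fromGL₁ : IsLocalizationAt (fromGL₁ q) (GL2.gen q .c) := by
  have hu : ∀ {T : Type} [Ring T] [Algebra ℂ T] (h h' : Sec q (chart 1) →ₐ[ℂ] T),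
      h.comp (fromGL₁ q) = h'.comp (fromGL₁ q) → h = h' := by
    intro T _ _ h h' hh
    have hg : ∀ y, h (fromGL₁ q y) = h' (fromGL₁ q y) := fun y => DFunLike.congr_fun hh y
    have hc : h (gen q c) = h' (gen q c) := by simpa [fromGL₁_gen, fromGLGen₁] using hg (GL2.gen q .c)
    have hC : ∀ H, h (gen q (cinv H)) = h' (gen q (cinv H)) := fun H =>
      left_inv_eq_right_inv (a := h (gen q c)) (by rw [← map_mul, cinv_mul_c, map_one])
        (by rw [hc, ← map_mul, c_mul_cinv, map_one])
    apply hom_ext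
    intro γ
    cases γ with
    | c => exact hc
    | a => simpa [fromGL₁_gen, fromGLGen₁] using hg (GL2.gen q .a)
    | D => simpa [fromGL₁_det] using hg (GL2.det q)
    | Dinv => simpa [fromGL₁_gen, fromGLGen₁] using hg (GL2.gen q .Dinv)
    | x =>
      have hx : gen q x = gen q (cinv le_rfl) * fromGL₁ q (GL2.gen q .d) := by
        rw [fromGL₁_gen, fromGLGen₁, mul_left_one (cinv_mul_c _)]
      rw [hx, map_mul, map_mul, hC, hg]
    | cinv H => exact hC H
    | ainv H => exact absurd H (chart_not_le one_ne_zero)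
  refine ⟨⟨⟨gen q c, gen q (cinv le_rfl), c_mul_cinv _, cinv_mul_c _⟩, (fromGL₁_gen GLGen.c).symm⟩, ?_⟩
  rintro T _ _ g ⟨u, hg⟩
  obtain ⟨h, hh⟩ := exists_extension_one g u hg
  exact ⟨h, hh, fun h' hh' => hu _ _ (hh'.trans hh.symm)⟩

/-- The presentation over U₁ ∩ U₂ differs from that over U₁ exactly by the generator c⁻¹ and its two
relations, so adding the inverse is all that an extension requires. -/
theorem isLocalizationAt_res_zero :
    IsLocalizationAt (res q (inf_le_left : chart 0 ⊓ chart 1 ≤ chart 0)) (gen q c) := by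
  have hq := q.ne_zero
  refine ⟨⟨⟨gen q c, gen q (cinv inf_le_right), c_mul_cinv _, cinv_mul_c _⟩,
    (res_gen _ SecGen.c).symm⟩, ?_⟩
  rintro T _ _ g ⟨u, hg⟩
  let f : SecGen (chart 0 ⊓ chart 1) → T
    | .a => g (gen q a)
    | .c => g (gen q c)
    | .x => g (gen q x)
    | .D => g (gen q D)
    | .Dinv => g (gen q Dinv)
    | .ainv _ => g (gen q (ainv le_rfl))
    | .cinv _ => (u⁻¹ : Tˣ)
  refine ⟨lift f ?_, ?_, fun h' hh' => ?_⟩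
  · intro x y r
    cases r with
    | c_mul_cinv => simp only [map_mul, map_one, FreeAlgebra.lift_ι_apply, f, ← hg, Units.mul_inv]
    | cinv_mul_c => simp only [map_mul, map_one, FreeAlgebra.lift_ι_apply, f, ← hg, Units.inv_mul]
    | empty h => exact absurd h inf_ne_bot
    | _ =>
      simp only [map_mul, map_smul, map_one, FreeAlgebra.lift_ι_apply, f]
      simp only [← map_mul g, ca, xa, xc, Da, Dc, Dx, map_smul g, smul_smul, map_one,
        D_mul_Dinv, Dinv_mul_D, a_mul_ainv, ainv_mul_a]
      try (match_scalars; field_simp)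
  · apply hom_ext
    intro γ
    cases γ with
    | cinv H => exact absurd H (chart_not_le zero_ne_one)
    | _ => simp only [AlgHom.comp_apply, res_gen, resGen, lift_gen, f]
  · have hc : h' (gen q c) = g (gen q c) := by simpa [resGen] using DFunLike.congr_fun hh' (gen q c)
    apply hom_ext
    intro γ
    rw [lift_gen]
    cases γ with
    | cinv H =>
      refine left_inv_eq_right_inv (a := h' (gen q c)) (by rw [← map_mul, cinv_mul_c, map_one]) ?_
      simp only [hc, f, ← hg, Units.mul_inv]
    | a => simpa [resGen] using DFunLike.congr_fun hh' (gen q a)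
    | c => exact hc
    | x => simpa [resGen] using DFunLike.congr_fun hh' (gen q x)
    | D => simpa [resGen] using DFunLike.congr_fun hh' (gen q D)
    | Dinv => simpa [resGen] using DFunLike.congr_fun hh' (gen q Dinv)
    | ainv H => simpa [resGen] using DFunLike.congr_fun hh' (gen q (ainv le_rfl))

theorem isLocalizationAt_res_one :
    IsLocalizationAt (res q (inf_le_right : chart 0 ⊓ chart 1 ≤ chart 1)) (gen q a) := by
  have hq := q.ne_zero
  refine ⟨⟨⟨gen q a, gen q (ainv inf_le_left), a_mul_ainv _, ainv_mul_a _⟩,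
    (res_gen _ SecGen.a).symm⟩, ?_⟩
  rintro T _ _ g ⟨u, hg⟩
  let f : SecGen (chart 0 ⊓ chart 1) → T
    | .a => g (gen q a)
    | .c => g (gen q c)
    | .x => g (gen q x)
    | .D => g (gen q D)
    | .Dinv => g (gen q Dinv)
    | .ainv _ => (u⁻¹ : Tˣ)
    | .cinv _ => g (gen q (cinv le_rfl))
  refine ⟨lift f ?_, ?_, fun h' hh' => ?_⟩
  · intro x y r
    cases r with
    | a_mul_ainv => simp only [map_mul, map_one, FreeAlgebra.lift_ι_apply, f, ← hg, Units.mul_inv]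
    | ainv_mul_a => simp only [map_mul, map_one, FreeAlgebra.lift_ι_apply, f, ← hg, Units.inv_mul]
    | empty h => exact absurd h inf_ne_bot
    | _ =>
      simp only [map_mul, map_smul, map_one, FreeAlgebra.lift_ι_apply, f]
      simp only [← map_mul g, ca, xa, xc, Da, Dc, Dx, map_smul g, smul_smul, map_one,
        D_mul_Dinv, Dinv_mul_D, c_mul_cinv, cinv_mul_c]
      try (match_scalars; field_simp)
  · apply hom_ext
    intro γ
    cases γ with
    | ainv H => exact absurd H (chart_not_le one_ne_zero)
    | _ => simp only [AlgHom.comp_apply, res_gen, resGen, lift_gen, f]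
  · have ha : h' (gen q a) = g (gen q a) := by simpa [resGen] using DFunLike.congr_fun hh' (gen q a)
    apply hom_ext
    intro γ
    rw [lift_gen]
    cases γ with
    | ainv H =>
      refine left_inv_eq_right_inv (a := h' (gen q a)) (by rw [← map_mul, ainv_mul_a, map_one]) ?_
      simp only [ha, f, ← hg, Units.mul_inv]
    | a => exact ha
    | c => simpa [resGen] using DFunLike.congr_fun hh' (gen q c)
    | x => simpa [resGen] using DFunLike.congr_fun hh' (gen q x)
    | D => simpa [resGen] using DFunLike.congr_fun hh' (gen q D)
    | Dinv => simpa [resGen] using DFunLike.congr_fun hh' (gen q Dinv)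
    | cinv H => simpa [resGen] using DFunLike.congr_fun hh' (gen q (cinv le_rfl))

end Sec

/-! ## The antipodes are bijective -/

/-- The square of the antipode is multiplicative, so generators suffice. On b and c the scalars in
the antipode cancel against those produced by moving the determinant past the generator. Being
involutive, the antipode is bijective, and this passes to the Hopf quotients. -/
theorem GL2.antipode_antipode {q : ℂˣ} (x : GL2 q) :
    HopfAlgebra.antipode ℂ (HopfAlgebra.antipode ℂ x) = x := by
  have hq := q.ne_zero
  have hS : ∀ y, HopfAlgebra.antipode ℂ y = antipodeMap q y := fun _ => rfl
  simp only [hS]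
  induction x using GL2.induction with
  | hC r => simp [Algebra.algebraMap_eq_smul_one, antipodeMap_one]
  | hg g =>
    rw [antipodeMap_gen]
    cases g with
    | Dinv =>
      rw [antipodeGen, det, map_sub, map_smul, antipodeMap_mul, antipodeMap_mul]
      simp only [antipodeMap_gen]
      exact antipodeGen_det
    | _ =>
      simp only [antipodeGen, map_neg, map_smul, antipodeMap_mul, antipodeMap_gen, mul_neg, neg_neg,
        smul_neg, mul_smul_comm, ← mul_assoc, Sec.det_a, Sec.det_b, Sec.det_c, Sec.det_d,
        smul_mul_assoc, smul_smul]
      simp only [mul_assoc, det_mul_Dinv, mul_one]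
      match_scalars
      field_simp
  | hm x y hx hy => rw [antipodeMap_mul, antipodeMap_mul, hx, hy]
  | ha x y hx hy => rw [map_add, map_add, hx, hy]

theorem Parabolic.antipode_antipode {q : ℂˣ} (x : Parabolic q) :
    HopfAlgebra.antipode ℂ (HopfAlgebra.antipode ℂ x) = x := by
  obtain ⟨x, rfl⟩ := Ideal.Quotient.mk_surjective x
  rw [HopfAlgebra.Quotient.antipode_mk, HopfAlgebra.Quotient.antipode_mk, GL2.antipode_antipode]

theorem Levi.antipode_antipode {q : ℂˣ} (x : Levi q) :
    HopfAlgebra.antipode ℂ (HopfAlgebra.antipode ℂ x) = x := by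
  obtain ⟨x, rfl⟩ := Ideal.Quotient.mk_surjective x
  rw [HopfAlgebra.Quotient.antipode_mk, HopfAlgebra.Quotient.antipode_mk,
    Parabolic.antipode_antipode]

/-! ## Linear independence of families of monomials -/

/-- The scalar in front of each basis vector is only required to exist as a unit; so the powers of q
arising from reordering monomials never have to be computed. -/
theorem linearIndependent_of_single {V ι M : Type} [AddCommGroup V] [Module ℂ V]
    (φ : V →ₗ[ℂ] M →₀ ℂ) {f : ι → M} (hf : Function.Injective f) {v : ι → V}
    (h : ∀ i, ∃ r : ℂˣ, φ (v i) = r • Finsupp.single (f i) 1) : LinearIndependent ℂ v := by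
  choose r hr using h
  apply LinearIndependent.of_comp φ
  have : φ ∘ v = r • fun i => Finsupp.single (f i) (1 : ℂ) := funext hr
  rw [this]
  exact ((Finsupp.linearIndependent_single_one ℂ M).comp f hf).units_smul r

/-! ## Bases of the Hopf algebras -/

namespace Parabolic

open SecGen

variable {q : ℂˣ}

theorem e_ts : e q * (t q * s q) = 1 := by
  rw [← mul_assoc, et, mul_assoc, es]; exact t_tinv

theorem ts_e : t q * s q * e q = 1 := by rw [mul_assoc]; exact t_tinv

/-- The values of the projection `F(U₁) → H` on the generators. -/
def projGen (q : ℂˣ) : SecGen (chart 0) → Parabolic q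
  | .a => t q
  | .c => 0
  | .x => tinv q * n q
  | .D => t q * s q
  | .Dinv => e q
  | .ainv _ => tinv q
  | .cinv h => absurd h (chart_not_le zero_ne_one)

/-- The projection `F(U₁) → H`. -/
def proj (q : ℂˣ) : Sec q (chart 0) →ₐ[ℂ] Parabolic q :=
  Sec.lift (projGen q) <| by
    have hq := q.ne_zero
    have h₁ : ∀ v : Parabolic q, s q * (tinv q * v) = tinv q * (s q * v) := fun v => by
      rw [← mul_assoc, s_tinv, mul_assoc]
    intro x y r
    cases r with
    | D_mul_Dinv => simpa [projGen] using ts_e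
    | Dinv_mul_D => simpa [projGen] using e_ts
    | a_mul_ainv h => simpa [projGen] using t_tinv
    | ainv_mul_a h => simpa [projGen] using tinv_t
    | c_mul_cinv h => exact absurd h (chart_not_le zero_ne_one)
    | cinv_mul_c h => exact absurd h (chart_not_le zero_ne_one)
    | empty h => exact absurd h (chart_ne_bot 0)
    | _ =>
      simp only [map_mul, map_smul, FreeAlgebra.lift_ι_apply, projGen, mul_zero, zero_mul,
        smul_zero, mul_assoc, nt, Sec.mul_left_rel nt, st, h₁, sn, Sec.tinv_mul_t_mul,
        Sec.t_mul_tinv_mul, mul_smul_comm, smul_smul]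
      try (match_scalars <;> field_simp)

theorem proj_gen (g : SecGen (chart 0)) : proj q (Sec.gen q g) = projGen q g := Sec.lift_gen _ _ g

/-- The endomorphism of `F(U₁)` that kills `c`. -/
def killC (q : ℂˣ) : Sec q (chart 0) →ₐ[ℂ] Sec q (chart 0) :=
  Sec.lift (fun g => match g with | .c => 0 | g => Sec.gen q g) <| by
    have hq := q.ne_zero
    intro x y r
    cases r with
    | D_mul_Dinv => simpa using Sec.D_mul_Dinv
    | Dinv_mul_D => simpa using Sec.Dinv_mul_D
    | a_mul_ainv h => simpa using Sec.a_mul_ainv h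
    | ainv_mul_a h => simpa using Sec.ainv_mul_a h
    | c_mul_cinv h => exact absurd h (chart_not_le zero_ne_one)
    | cinv_mul_c h => exact absurd h (chart_not_le zero_ne_one)
    | empty h => exact absurd h (chart_ne_bot 0)
    | _ =>
      simp only [map_mul, map_smul, FreeAlgebra.lift_ι_apply, mul_zero, zero_mul, smul_zero,
        Sec.xa, Sec.Da, Sec.Dx, smul_smul]
      try (match_scalars <;> field_simp)

theorem killC_fromGL₀_c : ((killC q).comp (Sec.fromGL₀ q)) (GL2.gen q .c) = 0 := by
  rw [AlgHom.comp_apply, Sec.fromGL₀_gen]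
  exact Sec.lift_gen _ _ _

/-- The section `H → F(U₁)` of the projection. -/
def sect (q : ℂˣ) : Parabolic q →ₐ[ℂ] Sec q (chart 0) :=
  Ideal.Quotient.liftₐ _ ((killC q).comp (Sec.fromGL₀ q)) fun _ h =>
    eq_zero_of_mem_idealOf ((killC q).comp (Sec.fromGL₀ q)).toRingHom killC_fromGL₀_c h

theorem sect_mk (g : GLGen) :
    sect q (parabolicMk q (GL2.gen q g)) = killC q (Sec.fromGLGen₀ q g) :=
  congrArg (killC q) (Sec.fromGL₀_gen g)

theorem sect_t : sect q (t q) = Sec.gen q a :=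
  (sect_mk .a).trans (Sec.lift_gen _ _ _)

theorem sect_n : sect q (n q) = Sec.gen q a * Sec.gen q x := by
  refine (sect_mk .b).trans ?_
  rw [Sec.fromGLGen₀, map_mul, killC, Sec.lift_gen, Sec.lift_gen]

theorem sect_s : sect q (s q) = Sec.gen q (ainv le_rfl) * Sec.gen q D := by
  refine (sect_mk .d).trans ?_
  simp only [Sec.fromGLGen₀, map_mul, map_add, killC, Sec.lift_gen, zero_mul, zero_add]

theorem sect_e : sect q (e q) = Sec.gen q Dinv :=
  (sect_mk .Dinv).trans (Sec.lift_gen _ _ _)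

theorem sect_tinv : sect q (tinv q) = Sec.gen q (ainv le_rfl) := by
  rw [tinv, map_mul, sect_s, sect_e, mul_assoc, Sec.D_mul_Dinv, mul_one]

/-- H is a retract of F(U₁), obtained by setting c = 0. The section carries independence of
monomials back to H, and the surjective projection carries over spanning and the multiplication
rules for monomials. -/
theorem proj_comp_sect : (proj q).comp (sect q) = AlgHom.id ℂ (Parabolic q) := by
  apply Ideal.Quotient.algHom_ext ℂ
  apply GL2.hom_ext
  intro g
  cases g with
  | a => exact (congrArg (proj q) sect_t).trans (proj_gen _)
  | b =>
    refine (congrArg (proj q) sect_n).trans ?_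
    rw [map_mul, proj_gen, proj_gen]
    exact Sec.t_mul_tinv_mul _
  | c =>
    refine Eq.trans (map_zero (proj q) ▸ congrArg (proj q) ?_) (mk_self_eq_zero _).symm
    exact killC_fromGL₀_c
  | d =>
    refine (congrArg (proj q) sect_s).trans ?_
    rw [map_mul, proj_gen, proj_gen]
    exact Sec.tinv_mul_t_mul _
  | Dinv => exact (congrArg (proj q) sect_e).trans (proj_gen _)

theorem proj_sect (y : Parabolic q) : proj q (sect q y) = y := DFunLike.congr_fun proj_comp_sect y

theorem proj_surjective : Function.Surjective (proj q) := fun y => ⟨_, proj_sect y⟩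

/-- The element `t⁻¹ n`. -/
def w (q : ℂˣ) : Parabolic q := tinv q * n q

/-- The monomial `t ^ j * (t⁻¹ n) ^ k * (t s) ^ l`. -/
def mon (q : ℂˣ) (m : ℤ × ℕ × ℤ) : Parabolic q :=
  zp (t q) (tinv q) m.1 * (w q ^ m.2.1 * zp (t q * s q) (e q) m.2.2)

theorem proj_mon (m : ℤ × ℕ × ℤ) : proj q (Sec.mon q _ (m.1, 0, m.2)) = mon q m := by
  simp only [Sec.mon, map_mul, map_pow, map_zp, Sec.ainv₀_eq le_rfl, proj_gen, projGen, zp_zero,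
    one_mul]
  rfl

theorem proj_mon_eq_zero {m : MonIndex} (hm : m.2.1 ≠ 0) : proj q (Sec.mon q _ m) = 0 := by
  have : proj q (zp (Sec.gen q c) (Sec.cinv₀ q (chart 0)) m.2.1) = 0 := by
    rw [Sec.cinv₀, dif_neg (chart_not_le zero_ne_one), map_zp, map_zero, proj_gen]
    change zp (0 : Parabolic q) 0 m.2.1 = 0
    rcases lt_or_gt_of_ne hm with h | h
    · exact zp_of_neg _ h
    · rw [zp, zero_pow (by omega), zero_mul]
  rw [Sec.mon, map_mul, map_mul, this, zero_mul, mul_zero]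

theorem sect_mon (m : ℤ × ℕ × ℤ) : sect q (mon q m) = Sec.mon q _ (m.1, 0, m.2) := by
  have hx : sect q (w q) = Sec.gen q x := by
    rw [w, map_mul, sect_tinv, sect_n, Sec.mul_left_one (Sec.ainv_mul_a _)]
  have hD : sect q (t q * s q) = Sec.gen q D := by
    rw [map_mul, sect_t, sect_s, Sec.mul_left_one (Sec.a_mul_ainv _)]
  simp only [Sec.mon, mon, map_mul, map_pow, map_zp, Sec.ainv₀_eq le_rfl, sect_t, sect_tinv, hx,
    hD, sect_e, zp_zero, one_mul]

theorem mem_monSet (m : ℤ × ℕ × ℤ) : ((m.1, 0, m.2) : MonIndex) ∈ Sec.monSet (chart 0) :=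
  ⟨Or.inl le_rfl, Or.inr le_rfl⟩

theorem linearIndependent_mon : LinearIndependent ℂ (mon q) :=
  linearIndependent_of_single (Sec.ev q 1 (chart_ne_bot 0) ∘ₗ (sect q).toLinearMap)
    (f := fun m => ((m.1, 0, m.2) : MonIndex))
    (fun m m' h => by simp only [Prod.mk.injEq, true_and] at h; exact Prod.ext h.1 h.2)
    fun m => ⟨1, by
      rw [LinearMap.comp_apply, AlgHom.toLinearMap_apply, sect_mon,
        Sec.ev_mon 1 (chart_ne_bot 0) (mem_monSet m), one_pow, one_smul]⟩

theorem span_mon : Submodule.span ℂ (Set.range (mon q)) = ⊤ := by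
  rw [eq_top_iff, ← LinearMap.range_eq_top.2 (show Function.Surjective (proj q).toLinearMap from
    proj_surjective), ← Submodule.map_top, ← Sec.span_mon, Submodule.map_span, Submodule.span_le]
  rintro _ ⟨_, ⟨m, rfl⟩, rfl⟩
  by_cases hm : m.2.1 = 0
  · refine Submodule.subset_span ⟨(m.1, m.2.2), ?_⟩
    rw [← proj_mon, ← hm]
    rfl
  · change proj q _ ∈ Submodule.span ℂ _
    rw [proj_mon_eq_zero hm]
    exact zero_mem _

/-- The basis of `H` that consists of the monomials. -/
def basis (q : ℂˣ) : Module.Basis (ℤ × ℕ × ℤ) ℂ (Parabolic q) :=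
  Module.Basis.mk linearIndependent_mon span_mon.ge

theorem basis_apply (m : ℤ × ℕ × ℤ) : basis q m = mon q m := Module.Basis.mk_apply _ _ m

theorem tinv_mul_mon (m : ℤ × ℕ × ℤ) : tinv q * mon q m = mon q (m.1 - 1, m.2) := by
  have := congrArg (proj q) (Sec.ainv_mul_mon (q := q) le_rfl (m.1, 0, m.2))
  rw [map_mul, proj_gen] at this
  rw [← proj_mon, ← proj_mon]
  exact this

theorem w_mul_mon (m : ℤ × ℕ × ℤ) :
    ∃ r : ℂˣ, w q * mon q m = r • mon q (m.1, m.2.1 + 1, m.2.2) := by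
  obtain ⟨r, hr⟩ := Sec.x_mul_mon (q := q) (U := chart 0) (m.1, 0, m.2)
  refine ⟨r, ?_⟩
  have := congrArg (proj q) hr
  rw [Units.smul_def, map_smul, map_mul, proj_gen] at this
  rw [← proj_mon, ← proj_mon]
  exact this

theorem ts_mul_mon (m : ℤ × ℕ × ℤ) :
    ∃ r : ℂˣ, t q * s q * mon q m = r • mon q (m.1, m.2.1, m.2.2 + 1) := by
  obtain ⟨r, hr⟩ := Sec.D_mul_mon (q := q) (U := chart 0) (m.1, 0, m.2)
  refine ⟨r, ?_⟩
  have := congrArg (proj q) hr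
  rw [Units.smul_def, map_smul, map_mul, proj_gen] at this
  rw [← proj_mon, ← proj_mon]
  exact this

/-- Written in t⁻¹ and ts, the element t⁻¹s is seen to shift monomials without changing their degree
in t⁻¹n. -/
theorem tinv_s : tinv q * s q = tinv q * (tinv q * (t q * s q)) := by
  rw [Sec.tinv_mul_t_mul]

theorem tinv_s_mul_mon (m : ℤ × ℕ × ℤ) :
    ∃ r : ℂˣ, tinv q * s q * mon q m = r • mon q (m.1 - 1 - 1, m.2.1, m.2.2 + 1) := by
  obtain ⟨r, hr⟩ := ts_mul_mon (q := q) m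
  refine ⟨r, ?_⟩
  rw [tinv_s, mul_assoc, mul_assoc, hr, mul_smul_comm, mul_smul_comm, tinv_mul_mon, tinv_mul_mon]

/-- The group-like monomials `t ^ j * (t s) ^ l`. -/
def glike (q : ℂˣ) (m : ℤ × ℤ) : Parabolic q := zp (t q) (tinv q) m.1 * zp (t q * s q) (e q) m.2

theorem glike_eq_mon (m : ℤ × ℤ) : glike q m = mon q (m.1, 0, m.2) := by
  rw [glike, mon, pow_zero, one_mul]

theorem zp_tmul {A B : Type} [Ring A] [Algebra ℂ A] [Ring B] [Algebra ℂ B] (a b : A) (c d : B)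
    (i : ℤ) : zp (a ⊗ₜ[ℂ] c) (b ⊗ₜ[ℂ] d) i = zp a b i ⊗ₜ[ℂ] zp c d i := by
  simp [zp, Algebra.TensorProduct.tmul_pow]

theorem zp_one_one (i : ℤ) : zp (1 : ℂ) 1 i = 1 := by simp [zp]

theorem comul_glike (m : ℤ × ℤ) :
    Coalgebra.comul (R := ℂ) (glike q m) = glike q m ⊗ₜ[ℂ] glike q m := by
  rw [← Bialgebra.comulAlgHom_apply]
  simp only [glike, map_mul, map_zp]
  simp only [Bialgebra.comulAlgHom_apply, comul_t, comul_tinv, comul_s,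
    comul_e, Algebra.TensorProduct.tmul_mul_tmul, zp_tmul]

theorem counit_glike (m : ℤ × ℤ) : Coalgebra.counit (R := ℂ) (glike q m) = 1 := by
  rw [← Bialgebra.counitAlgHom_apply]
  simp only [glike, map_mul, map_zp]
  simp only [Bialgebra.counitAlgHom_apply, counit_t, counit_tinv, counit_s,
    counit_e, mul_one, zp_one_one]

end Parabolic

namespace Levi

variable {q : ℂˣ}

/-- The projection of the parabolic subgroup onto its Levi quotient. -/
abbrev mk (q : ℂˣ) : Parabolic q →ₐ[ℂ] Levi q := Ideal.Quotient.mkₐ ℂ (leviIdeal q)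

theorem mk_n : mk q (Parabolic.n q) = 0 := mk_self_eq_zero _

/-- The section `H₀ → F₀(U₁)` of the projection. -/
def sect (q : ℂˣ) : Levi q →ₐ[ℂ] Sec₀ q (chart 0) :=
  Ideal.Quotient.liftₐ _ ((Sec₀.quotientMap q _).comp (Parabolic.sect q)) fun _ h =>
    eq_zero_of_mem_idealOf ((Sec₀.quotientMap q _).comp (Parabolic.sect q)).toRingHom (by
      change Sec₀.quotientMap q _ (Parabolic.sect q (Parabolic.n q)) = 0
      rw [Parabolic.sect_n, map_mul, Sec₀.quotientMap_x, mul_zero]) h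

/-- The group-like monomials `t ^ j * (t s) ^ l`. -/
def glike (q : ℂˣ) (m : ℤ × ℤ) : Levi q := mk q (Parabolic.glike q m)

theorem sect_glike (m : ℤ × ℤ) :
    sect q (glike q m) = Sec₀.quotientMap q _ (Sec.mon q _ (m.1, 0, 0, m.2)) := by
  change Sec₀.quotientMap q _ (Parabolic.sect q (Parabolic.glike q m)) = _
  rw [Parabolic.glike_eq_mon, Parabolic.sect_mon]

theorem linearIndependent_glike : LinearIndependent ℂ (glike q) :=
  linearIndependent_of_single (Sec₀.ev q (chart_ne_bot 0) ∘ₗ (sect q).toLinearMap)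
    (f := fun m => ((m.1, 0, 0, m.2) : MonIndex))
    (fun m m' h => by simp only [Prod.mk.injEq, true_and] at h; exact Prod.ext h.1 h.2)
    fun m => ⟨1, by
      rw [LinearMap.comp_apply, AlgHom.toLinearMap_apply, sect_glike,
        Sec₀.ev_mon (chart_ne_bot 0) ⟨Parabolic.mem_monSet (m.1, 0, m.2), rfl⟩, one_smul]⟩

theorem span_glike : Submodule.span ℂ (Set.range (glike q)) = ⊤ := by
  rw [eq_top_iff, ← LinearMap.range_eq_top.2 (show Function.Surjective (mk q).toLinearMap from
    Ideal.Quotient.mk_surjective), ← Submodule.map_top, ← Parabolic.span_mon, Submodule.map_span,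
    Submodule.span_le]
  rintro _ ⟨_, ⟨m, rfl⟩, rfl⟩
  change mk q (Parabolic.mon q m) ∈ Submodule.span ℂ _
  by_cases hm : m.2.1 = 0
  · refine Submodule.subset_span ⟨(m.1, m.2.2), ?_⟩
    rw [glike, Parabolic.glike_eq_mon, ← hm]
  · rw [Parabolic.mon, map_mul, map_mul, map_pow, Parabolic.w, map_mul, mk_n, mul_zero,
      zero_pow hm, zero_mul, mul_zero]
    exact zero_mem _

/-- The basis of `H₀` that consists of the group-like monomials. -/
def basis (q : ℂˣ) : Module.Basis (ℤ × ℤ) ℂ (Levi q) :=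
  Module.Basis.mk linearIndependent_glike span_glike.ge

theorem basis_apply (m : ℤ × ℤ) : basis q m = glike q m := Module.Basis.mk_apply _ _ m

theorem comul_glike (m : ℤ × ℤ) :
    Coalgebra.comul (R := ℂ) (glike q m) = glike q m ⊗ₜ[ℂ] glike q m := by
  rw [glike, mk, Ideal.Quotient.mkₐ_eq_mk, Bialgebra.Quotient.comul_mk, Parabolic.comul_glike]
  rfl

theorem counit_glike (m : ℤ × ℤ) : Coalgebra.counit (R := ℂ) (glike q m) = 1 := by
  rw [glike, mk, Ideal.Quotient.mkₐ_eq_mk, Bialgebra.Quotient.counit_mk, Parabolic.counit_glike]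

end Levi

/-! ## Comodule algebras over `H` with a triangular coaction -/

section Triangular

open Parabolic

variable {q : ℂˣ} {A : Type} [Ring A] [Algebra ℂ A]

/-- The span of the tensors of low degree in `t⁻¹ n`. -/
def lowSpan (q : ℂˣ) (A : Type) [Ring A] [Algebra ℂ A] (k : ℕ) :
    Submodule ℂ (A ⊗[ℂ] Parabolic q) :=
  Submodule.span ℂ {y | ∃ b : A, ∃ m : ℤ × ℕ × ℤ, m.2.1 < k ∧ y = b ⊗ₜ[ℂ] mon q m}

theorem mul_mem_lowSpan {h : Parabolic q} {f : ℤ × ℕ × ℤ → ℤ × ℕ × ℤ} {k k' : ℕ}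
    (hh : ∀ m, ∃ r : ℂˣ, h * mon q m = r • mon q (f m))
    (hf : ∀ m : ℤ × ℕ × ℤ, m.2.1 < k → (f m).2.1 < k') (b : A) {y : A ⊗[ℂ] Parabolic q}
    (hy : y ∈ lowSpan q A k) : b ⊗ₜ[ℂ] h * y ∈ lowSpan q A k' := by
  induction hy using Submodule.span_induction with
  | mem y hy =>
    obtain ⟨b', m, hm, rfl⟩ := hy
    obtain ⟨r, hr⟩ := hh m
    rw [Algebra.TensorProduct.tmul_mul_tmul, hr, Units.smul_def, TensorProduct.tmul_smul]
    exact Submodule.smul_mem _ _ (Submodule.subset_span ⟨_, _, hf m hm, rfl⟩)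
  | zero => rw [mul_zero]; exact zero_mem _
  | add x y _ _ hx hy => rw [mul_add]; exact add_mem hx hy
  | smul r x _ hx => rw [mul_smul_comm]; exact Submodule.smul_mem _ _ hx

theorem zp_t_mul_mon (i : ℤ) (m : ℤ × ℕ × ℤ) :
    zp (t q) (tinv q) i * mon q m = mon q (i + m.1, m.2) := by
  rw [mon, mon, ← mul_assoc]
  have h := fun i => zp_units (⟨t q, tinv q, t_tinv, tinv_t⟩ : (Parabolic q)ˣ) i
  simp only [Units.inv_mk] at h
  rw [h, h, h, zpow_add, Units.val_mul]

variable (δ : RightCoaction ℂ (Parabolic q) A) {u D : Aˣ} {x : A}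
  (hu : δ.toAlgHom (u : A) = (u : A) ⊗ₜ t q)
  (hu' : δ.toAlgHom ((u⁻¹ : Aˣ) : A) = ((u⁻¹ : Aˣ) : A) ⊗ₜ tinv q)
  (hD : δ.toAlgHom (D : A) = (D : A) ⊗ₜ (t q * s q))
  (hD' : δ.toAlgHom ((D⁻¹ : Aˣ) : A) = ((D⁻¹ : Aˣ) : A) ⊗ₜ e q)
  (hx : δ.toAlgHom x = 1 ⊗ₜ (tinv q * n q) + x ⊗ₜ (tinv q * s q))

include hD hD' hx in
-- Each factor x contributes 1 ⊗ w, which raises the degree in w by one, or x ⊗ t⁻¹s, which keeps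
-- it. Degree k is reached only by taking the first summand every time, and this yields D^l ⊗ w^k
-- (ts)^l.
theorem coaction_pow_mul_sub_mem (k : ℕ) (l : ℤ) :
    δ.toAlgHom (x ^ k * (D ^ l : Aˣ)) - ((D ^ l : Aˣ) : A) ⊗ₜ mon q (0, k, l) ∈
      lowSpan q A k := by
  induction k with
  | zero =>
    rw [pow_zero, one_mul, ← zp_units, map_zp, hD, hD', zp_tmul, mon, zp_zero, pow_zero, one_mul,
      one_mul, sub_self]
    exact zero_mem _
  | succ k ih =>
    set y := δ.toAlgHom (x ^ k * (D ^ l : Aˣ)) - ((D ^ l : Aˣ) : A) ⊗ₜ mon q (0, k, l) with hy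
    have hy' : δ.toAlgHom (x ^ k * (D ^ l : Aˣ)) = y + ((D ^ l : Aˣ) : A) ⊗ₜ mon q (0, k, l) := by
      rw [hy, sub_add_cancel]
    have hw : (tinv q * n q) * mon q (0, k, l) = mon q (0, k + 1, l) := by
      simp only [mon, zp_zero, one_mul, pow_succ', mul_assoc, w]
    -- After the leading term is removed, three products remain: w times the lower terms, t⁻¹s times
    -- the lower terms, and t⁻¹s times the old leading term. All have degree below k + 1.
    have h1 : δ.toAlgHom (x ^ (k + 1) * (D ^ l : Aˣ)) -
        ((D ^ l : Aˣ) : A) ⊗ₜ mon q (0, k + 1, l) =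
        (1 : A) ⊗ₜ w q * y + (x ⊗ₜ (tinv q * s q) * y +
          x ⊗ₜ (tinv q * s q) * ((D ^ l : Aˣ) : A) ⊗ₜ mon q (0, k, l)) := by
      rw [pow_succ', mul_assoc, map_mul, hy', hx, add_mul, mul_add, mul_add,
        Algebra.TensorProduct.tmul_mul_tmul 1, hw, one_mul, w]
      abel
    rw [h1]
    refine add_mem (mul_mem_lowSpan w_mul_mon (fun m hm => Nat.succ_lt_succ hm) _ ih)
      (add_mem (mul_mem_lowSpan tinv_s_mul_mon (fun m hm => Nat.lt_succ_of_lt hm) _ ih) ?_)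
    refine mul_mem_lowSpan (k := k + 1) tinv_s_mul_mon (fun m hm => hm) _ ?_
    exact Submodule.subset_span ⟨_, _, Nat.lt_succ_self k, rfl⟩

include hu hu' hD hD' hx in
theorem coaction_mon_sub_mem (m : ℤ × ℕ × ℤ) :
    δ.toAlgHom ((u ^ m.1 : Aˣ) * (x ^ m.2.1 * (D ^ m.2.2 : Aˣ))) -
      ((u ^ m.1 * D ^ m.2.2 : Aˣ) : A) ⊗ₜ mon q m ∈ lowSpan q A m.2.1 := by
  have h : δ.toAlgHom ((u ^ m.1 : Aˣ) : A) = ((u ^ m.1 : Aˣ) : A) ⊗ₜ zp (t q) (tinv q) m.1 := by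
    rw [← zp_units, map_zp, hu, hu', zp_tmul]
  have h2 : ((u ^ m.1 * D ^ m.2.2 : Aˣ) : A) ⊗ₜ mon q m =
      ((u ^ m.1 : Aˣ) : A) ⊗ₜ[ℂ] zp (t q) (tinv q) m.1 *
        ((D ^ m.2.2 : Aˣ) : A) ⊗ₜ mon q (0, m.2) := by
    rw [Algebra.TensorProduct.tmul_mul_tmul, zp_t_mul_mon, add_zero, Units.val_mul]
  rw [map_mul, h, h2, ← mul_sub]
  exact mul_mem_lowSpan (f := fun m' => (m.1 + m'.1, m'.2))
    (fun m' => ⟨1, by rw [one_smul]; exact zp_t_mul_mon _ m'⟩) (fun m hm => hm) _ (coaction_pow_mul_sub_mem δ hD hD' hx m.2.1 m.2.2)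

include hu hu' hD hD' hx in
theorem eq_zero_of_coaction_mon (a : (ℤ × ℕ × ℤ) →₀ A)
    (ha : (a.sum fun m y => y ⊗ₜ[ℂ] (1 : Parabolic q) *
      δ.toAlgHom ((u ^ m.1 : Aˣ) * (x ^ m.2.1 * (D ^ m.2.2 : Aˣ)))) = 0) : a = 0 := by
  refine δ.eq_zero_of_triangular
    (e := fun m : ℤ × ℕ × ℤ => (u ^ m.1 : Aˣ) * (x ^ m.2.1 * (D ^ m.2.2 : Aˣ)))
    (Parabolic.basis q) (fun m => m.2.1) (fun m => u ^ m.1 * D ^ m.2.2) (fun m => ?_) a ha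
  simp only [basis_apply]
  exact coaction_mon_sub_mem δ hu hu' hD hD' hx m

include hu hu' hD hD' hx in
-- A unit y with δ(y) = y ⊗ h gives 1 ⊗ h as the image of y⁻¹ ⊗ y, which covers t, t⁻¹, ts and its
-- inverse. The remaining generator comes from 1 ⊗ t⁻¹n = δ(x) − (x ⊗ 1)(1 ⊗ t⁻¹s).
theorem canonicalMap_surjective_of_triangular : Function.Surjective δ.canonicalMap := by
  have key : ∀ (y : Aˣ) (h : Parabolic q), δ.toAlgHom (y : A) = (y : A) ⊗ₜ h →
      (1 : A) ⊗ₜ[ℂ] h ∈ δ.canonicalMap.range := fun y h hy =>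
    ⟨QuotientAddGroup.mk (((y⁻¹ : Aˣ) : A) ⊗ₜ[ℤ] (y : A)), by
      rw [δ.canonicalMap_mk, hy, Algebra.TensorProduct.tmul_mul_tmul, Units.inv_mul, one_mul]⟩
  have ht := key _ _ hu
  have ht' := key _ _ hu'
  have hts := key _ _ hD
  have he := key _ _ hD'
  have hw : (1 : A) ⊗ₜ[ℂ] (tinv q * n q) ∈ δ.canonicalMap.range := by
    have h1 : δ.toAlgHom x ∈ δ.canonicalMap.range :=
      ⟨QuotientAddGroup.mk (1 ⊗ₜ[ℤ] x), by
        rw [δ.canonicalMap_mk, ← Algebra.TensorProduct.one_def, one_mul]⟩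
    have h2 := δ.mul_mem_range_canonicalMap_of_mem ht'
      (δ.mul_mem_range_canonicalMap_of_mem ht' hts)
    rw [Algebra.TensorProduct.tmul_mul_tmul, Algebra.TensorProduct.tmul_mul_tmul, one_mul, one_mul,
      ← tinv_s] at h2
    have h3 := δ.mul_mem_range_canonicalMap h2 x 1
    rw [map_one, mul_one, Algebra.TensorProduct.tmul_mul_tmul, one_mul, mul_one] at h3
    rw [eq_sub_of_add_eq hx.symm]
    exact sub_mem h1 h3
  refine δ.canonicalMap_surjective (Set.range (projGen q)) ?_ ?_
  · rw [eq_top_iff]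
    rintro y -
    obtain ⟨y, rfl⟩ := proj_surjective y
    induction y using Sec.induction with
    | hC r => rw [AlgHom.commutes]; exact Subalgebra.algebraMap_mem _ r
    | hg g => rw [proj_gen]; exact Algebra.subset_adjoin ⟨g, rfl⟩
    | hm x y hx hy => rw [map_mul]; exact mul_mem hx hy
    | ha x y hx hy => rw [map_add]; exact add_mem hx hy
  · rintro _ ⟨g, rfl⟩
    cases g with
    | a => exact ht
    | c => rw [projGen, TensorProduct.tmul_zero]; exact zero_mem _
    | x => exact hw
    | D => exact hts
    | Dinv => exact he
    | ainv h => exact ht'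
    | cinv h => exact absurd h (chart_not_le zero_ne_one)

end Triangular

/-! ## The Hopf algebra `H` as an `H₀`-comodule algebra -/

namespace Parabolic

variable {q : ℂˣ}

/-- The group-like monomials as units. -/
def glikeUnit (q : ℂˣ) (m : ℤ × ℤ) : (Parabolic q)ˣ :=
  ⟨t q, tinv q, t_tinv, tinv_t⟩ ^ m.1 * ⟨t q * s q, e q, ts_e, e_ts⟩ ^ m.2

theorem glikeUnit_val (m : ℤ × ℤ) : (glikeUnit q m : Parabolic q) = glike q m := by
  rw [glikeUnit, Units.val_mul, ← zp_units, ← zp_units]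
  rfl

theorem w_pow_mul_glike (n : ℕ) (m : ℤ × ℤ) :
    ∃ r : ℂˣ, w q ^ n * glike q m = r • mon q (m.1, n, m.2) := by
  induction n with
  | zero => exact ⟨1, by rw [pow_zero, one_mul, one_smul, glike_eq_mon]⟩
  | succ n ih =>
    obtain ⟨r, hr⟩ := ih
    obtain ⟨r', hr'⟩ := w_mul_mon (q := q) (m.1, n, m.2)
    exact ⟨r * r', by rw [pow_succ', mul_assoc, hr, mul_smul_comm, hr', smul_smul]⟩

theorem linearIndependent_w_pow_mul_glike :
    LinearIndependent ℂ (fun m : ℕ × ℤ × ℤ => w q ^ m.1 * glike q m.2) :=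
  linearIndependent_of_single (basis q).repr.toLinearMap
    (f := fun m => ((m.2.1, m.1, m.2.2) : ℤ × ℕ × ℤ))
    (fun m m' h => by
      simp only [Prod.mk.injEq] at h
      exact Prod.ext h.2.1 (Prod.ext h.1 h.2.2))
    fun m => by
      obtain ⟨r, hr⟩ := w_pow_mul_glike (q := q) m.1 m.2
      refine ⟨r, ?_⟩
      rw [hr, ← basis_apply, Units.smul_def, map_smul, Units.smul_def]
      simp

theorem span_w_pow_mul_glike :
    ⊤ ≤ Submodule.span ℂ (Set.range fun m : ℕ × ℤ × ℤ => w q ^ m.1 * glike q m.2) := by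
  rw [← span_mon, Submodule.span_le]
  rintro _ ⟨m, rfl⟩
  obtain ⟨r, hr⟩ := w_pow_mul_glike (q := q) m.2.1 (m.1, m.2.2)
  have : mon q m = (r⁻¹ : ℂˣ) • (w q ^ m.2.1 * glike q (m.1, m.2.2)) := by
    rw [hr, inv_smul_smul]
  rw [this]
  exact Submodule.smul_mem _ _ (Submodule.subset_span ⟨(m.2.1, m.1, m.2.2), rfl⟩)

/-- Image under the projection F(U₁) → H of the fact that x commutes up to a scalar with monomials.
-/
theorem glike_mul_w (m : ℤ × ℤ) : QCommute (glike q m) (w q) := by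
  have h : QCommute (Sec.gen q (SecGen.x : SecGen (chart 0))) (Sec.mon q _ (m.1, 0, 0, m.2)) := by
    rw [Sec.mon]
    refine (Sec.QCommute_zpa Sec.qcommute_ax.symm _).mul_right
      ((Sec.QCommute_zpc Sec.qcommute_cx.symm _).mul_right ?_)
    exact ((QCommute.refl _).pow_right _).mul_right (Sec.QCommute_zpD Sec.qcommute_xD _)
  have h2 := (h.map (proj q)).symm
  rw [proj_gen, proj_mon (m.1, 0, m.2), ← glike_eq_mon] at h2
  exact h2

/-- H is free over ℂ[w], w = t⁻¹n, on the units t^j (ts)^l, whose classes form the group-like basis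
of H₀. The element w is coinvariant: in its coproduct t⁻¹t ⊗ t⁻¹n + t⁻¹n ⊗ t⁻¹s the second term dies
with n. -/
theorem isPrincipal_quotientLeftCoaction (q : ℂˣ) :
    (quotientLeftCoaction ℂ (leviIdeal q)).IsPrincipal := by
  have hδ : ∀ y : Parabolic q, (quotientLeftCoaction ℂ (leviIdeal q)).toAlgHom y =
      Algebra.TensorProduct.map (Levi.mk q) (AlgHom.id ℂ (Parabolic q))
        (Coalgebra.comul (R := ℂ) y) := fun _ => rfl
  refine (quotientLeftCoaction ℂ (leviIdeal q)).isPrincipal_of_groupLike (z := w q) (Levi.basis q)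
    (glikeUnit q) (κ₀ := 0) ?_ ?_ (fun m => ?_) ?_ ?_ ?_ (fun m => ?_)
  · simp [glikeUnit]
  · rw [Levi.basis_apply, Levi.glike, glike]
    simp
  · rw [glikeUnit_val, hδ, comul_glike, Levi.basis_apply]
    rfl
  · change (quotientLeftCoaction ℂ (leviIdeal q)).toAlgHom (w q) = 1 ⊗ₜ w q
    have hst : Levi.mk q (tinv q) * Levi.mk q (t q) = 1 := by rw [← map_mul, tinv_t, map_one]
    rw [hδ, w, Bialgebra.comul_mul, comul_tinv, comul_n, mul_add,
      Algebra.TensorProduct.tmul_mul_tmul, Algebra.TensorProduct.tmul_mul_tmul, map_add,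
      Algebra.TensorProduct.map_tmul, Algebra.TensorProduct.map_tmul, map_mul, hst, map_mul (Levi.mk q),
      Levi.mk_n, mul_zero, TensorProduct.zero_tmul, add_zero]
    rfl
  · simpa only [glikeUnit_val] using linearIndependent_w_pow_mul_glike
  · simpa only [glikeUnit_val] using span_w_pow_mul_glike
  · rw [glikeUnit_val]
    exact glike_mul_w m

end Parabolic

/-! ## Local trivializations of `F` and `F₀` -/

namespace Sec

open SecGen

variable {q : ℂˣ} {U : Opens projLine}

/-- The unit `D`. -/
def unitD (q : ℂˣ) (U : Opens projLine) : (Sec q U)ˣ :=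
  ⟨gen q D, gen q Dinv, D_mul_Dinv, Dinv_mul_D⟩

end Sec

theorem QCommute.zpow_right {A : Type} [Ring A] [Algebra ℂ A] {y : A} {u : Aˣ}
    (h : QCommute y (u : A)) (i : ℤ) : QCommute y ((u ^ i : Aˣ) : A) := by
  rw [← zp_units]
  exact h.zp_right (h.inv_right u.mul_inv u.inv_mul) i

open Sec SecGen in
/-- A coordinate `z` on `U` and a unit `u` over `U` such that the products `z ^ n * u ^ j * x ^ k *
D ^ l` are, up to nonzero scalars, the monomials over `U`. -/
structure Trivialization (q : ℂˣ) (U : Opens projLine) where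
  /-- the coordinate -/
  z : Sec q U
  /-- the unit -/
  u : (Sec q U)ˣ
  /-- the exponents of the monomials -/
  idx : ℕ × ℤ × ℕ × ℤ → MonIndex
  ne_bot : U ≠ ⊥
  coaction_u : coactionHom q U (u : Sec q U) = (u : Sec q U) ⊗ₜ Parabolic.t q
  coaction_uinv : coactionHom q U ((u⁻¹ : (Sec q U)ˣ) : Sec q U) =
    ((u⁻¹ : (Sec q U)ˣ) : Sec q U) ⊗ₜ Parabolic.tinv q
  coaction_z : coactionHom q U z = z ⊗ₜ 1
  idx_injective : Function.Injective idx
  idx_mem : ∀ m, idx m ∈ monSet U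
  exists_idx : ∀ m ∈ monSet U, ∃ m', idx m' = m
  idx_x : ∀ m, (idx m).2.2.1 = m.2.2.1
  pow_mul : ∀ m, ∃ r : ℂˣ, z ^ m.1 * ((u ^ m.2.1 : (Sec q U)ˣ) * (gen q (x : SecGen U) ^ m.2.2.1 *
    (unitD q U ^ m.2.2.2 : (Sec q U)ˣ))) = r • mon q U (idx m)
  qcommute_u : QCommute z (u : Sec q U)
  qcommute_x : QCommute z (gen q x)
  qcommute_D : QCommute z (gen q D)

namespace Trivialization

open Sec SecGen

variable {q : ℂˣ} {U : Opens projLine} (T : Trivialization q U)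

/-- The elements `u ^ j * x ^ k * D ^ l`. -/
def elt (m : ℤ × ℕ × ℤ) : Sec q U :=
  (T.u ^ m.1 : (Sec q U)ˣ) * (gen q (x : SecGen U) ^ m.2.1 * (unitD q U ^ m.2.2 : (Sec q U)ˣ))

theorem elt_zero : T.elt 0 = 1 := by simp [elt]

theorem linearIndependent_elt : LinearIndependent ℂ
    (fun m : ℕ × ℤ × ℕ × ℤ => T.z ^ m.1 * T.elt m.2) :=
  linearIndependent_of_single (Sec.ev q 1 T.ne_bot) T.idx_injective fun m => by
    obtain ⟨r, hr⟩ := T.pow_mul m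
    refine ⟨r, ?_⟩
    rw [elt, hr, Units.smul_def, map_smul, Sec.ev_mon 1 T.ne_bot (T.idx_mem m), one_pow,
      Units.smul_def]

theorem span_elt : ⊤ ≤ Submodule.span ℂ
    (Set.range fun m : ℕ × ℤ × ℕ × ℤ => T.z ^ m.1 * T.elt m.2) := by
  rw [← Sec.span_mon q U, Submodule.span_le]
  rintro _ ⟨m, rfl⟩
  by_cases hm : m ∈ monSet U
  · obtain ⟨m, rfl⟩ := T.exists_idx m hm
    obtain ⟨r, hr⟩ := T.pow_mul m
    have : mon q U (T.idx m) = (r⁻¹ : ℂˣ) • (T.z ^ m.1 * T.elt m.2) := by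
      rw [elt, hr, inv_smul_smul]
    rw [this]
    exact Submodule.smul_mem _ _ (Submodule.subset_span ⟨m, rfl⟩)
  · rw [mon_eq_zero hm]
    exact zero_mem _

theorem qcommute_elt (m : ℤ × ℕ × ℤ) : QCommute T.z (T.elt m) :=
  (T.qcommute_u.zpow_right _).mul_right ((T.qcommute_x.pow_right _).mul_right
    (QCommute.zpow_right (u := unitD q U) T.qcommute_D _))

theorem coaction_x : (Sec.coaction q U).toAlgHom (gen q x) =
    1 ⊗ₜ (Parabolic.tinv q * Parabolic.n q) + gen q x ⊗ₜ (Parabolic.tinv q * Parabolic.s q) :=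
  coactionHom_gen _

theorem eq_zero_of_coaction_elt (a : (ℤ × ℕ × ℤ) →₀ Sec q U)
    (ha : (a.sum fun m y => y ⊗ₜ[ℂ] (1 : Parabolic q) *
      (Sec.coaction q U).toAlgHom (T.elt m)) = 0) : a = 0 :=
  eq_zero_of_coaction_mon (Sec.coaction q U) (u := T.u) (D := unitD q U) (x := gen q x)
    T.coaction_u T.coaction_uinv (coactionHom_gen _) (coactionHom_gen _) coaction_x a ha

theorem coinvariants_eq : (Sec.coaction q U).coinvariants = Algebra.adjoin ℂ {T.z} :=
  (Sec.coaction q U).coinvariants_eq_adjoin T.elt_zero T.coaction_z T.linearIndependent_elt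
    T.span_elt T.eq_zero_of_coaction_elt

include T in
theorem isPrincipal : (Sec.coaction q U).IsPrincipal :=
  (Sec.coaction q U).isPrincipal_of_basis T.elt_zero T.coaction_z T.linearIndependent_elt
    T.span_elt (fun m => (T.qcommute_elt m).symm) T.eq_zero_of_coaction_elt
    (canonicalMap_surjective_of_triangular (Sec.coaction q U) (u := T.u) (D := unitD q U)
      (x := gen q x) T.coaction_u T.coaction_uinv (coactionHom_gen _) (coactionHom_gen _)
      coaction_x)

theorem linearIndependent_z_pow : LinearIndependent ℂ (fun n : ℕ => T.z ^ n) := by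
  have := T.linearIndependent_elt.comp (fun n : ℕ => (n, (0 : ℤ × ℕ × ℤ)))
    fun m n h => congrArg Prod.fst h
  simpa [Function.comp_def, elt_zero] using this

/-! The sheaf `F₀` -/

/-- The units `u ^ j * D ^ l` of the sections of `F₀`. -/
def unit (m : ℤ × ℤ) : (Sec₀ q U)ˣ :=
  Units.map (Sec₀.quotientMap q U : Sec q U →* Sec₀ q U) (T.u ^ m.1 * unitD q U ^ m.2)

theorem unit_val (m : ℤ × ℤ) :
    (T.unit m : Sec₀ q U) = Sec₀.quotientMap q U (T.elt (m.1, 0, m.2)) := by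
  rw [elt, pow_zero, one_mul]
  rfl

theorem unit_zero : T.unit 0 = 1 := by simp [unit]

theorem z_pow_mul_unit (m : ℕ × ℤ × ℤ) : ∃ r : ℂˣ,
    Sec₀.quotientMap q U T.z ^ m.1 * (T.unit m.2 : Sec₀ q U) =
      r • Sec₀.quotientMap q U (mon q U (T.idx (m.1, m.2.1, 0, m.2.2))) := by
  obtain ⟨r, hr⟩ := T.pow_mul (m.1, m.2.1, 0, m.2.2)
  refine ⟨r, ?_⟩
  rw [unit_val, ← map_pow, ← map_mul, elt, hr, Units.smul_def, map_smul, Units.smul_def]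

theorem linearIndependent_unit : LinearIndependent ℂ
    (fun m : ℕ × ℤ × ℤ => Sec₀.quotientMap q U T.z ^ m.1 * (T.unit m.2 : Sec₀ q U)) :=
  linearIndependent_of_single (Sec₀.ev q T.ne_bot)
    (f := fun m => T.idx (m.1, m.2.1, 0, m.2.2)) (fun m m' h => by
      have := T.idx_injective h
      simp only [Prod.mk.injEq, true_and] at this
      exact Prod.ext this.1 (Prod.ext this.2.1 this.2.2)) fun m => by
    obtain ⟨r, hr⟩ := T.z_pow_mul_unit m
    refine ⟨r, ?_⟩
    rw [hr, Units.smul_def, map_smul, Sec₀.ev_mon T.ne_bot ⟨T.idx_mem _, T.idx_x _⟩,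
      Units.smul_def]

theorem span_unit : ⊤ ≤ Submodule.span ℂ (Set.range
    fun m : ℕ × ℤ × ℤ => Sec₀.quotientMap q U T.z ^ m.1 * (T.unit m.2 : Sec₀ q U)) := by
  rw [← Sec₀.span_mon q U, Submodule.span_le]
  rintro _ ⟨m, rfl⟩
  by_cases hm : m ∈ Sec₀.monSet U
  · obtain ⟨m', rfl⟩ := T.exists_idx m hm.1
    obtain ⟨n, j, k, l⟩ := m'
    -- Reindexing preserves the exponent of x, so the monomials without x correspond to the products
    -- without x.
    obtain rfl : k = 0 := (T.idx_x _).symm.trans hm.2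
    obtain ⟨r, hr⟩ := T.z_pow_mul_unit (n, j, l)
    have : Sec₀.quotientMap q U (mon q U (T.idx (n, j, 0, l))) = (r⁻¹ : ℂˣ) •
        (Sec₀.quotientMap q U T.z ^ n * (T.unit (j, l) : Sec₀ q U)) := by
      rw [hr, inv_smul_smul]
    change Sec₀.quotientMap q U (mon q U (T.idx (n, j, 0, l))) ∈ Submodule.span ℂ _
    rw [this]
    exact Submodule.smul_mem _ _ (Submodule.subset_span ⟨(n, j, l), rfl⟩)
  · change Sec₀.quotientMap q U (mon q U m) ∈ Submodule.span ℂ _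
    rw [Sec₀.quotientMap_mon_eq_zero hm]
    exact zero_mem _

theorem qcommute_unit (m : ℤ × ℤ) :
    QCommute (Sec₀.quotientMap q U T.z) (T.unit m : Sec₀ q U) := by
  rw [unit_val]
  exact (T.qcommute_elt _).map _

theorem coaction_quotientMap (y : Sec q U) : (Sec₀.coaction q U).toAlgHom
    (Sec₀.quotientMap q U y) = Algebra.TensorProduct.map (Sec₀.quotientMap q U) (Levi.mk q)
      ((Sec.coaction q U).toAlgHom y) := rfl

theorem coaction_unit (m : ℤ × ℤ) : (Sec₀.coaction q U).toAlgHom (T.unit m : Sec₀ q U) =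
    (T.unit m : Sec₀ q U) ⊗ₜ Levi.basis q m := by
  have hu : (Sec.coaction q U).toAlgHom ((T.u ^ m.1 : (Sec q U)ˣ) : Sec q U) =
      ((T.u ^ m.1 : (Sec q U)ˣ) : Sec q U) ⊗ₜ zp (Parabolic.t q) (Parabolic.tinv q) m.1 := by
    rw [← zp_units, ← Parabolic.zp_tmul, map_zp]
    exact congrArg₂ (fun a b => zp a b m.1) T.coaction_u T.coaction_uinv
  have hD : (Sec.coaction q U).toAlgHom ((unitD q U ^ m.2 : (Sec q U)ˣ) : Sec q U) =
      ((unitD q U ^ m.2 : (Sec q U)ˣ) : Sec q U) ⊗ₜ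
        zp (Parabolic.t q * Parabolic.s q) (Parabolic.e q) m.2 := by
    rw [← zp_units, ← Parabolic.zp_tmul, map_zp]
    exact congrArg₂ (fun a b => zp a b m.2) (coactionHom_gen D) (coactionHom_gen Dinv)
  rw [unit_val, coaction_quotientMap, elt, pow_zero, one_mul, map_mul, hu, hD,
    Algebra.TensorProduct.tmul_mul_tmul, Algebra.TensorProduct.map_tmul, Levi.basis_apply]
  rfl

theorem quotientMap_z_mem : Sec₀.quotientMap q U T.z ∈ (Sec₀.coaction q U).coinvariants := by
  change (Sec₀.coaction q U).toAlgHom (Sec₀.quotientMap q U T.z) = _ ⊗ₜ 1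
  rw [coaction_quotientMap]
  exact (congrArg _ T.coaction_z).trans (by
    rw [Algebra.TensorProduct.map_tmul, map_one])

theorem eq_zero_of_coaction_unit (a : (ℤ × ℤ) →₀ Sec₀ q U)
    (ha : (a.sum fun m y => y ⊗ₜ[ℂ] (1 : Levi q) *
      (Sec₀.coaction q U).toAlgHom (T.unit m : Sec₀ q U)) = 0) : a = 0 :=
  (Sec₀.coaction q U).eq_zero_of_groupLike (Levi.basis q) T.unit T.coaction_unit a ha

theorem coinvariants_eq₀ :
    (Sec₀.coaction q U).coinvariants = Algebra.adjoin ℂ {Sec₀.quotientMap q U T.z} :=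
  (Sec₀.coaction q U).coinvariants_eq_adjoin (e := fun m => (T.unit m : Sec₀ q U)) (κ₀ := 0)
    (by rw [unit_zero, Units.val_one]) T.quotientMap_z_mem T.linearIndependent_unit
    T.span_unit T.eq_zero_of_coaction_unit

include T in
theorem isPrincipal₀ : (Sec₀.coaction q U).IsPrincipal :=
  (Sec₀.coaction q U).isPrincipal_of_basis (e := fun m => (T.unit m : Sec₀ q U)) (κ₀ := 0)
    (by rw [unit_zero, Units.val_one]) T.quotientMap_z_mem T.linearIndependent_unit
    T.span_unit (fun m => (T.qcommute_unit m).symm) T.eq_zero_of_coaction_unit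
    ((Sec₀.coaction q U).canonicalMap_surjective_of_groupLike (Levi.basis q) T.unit
      T.coaction_unit)

include T in
theorem isCleft₀ : (Sec₀.coaction q U).IsCleft :=
  (Sec₀.coaction q U).isCleft_of_groupLike (Levi.basis q) T.unit
    (fun m => by rw [Levi.basis_apply, Levi.comul_glike])
    (fun m => by rw [Levi.basis_apply, Levi.counit_glike]) T.coaction_unit

theorem linearIndependent_quotientMap_z_pow :
    LinearIndependent ℂ (fun n : ℕ => Sec₀.quotientMap q U T.z ^ n) := by
  have := T.linearIndependent_unit.comp (fun n : ℕ => (n, (0 : ℤ × ℤ)))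
    fun m n h => congrArg Prod.fst h
  simpa [Function.comp_def, unit_zero] using this

/-- The trivialization over the first chart. -/
def zero (q : ℂˣ) : Trivialization q (chart 0) where
  z := gen q c * gen q (ainv le_rfl)
  u := ⟨gen q a, gen q (ainv le_rfl), a_mul_ainv _, ainv_mul_a _⟩
  -- Up to a scalar, (c a⁻¹)^n a^j is a^(j−n) c^n.
  idx m := (m.2.1 - m.1, m.1, m.2.2)
  ne_bot := chart_ne_bot 0
  coaction_u := coactionHom_gen _
  coaction_uinv := coactionHom_gen _
  coaction_z := by
    rw [map_mul, coactionHom_gen, coactionHom_gen, coactionGen, coactionGen,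
      Algebra.TensorProduct.tmul_mul_tmul, Parabolic.t_tinv]
  idx_injective := by
    rintro ⟨n, j, m⟩ ⟨n', j', m'⟩ h
    simp only [Prod.mk.injEq, Nat.cast_inj] at h ⊢
    exact ⟨h.2.1, by omega, h.2.2⟩
  idx_mem m := ⟨Or.inl le_rfl, Or.inr (Int.natCast_nonneg _)⟩
  exists_idx := by
    rintro ⟨i, j, m⟩ ⟨-, hj⟩
    obtain ⟨n, rfl⟩ := Int.eq_ofNat_of_zero_le (hj.resolve_left (chart_not_le zero_ne_one))
    exact ⟨(n, i + n, m), by simp⟩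
  idx_x _ := rfl
  pow_mul := by
    rintro ⟨n, j, k, l⟩
    induction n with
    | zero =>
      refine ⟨1, ?_⟩
      rw [pow_zero, one_mul, one_smul, ← zp_units, ← zp_units]
      simp [mon, ainv₀_eq le_rfl, unitD]
    | succ n ih =>
      obtain ⟨r, hr⟩ := ih
      obtain ⟨s, hs⟩ := c_mul_mon (q := q) (U := chart 0) (m := (j - n - 1, n, k, l))
        (Or.inr (Int.natCast_nonneg n))
      refine ⟨r * s, ?_⟩
      rw [pow_succ', mul_assoc, hr, mul_smul_comm, mul_assoc, ainv_mul_mon, hs, smul_smul]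
      simp [sub_sub]
  qcommute_u := qcommute_ac.symm.mul_left
    ((QCommute.refl _).inv_right (a_mul_ainv le_rfl) (ainv_mul_a le_rfl)).symm
  qcommute_x := qcommute_cx.mul_left
    (qcommute_ax.symm.inv_right (a_mul_ainv le_rfl) (ainv_mul_a le_rfl)).symm
  qcommute_D := qcommute_cD.mul_left
    (qcommute_aD.symm.inv_right (a_mul_ainv le_rfl) (ainv_mul_a le_rfl)).symm

/-- The trivialization over the second chart. -/
def one (q : ℂˣ) : Trivialization q (chart 1) where
  z := gen q a * gen q (cinv le_rfl)
  u := ⟨gen q c, gen q (cinv le_rfl), c_mul_cinv _, cinv_mul_c _⟩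
  -- Up to a scalar, (a c⁻¹)^n c^j is a^n c^(j−n).
  idx m := (m.1, m.2.1 - m.1, m.2.2)
  ne_bot := chart_ne_bot 1
  coaction_u := coactionHom_gen _
  coaction_uinv := coactionHom_gen _
  coaction_z := by
    rw [map_mul, coactionHom_gen, coactionHom_gen, coactionGen, coactionGen,
      Algebra.TensorProduct.tmul_mul_tmul, Parabolic.t_tinv]
  idx_injective := by
    rintro ⟨n, j, m⟩ ⟨n', j', m'⟩ h
    simp only [Prod.mk.injEq, Nat.cast_inj] at h ⊢
    exact ⟨h.1, by omega, h.2.2⟩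
  idx_mem m := ⟨Or.inr (Int.natCast_nonneg _), Or.inl le_rfl⟩
  exists_idx := by
    rintro ⟨i, j, m⟩ ⟨hi, -⟩
    obtain ⟨n, rfl⟩ := Int.eq_ofNat_of_zero_le (hi.resolve_left (chart_not_le one_ne_zero))
    exact ⟨(n, j + n, m), by simp⟩
  idx_x _ := rfl
  pow_mul := by
    rintro ⟨n, j, k, l⟩
    induction n with
    | zero =>
      refine ⟨1, ?_⟩
      rw [pow_zero, one_mul, one_smul, ← zp_units, ← zp_units]
      simp [mon, cinv₀_eq le_rfl, unitD]
    | succ n ih =>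
      obtain ⟨r, hr⟩ := ih
      obtain ⟨s, hs⟩ := cinv_mul_mon (q := q) (U := chart 1) le_rfl (n, j - n, k, l)
      refine ⟨r * s, ?_⟩
      rw [pow_succ', mul_assoc, hr, mul_smul_comm, mul_assoc, hs, mul_smul_comm,
        a_mul_mon (Or.inr (Int.natCast_nonneg n)), smul_smul]
      simp [sub_sub]
  qcommute_u := qcommute_ac.mul_left
    ((QCommute.refl _).inv_right (c_mul_cinv le_rfl) (cinv_mul_c le_rfl)).symm
  qcommute_x := qcommute_ax.mul_left
    (qcommute_cx.symm.inv_right (c_mul_cinv le_rfl) (cinv_mul_c le_rfl)).symm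
  qcommute_D := qcommute_aD.mul_left
    (qcommute_cD.symm.inv_right (c_mul_cinv le_rfl) (cinv_mul_c le_rfl)).symm

/-- The equation ties the algebra generating the coinvariants to the structure sheaf: the affine
coordinate of the chart is sent to z. -/
theorem exists_trivialization (q : ℂˣ) (i : Fin 2) :
    ∃ T : Trivialization q (chart i), embed q (chart i) (coord _ i le_rfl) = T.z := by
  fin_cases i
  · exact ⟨zero q, embed_coord_zero le_rfl⟩
  · exact ⟨one q, embed_coord_one le_rfl⟩

end Trivialization

/-! ## The bundles -/

section Bundles

variable (q : ℂˣ)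

theorem embed_injective_and_range (i : Fin 2) : Function.Injective (Sec.embed q (chart i)) ∧
    (Sec.embed q (chart i)).range = (Sec.coaction q (chart i)).coinvariants := by
  obtain ⟨T, hT⟩ := Trivialization.exists_trivialization q i
  rw [T.coinvariants_eq]
  exact injective_and_range_of_coord i _ hT T.linearIndependent_z_pow

theorem quotientMap_embed_injective_and_range (i : Fin 2) :
    Function.Injective ((Sec₀.quotientMap q _).comp (Sec.embed q (chart i))) ∧
    ((Sec₀.quotientMap q _).comp (Sec.embed q (chart i))).range =
      (Sec₀.coaction q (chart i)).coinvariants := by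
  obtain ⟨T, hT⟩ := Trivialization.exists_trivialization q i
  rw [T.coinvariants_eq₀]
  exact injective_and_range_of_coord i _ (congrArg (Sec₀.quotientMap q _) hT)
    T.linearIndependent_quotientMap_z_pow

theorem isQuantumPrincipalBundle_sheafF :
    IsQuantumPrincipalBundle structureSheaf (sheafF q) chart where
  antipode_bijective := (Function.Involutive.bijective Parabolic.antipode_antipode)
  base_isSheaf := structureSheaf_isSheaf
  isSheaf := sheafF_isSheaf q
  cover := iSup_chart
  coinvariants_eq := ⟨embedF q, embed_injective_and_range q⟩
  principal i := (Trivialization.exists_trivialization q i).choose.isPrincipal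

theorem isLocallyCleftQuantumPrincipalBundle_sheafF₀ :
    IsLocallyCleftQuantumPrincipalBundle structureSheaf (sheafF₀ q) chart where
  antipode_bijective := (Function.Involutive.bijective Levi.antipode_antipode)
  base_isSheaf := structureSheaf_isSheaf
  isSheaf := sheafF₀_isSheaf q
  cover := iSup_chart
  coinvariants_eq := ⟨embedF q ≫ quotientF q, quotientMap_embed_injective_and_range q⟩
  principal i := (Trivialization.exists_trivialization q i).choose.isPrincipal₀
  cleft i := (Trivialization.exists_trivialization q i).choose.isCleft₀

/-- Both algebras of coinvariants are images of the regular functions on the chart, and the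
embedding for F₀ is the one for F followed by the quotient map. -/
theorem map_coinvariants_quotientMap (i : Fin 2) :
    (Sec.coaction q (chart i)).coinvariants.map (Sec₀.quotientMap q _) =
      (Sec₀.coaction q (chart i)).coinvariants := by
  rw [← (embed_injective_and_range q i).2, ← (quotientMap_embed_injective_and_range q i).2,
    AlgHom.range_comp]

theorem isColinear_quotientMap (U : Opens projLine) :
    IsColinear (leviIdeal q) (Sec.coaction q U) (Sec₀.coaction q U) (Sec₀.quotientMap q U) := by
  rw [IsColinear, RightCoaction.induced, ← AlgHom.comp_assoc, ← Algebra.TensorProduct.map_comp]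
  rfl

theorem isAffineAlgebraicReduction_quotientMap (i : Fin 2) :
    IsAffineAlgebraicReduction (leviIdeal q) (Sec.coaction q (chart i))
      (Sec₀.coaction q (chart i)) (Sec₀.quotientMap q _) where
  principal := (Trivialization.exists_trivialization q i).choose.isPrincipal
  principal_quotient := Parabolic.isPrincipal_quotientLeftCoaction q
  principal_reduced := (Trivialization.exists_trivialization q i).choose.isPrincipal₀
  base_iso := by
    obtain ⟨h, h'⟩ := embed_injective_and_range q i
    obtain ⟨k, k'⟩ := quotientMap_embed_injective_and_range q i
    rw [← h', ← k']
    exact ⟨(AlgEquiv.ofInjective _ h).symm.trans (AlgEquiv.ofInjective _ k)⟩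
  colinear := isColinear_quotientMap q _
  surjective := Sec₀.quotientMap_surjective
  map_coinvariants := map_coinvariants_quotientMap q i

theorem isAlgebraicReduction_quotientF : IsAlgebraicReduction (leviIdeal q) structureSheaf
    (sheafF q) (sheafF₀ q) (quotientF q) chart where
  bundle := isQuantumPrincipalBundle_sheafF q
  bundle_reduced :=
    (isLocallyCleftQuantumPrincipalBundle_sheafF₀ q).toIsQuantumPrincipalBundle
  colinear := isColinear_quotientMap q
  map_coinvariants := map_coinvariants_quotientMap q
  affine := isAffineAlgebraicReduction_quotientMap q

end Bundles

end QuantumBundle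

end

theorem mainTheorem8 (q : ℂˣ) :
    -- `F₀` is a locally cleft quantum principal `H₀`-bundle for the cover `U₁, U₂`
    IsLocallyCleftQuantumPrincipalBundle structureSheaf (sheafF₀ q) chart ∧
    -- `F₀` is an algebraic reduction of `F`; the quotient maps commute with the restrictions
    (∃ φ : (sheafF q).presheaf ⟶ (sheafF₀ q).presheaf,
      (∀ U : Opens projLine, (φ.app (op U)).hom = Sec₀.quotientMap q U) ∧
      IsAlgebraicReduction (leviIdeal q) structureSheaf (sheafF q) (sheafF₀ q) φ chart) ∧
    -- `F(U₁) = A[a⁻¹]` with `x = a⁻¹ b`, as comodule algebras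
    (∃ i₁ : GL2 q →ₐ[ℂ] Sec q (chart 0),
      IsLocalizationAt i₁ (GL2.gen q GLGen.a) ∧
      i₁ (GL2.gen q GLGen.a) = Sec.gen q SecGen.a ∧
      i₁ (GL2.gen q GLGen.c) = Sec.gen q SecGen.c ∧
      i₁ (GL2.gen q GLGen.b) = Sec.gen q SecGen.a * Sec.gen q SecGen.x ∧
      i₁ (GL2.det q) = Sec.gen q SecGen.D ∧
      (Sec.coactionHom q (chart 0)).comp i₁ =
        (Algebra.TensorProduct.map i₁ (AlgHom.id ℂ (Parabolic q))).comp (coactionGL2 q)) ∧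
    -- `F(U₂) = A[c⁻¹]` with `y = c⁻¹ d`, as comodule algebras
    (∃ i₂ : GL2 q →ₐ[ℂ] Sec q (chart 1),
      IsLocalizationAt i₂ (GL2.gen q GLGen.c) ∧
      i₂ (GL2.gen q GLGen.a) = Sec.gen q SecGen.a ∧
      i₂ (GL2.gen q GLGen.c) = Sec.gen q SecGen.c ∧
      i₂ (GL2.gen q GLGen.d) = Sec.gen q SecGen.c * Sec.gen q SecGen.x ∧
      i₂ (GL2.det q) = Sec.gen q SecGen.D ∧
      (Sec.coactionHom q (chart 1)).comp i₂ =
        (Algebra.TensorProduct.map i₂ (AlgHom.id ℂ (Parabolic q))).comp (coactionGL2 q)) ∧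
    -- `F(U₁ ∩ U₂)` is the localization of `F(U₁)` at `c` and of `F(U₂)` at `a`
    IsLocalizationAt (Sec.res q (inf_le_left : chart 0 ⊓ chart 1 ≤ chart 0))
      (Sec.gen q SecGen.c) ∧
    IsLocalizationAt (Sec.res q (inf_le_right : chart 0 ⊓ chart 1 ≤ chart 1))
      (Sec.gen q SecGen.a) := by
  exact ⟨isLocallyCleftQuantumPrincipalBundle_sheafF₀ q,
    ⟨quotientF q, fun _ => rfl, isAlgebraicReduction_quotientF q⟩,
    ⟨Sec.fromGL₀ q, Sec.isLocalizationAt_fromGL₀, Sec.fromGL₀_gen .a, Sec.fromGL₀_gen .c,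
      Sec.fromGL₀_gen .b, Sec.fromGL₀_det, Sec.coactionHom_fromGL₀⟩,
    ⟨Sec.fromGL₁ q, Sec.isLocalizationAt_fromGL₁, Sec.fromGL₁_gen .a, Sec.fromGL₁_gen .c,
      Sec.fromGL₁_gen .d, Sec.fromGL₁_det, Sec.coactionHom_fromGL₁⟩,
    Sec.isLocalizationAt_res_zero, Sec.isLocalizationAt_res_one⟩
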